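/- **Model.** Let $Y_k=f(k/n)+e_k$, $k=1,\dots,n$, with $e_k$ i.i.d. $N(0,\sigma^2)$, $\sigma>0$ known. The kernel $K:\mathbb R\to[0,\infty)$ is symmetric, integrates to $1$, is supported in $[-1,1]$, is bounded by $K_{\max}$, is Lipschitz with constant $L_K>0$, and satisfies $K(u)\ge K_{\min}>0$ for $|u|\le\Delta$, for some $\Delta>0$. Put $\mu_2=\int K^2$, let $\lambda_0>0$, let $\kappa>1+2K_{\max}/\sqrt{\mu_2}$, $\alpha\in(0,1)$, $\beta\in(0,2]$ and $L>0$, and write $x_k=k/n$. **Classes.** $\Sigma(\beta,L)$ is the set of $f$ on $[0,1]$ that are $\lceil\beta\rceil-1$ times continuously differentiable with $|f^{(\lceil\beta\rceil-1)}(x)-f^{(\lceil\beta\rceil-1)}(y)|\le L|x-y|^{\beta-\lceil\beta\rceil+1}$. For $\beta\le1$, $\mathcal F_\beta(\delta)$ is the set of $f\in\Sigma(\beta,L)$ with $f(a)-f(b)\ge\delta$ for some $0\le a<b\le1$; for $\beta>1$ it is the set of $f\in\Sigma(\beta,L)$ with $f'(x)\le-\delta$ for some $x\in[0,1]$. Let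 $\varepsilon_{0,\gamma}(f)=\inf_g \mathrm{Leb}\{x\in[0,1]:|f(x)-g(x)|>\gamma\}$, the infimum over non-decreasing $g$ on $[0,1]$, and $\varepsilon_{1,\gamma}(f)=\mathrm{Leb}\{x\in[0,1]:f'(x)\le-\gamma\}$. Let $\Delta_{\beta,n}=(\log n/n)^{(\beta-\lceil\beta\rceil+1)/(2\beta+1)}$. **Estimator.** $\hat f_n(x;h)$ is the first coordinate of a minimiser $\theta\in\mathbb R^2$ of $\sum_{k=1}^n\bigl(Y_k-\theta_1-\theta_2\frac{x_k-x}{h}\bigr)^2K\bigl(\frac{x_k-x}{h}\bigr)$. At a design point it is computed from one pass over the data in the window of radius $h$. **Bandwidth selection (CALM)** on an index set $\mathcal A$. Let $h_m=4^{m-1}/n$, let $M$ be the integer part of $\frac45\log_4n+\frac15\log_4\log n$, let $G_2(m)=C_\rho\sqrt{\log n/(nh_m)}$ with $C_\rho=\sqrt{32\sigma^2\mu_2/\lambda_0^2}$. For $m=1,2,\dots,M$ compute the estimates $(\hat f_n(x_i;h_m))_{i\in\mathcal A}$ and stop as soon as $\max_{i\in\mathcal A}|\hat f_n(x_i;h_k)-\hat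 f_n(x_i;h_m)|>4\kappa G_2(k)$ for some $k<m$. Return the last $m$ before that, $\bar m$ ($\bar m=M$ if there is no stop), with its estimates and $h_{\bar m}$. **Indices.** Given $i\in\{1,\dots,n\}$, start with $\mathcal A=\{i\}$, $\mathcal P=\emptyset$. If $i<n$, repeat $\lceil20\log n\rceil$ times: for $k=0,\dots,\lceil\log_2(n-i)\rceil$ draw $J$ uniformly from $\{1,\dots,\min(2^k,n-i)\}$, add $i+J$ to $\mathcal A$ and $(i,i+J)$ to $\mathcal P$. If $i>1$, do the same on the left with $i-1$ for $n-i$, adding $i-J$ and $(i-J,i)$. **A-FOMT.** Let $C_n(\alpha)=-\log(\alpha/2)\,n/\log n$, $N_{\max}=\frac{40}{\log2}C_n(\alpha)\log^2n$, $L_1=\sqrt e(L_K+K_{\max})$, $L_2=4K_{\max}+2L_K$, $C_*=8K_{\max}/\lambda_0$, $\tilde C_*=\frac{L_1}{8L_2}+\frac{\sqrt e K_{\max}}{\lambda_0}$, $W=\max(4C_*^2,4\tilde C_*^2)$, and $$C_{n,\alpha,i,j}(h)=\sigma\sqrt{-2W\log(\alpha/N_{\max})}\;n^{-1/2}h^{-3/2}\min\Bigl(\tfrac{8L_2}{\lambda_0}|x_i-x_j|,\,h\Bigr).$$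 Repeat $\lfloor C_n(\alpha)\rfloor$ times: draw $I$ uniformly from $\{1,\dots,n\}$, generate $(\mathcal P,\mathcal A)$ from $I$, run CALM on $\mathcal A$, and for each $(i,j)\in\mathcal P$ reject and stop if $\hat f_n(x_i;h_{\bar m})-\hat f_n(x_j;h_{\bar m})\ge C_{n,\alpha,i,j}(h_{\bar m})$. If nothing is rejected, accept. The complexity is the number of elementary steps: arithmetic operations, comparisons, evaluations of elementary functions, of $K$ or of a data point, memory accesses, passages through a loop, and draws of a uniform index. **Self-similarity.** Let $B_{f,\mathcal A}(h)=\max_{i\in\mathcal A}|f(x_i)-\mathbb E\hat f_n(x_i;h)|$. For $c_0,c_1>0$, $f$ is called globally self-similar (at sample size $n$) if, for the random set $\mathcal A$ generated from a uniform $I$, the probability that $|\mathcal A|\ge(\log n)^2$ and that $$c_0h^\beta\le B_{f,\mathcal A}(h)\le c_1h^\beta\quad\text{for all }h\in\bigl[(\log n/n)^{1/(2\beta+1)},\tfrac12\bigr]$$ fails is at most $1/n$. **Theorem.** There are $C_0,C_\beta>0$, which do not depend on $\alpha$, $n$, $f$, such that for all $C\ge C_0$ and $\alpha\in(0,1)$,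 with $\gamma_n=C_\beta\Delta_{\beta,n}$: (i) There are $c,n_0$ such that for all $n\ge n_0$ and all $f\in\mathcal F_\beta(C\Delta_{\beta,n})$, with probability at least $1-\alpha$ A-FOMT takes at most $c\,\varepsilon_{\lceil\beta\rceil-1,\gamma_n}(f)^{-1}\,n^{4/5}(\log n)^{11/5}$ steps (here and in (ii), $0^{-1}$ counts as $0$). (ii) For all $c_0,c_1>0$ there are $c,n_0$ such that for all $n\ge n_0$ and all $f\in\mathcal F_\beta(C\Delta_{\beta,n})$ that are globally self-similar with the constants $c_0,c_1$, with probability at least $1-\alpha$ A-FOMT takes at most $c\,\varepsilon_{\lceil\beta\rceil-1,\gamma_n}(f)^{-1}\,n^{2\beta/(2\beta+1)}(\log n)^{(4\beta+3)/(2\beta+1)}$ steps. (iii) There are $c,n_0$ such that for all $n\ge n_0$, for every data vector and every outcome of the random draws, A-FOMT takes at most $c\,C_n(\alpha)\,n^{4/5}(\log n)^{11/5}$ steps and at most $c\,n^{9/5}(\log n)^{6/5}$ steps. -/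

import Mathlib

namespace AFOMT

open MeasureTheory ProbabilityTheory

/-! ## Function classes on `[0,1]`

A function on `[0,1]` is a function `ℝ → ℝ` of which only the restriction to `[0,1]` is used. -/

/-- Hölder class `Σ(β, L)` on `[0,1]`. -/
def Holder (β L : ℝ) : Set (ℝ → ℝ) :=
  {f | ContDiffOn ℝ (⌈β⌉₊ - 1 : ℕ) f (Set.Icc 0 1) ∧
    ∀ x ∈ Set.Icc (0 : ℝ) 1, ∀ y ∈ Set.Icc (0 : ℝ) 1,
      |iteratedDerivWithin (⌈β⌉₊ - 1) f (Set.Icc 0 1) x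
        - iteratedDerivWithin (⌈β⌉₊ - 1) f (Set.Icc 0 1) y| ≤ L * |x - y| ^ (β + 1 - ⌈β⌉₊)}

/-- The alternatives `F_β(δ)`: functions of `Σ(β, L)` with a drop of size at least `δ` if `β ≤ 1`,
with a derivative at most `-δ` somewhere if `β > 1`. -/
def Alternative (β L δ : ℝ) : Set (ℝ → ℝ) :=
  {f | f ∈ Holder β L ∧
    if β ≤ 1 then ∃ a b : ℝ, 0 ≤ a ∧ a < b ∧ b ≤ 1 ∧ δ ≤ f a - f b
    else ∃ x ∈ Set.Icc (0 : ℝ) 1, derivWithin f (Set.Icc 0 1) x ≤ -δ}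

/-- The `γ`-exceedance fraction of order `k`, for `k = 0` and `k = 1`. -/
noncomputable def exceedance (k : ℕ) (γ : ℝ) (f : ℝ → ℝ) : ℝ :=
  if k = 0 then
    (⨅ g ∈ {g : ℝ → ℝ | MonotoneOn g (Set.Icc 0 1)},
      volume {x : ℝ | x ∈ Set.Icc (0 : ℝ) 1 ∧ γ < |f x - g x|}).toReal
  else (volume {x : ℝ | x ∈ Set.Icc (0 : ℝ) 1 ∧ derivWithin f (Set.Icc 0 1) x ≤ -γ}).toReal

/-- The separation rate `Δ_{β,n} = (log n / n) ^ ((β - ⌈β⌉ + 1) / (2 β + 1))`. -/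
noncomputable def sepRate (β : ℝ) (n : ℕ) : ℝ :=
  (Real.log n / n) ^ ((β - ⌈β⌉₊ + 1) / (2 * β + 1))

/-! ## Kernel, regression model, local linear estimator -/

/-- The assumptions on the kernel, with their constants. -/
structure KernelAssumptions (K : ℝ → ℝ) (Kmax Kmin Δ LK : ℝ) : Prop where
  nonneg : ∀ u, 0 ≤ K u
  integral_eq_one : ∫ u, K u = 1
  support_subset : Function.support K ⊆ Set.Icc (-1) 1
  Kmin_pos : 0 < Kmin
  Δ_pos : 0 < Δ
  lower : ∀ u, |u| ≤ Δ → Kmin ≤ K u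
  upper : ∀ u, K u ≤ Kmax
  LK_pos : 0 < LK
  lipschitz : ∀ u v, |K u - K v| ≤ LK * |u - v|
  symm : ∀ u, K (-u) = K u

/-- `μ₂ = ∫ K²`. -/
noncomputable def mu2 (K : ℝ → ℝ) : ℝ := ∫ u, K u ^ 2

/-- The joint law of i.i.d. centred Gaussian errors with variance `σ²`; only the coordinates
`1, …, n` are used. -/
noncomputable def noiseLaw (σ : ℝ) : Measure (ℕ → ℝ) :=
  Measure.infinitePi fun _ => gaussianReal 0 (Real.toNNReal (σ ^ 2))

/-- The observations `Y_k = f(k/n) + e_k`. -/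
noncomputable def obs (f : ℝ → ℝ) (n : ℕ) (e : ℕ → ℝ) : ℕ → ℝ := fun k => f (k / n) + e k

/-- The weighted least squares criterion of the local polynomial estimator of order one at `x`;
`θ.1 + θ.2 * u` is the scalar product of `θ` with `U(u) = (1, u)`. -/
noncomputable def lpeLoss (K : ℝ → ℝ) (n : ℕ) (h : ℝ) (Y : ℕ → ℝ) (x : ℝ) (θ : ℝ × ℝ) : ℝ :=
  ∑ k ∈ Finset.Icc 1 n, (Y k - (θ.1 + θ.2 * (((k : ℝ) / n - x) / h))) ^ 2
    * K (((k : ℝ) / n - x) / h)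

open Classical in
/-- The local polynomial estimator of order one at `x` with bandwidth `h`: the first coordinate of
a minimiser of the criterion. At the design points `x = i / n` it does not depend on the
minimiser. -/
noncomputable def lpe (K : ℝ → ℝ) (n : ℕ) (h : ℝ) (Y : ℕ → ℝ) (x : ℝ) : ℝ :=
  if hex : ∃ θ : ℝ × ℝ, ∀ θ' : ℝ × ℝ, lpeLoss K n h Y x θ ≤ lpeLoss K n h Y x θ'
  then (Classical.choose hex).1 else 0

/-! ## Programs and their step counts

Programs work on real numbers and natural numbers. An elementary step is one arithmetic operation,
comparison, evaluation of an elementary function, of the kernel or of a data point, memory access,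
passage through a loop, or draw of a uniform random index. -/

/-- The result of a deterministic program, with the number of steps used. -/
structure Timed (α : Type) where
  val : α
  steps : ℕ

instance : Monad Timed where
  pure a := ⟨a, 0⟩
  bind x f := ⟨(f x.val).val, x.steps + (f x.val).steps⟩

/-- One elementary step with result `a`. -/
def op {α : Type} (a : α) : Timed α := ⟨a, 1⟩

/-- A fixed number `c` of elementary steps with result `a`. -/
def charge {α : Type} (c : ℕ) (a : α) : Timed α := ⟨a, c⟩

/-- Randomised programs: the joint law of the result and of the number of steps. -/
def Prog (α : Type) : Type := PMF (Timed α)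

noncomputable instance : Monad Prog where
  pure a := PMF.pure (⟨a, 0⟩ : Timed _)
  bind x f := PMF.bind x fun p =>
    PMF.map (fun q => (⟨q.val, p.steps + q.steps⟩ : Timed _)) (f p.val)

noncomputable instance : MonadLift Timed Prog where
  monadLift t := PMF.pure t

/-- Draw an index uniformly from `{1, …, w}`, for `w ≥ 1`, independently of the past; one step. -/
noncomputable def draw (w : ℕ) : Prog ℕ :=
  PMF.map (fun j => (⟨j, 1⟩ : Timed ℕ))
    (PMF.uniformOfFinset (Finset.Icc 1 (max 1 w)) (by simp))

/-! ## The parameters and constants of the procedure -/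

/-- What the procedure is given besides the data and `α`: the kernel with its bound and its
Lipschitz constant, the standard deviation, the constant `κ` of the bandwidth selector and the
eigenvalue constant `λ₀`. -/
structure Tuning where
  K : ℝ → ℝ
  Kmax : ℝ
  LK : ℝ
  σ : ℝ
  κ : ℝ
  lam0 : ℝ

/-- `C_n(α) = -log(α/2) · n / log n`. -/
noncomputable def numRounds (α : ℝ) (n : ℕ) : ℝ := -Real.log (α / 2) * (n / Real.log n)

/-- Candidate bandwidths `h_m = 4^(m-1) / n`, `m ≥ 1`. -/
noncomputable def bw (n m : ℕ) : ℝ := (4 : ℝ) ^ (m - 1) / n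

/-- The integer part of `M = (4/5) log₄ n + (1/5) log₄ log n`. -/
noncomputable def numBw (n : ℕ) : ℕ :=
  ⌊4 / 5 * Real.logb 4 n + 1 / 5 * Real.logb 4 (Real.log n)⌋₊

namespace Tuning

variable (T : Tuning)

/-- `C_ρ = √(32 σ² μ₂ / λ₀²)`. -/
noncomputable def Crho : ℝ := √(32 * T.σ ^ 2 * mu2 T.K / T.lam0 ^ 2)

/-- `G₂(m) = C_ρ √(log n / (n h_m))`. -/
noncomputable def G2 (n m : ℕ) : ℝ := T.Crho * √(Real.log n / (n * bw n m))

/-- `C_* = 8 K_max / λ₀`. -/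
noncomputable def Cstar : ℝ := 8 * T.Kmax / T.lam0

noncomputable def L1 : ℝ := √(Real.exp 1) * (T.LK + T.Kmax)

/-- `L₂ = 2 p K_max + p L_K` with `p = 2`, the number of coefficients of a polynomial of
order one. -/
noncomputable def L2 : ℝ := 2 * 2 * T.Kmax + 2 * T.LK

noncomputable def Ctilde : ℝ := T.L1 / (8 * T.L2) + √(Real.exp 1) * T.Kmax / T.lam0

noncomputable def W : ℝ := max (4 * T.Cstar ^ 2) (4 * T.Ctilde ^ 2)

/-- `N_max = (40 / log 2) C_n(α) log² n`. -/
noncomputable def Nmax (α : ℝ) (n : ℕ) : ℝ :=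
  40 / Real.log 2 * numRounds α n * Real.log n ^ 2

/-- The critical value `C_{n,α,i,j}` at bandwidth `h`. -/
noncomputable def critVal (α : ℝ) (n i j : ℕ) (h : ℝ) : ℝ :=
  T.σ * √(-2 * Real.log (α / Nmax α n) * T.W) * (n : ℝ) ^ (-(1 / 2) : ℝ) * h ^ (-(3 / 2) : ℝ)
    * min (8 * T.L2 / T.lam0 * |(i : ℝ) / n - (j : ℝ) / n|) h

end Tuning

/-! ## Computation of the local linear estimator -/

/-- Weighted moments of the design and of the data in a window. -/
structure Moments where
  s0 : ℝ
  s1 : ℝ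
  s2 : ℝ
  t0 : ℝ
  t1 : ℝ

/-- One pass over the data points of the window around `i / n`, for the bandwidth `h = N / n`;
then `(x_k - x_i) / h = (k - i) / N`. -/
noncomputable def momentsProg (K : ℝ → ℝ) (N i : ℕ) (Y : ℕ → ℝ) : List ℕ → Timed Moments
  | [] => pure ⟨0, 0, 0, 0, 0⟩
  | k :: ks => do
    op ()
    let S ← momentsProg K N i Y ks
    let d ← op ((k : ℝ) - i)
    let u ← op (d / N)
    let w ← op (K u)
    let y ← op (Y k)
    let wu ← op (w * u)
    let wuu ← op (wu * u)
    let wy ← op (w * y)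
    let wuy ← op (wu * y)
    let s0 ← op (S.s0 + w)
    let s1 ← op (S.s1 + wu)
    let s2 ← op (S.s2 + wuu)
    let t0 ← op (S.t0 + wy)
    let t1 ← op (S.t1 + wuy)
    pure ⟨s0, s1, s2, t0, t1⟩

/-- First coordinate of the solution of the `2 × 2` normal equations; if they are singular, only
one data point carries weight. -/
noncomputable def solveProg (S : Moments) : Timed ℝ := do
  let a ← op (S.s0 * S.s2)
  let b ← op (S.s1 * S.s1)
  let D ← op (a - b)
  let z ← op (decide (D = 0))
  if z then op (S.t0 / S.s0)
  else do
    let p ← op (S.s2 * S.t0)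
    let q ← op (S.s1 * S.t1)
    let r ← op (p - q)
    op (r / D)

/-- The indices `k ∈ {1, …, n}` with `|k - i| ≤ N`. -/
def window (n N i : ℕ) : List ℕ :=
  List.range' (max 1 (i - N)) (min n (i + N) + 1 - max 1 (i - N))

/-- Computation of the estimator at `x_i = i / n` with bandwidth `h_m = 4^(m-1) / n`. -/
noncomputable def lpeProg (K : ℝ → ℝ) (n m : ℕ) (Y : ℕ → ℝ) (i : ℕ) : Timed ℝ := do
  let N ← op (4 ^ (m - 1))
  let S ← momentsProg K N i Y (window n N i)
  solveProg S

/-! ## The program for the estimator is correct -/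

theorem momentsProg_val (K : ℝ → ℝ) (N i : ℕ) (Y : ℕ → ℝ) (l : List ℕ) :
    (momentsProg K N i Y l).val =
      ⟨(l.map fun k : ℕ => K (((k : ℝ) - i) / N)).sum,
       (l.map fun k : ℕ => K (((k : ℝ) - i) / N) * (((k : ℝ) - i) / N)).sum,
       (l.map fun k : ℕ => K (((k : ℝ) - i) / N) * (((k : ℝ) - i) / N) * (((k : ℝ) - i) / N)).sum,
       (l.map fun k : ℕ => K (((k : ℝ) - i) / N) * Y k).sum,
       (l.map fun k : ℕ => K (((k : ℝ) - i) / N) * (((k : ℝ) - i) / N) * Y k).sum⟩ := by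
  induction l with
  | nil => rfl
  | cons k ks ih =>
    simp only [momentsProg, bind, op, pure, ih, List.map_cons, List.sum_cons, Moments.mk.injEq]
    refine ⟨?_, ?_, ?_, ?_, ?_⟩ <;> ring

theorem window_sum {n N i : ℕ} (hi : i ∈ Finset.Icc 1 n) (hN : 0 < N) {K : ℝ → ℝ}
    (hK : Function.support K ⊆ Set.Icc (-1) 1) (g : ℕ → ℝ) :
    ((window n N i).map fun k : ℕ => K (((k : ℝ) - i) / N) * g k).sum
      = ∑ k ∈ Finset.Icc 1 n, K (((k : ℝ) - i) / N) * g k := by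
  have hi' := Finset.mem_Icc.1 hi
  have h1 : ((window n N i).map fun k : ℕ => K (((k : ℝ) - i) / N) * g k).sum
      = ∑ k ∈ (window n N i).toFinset, K (((k : ℝ) - i) / N) * g k := by
    rw [List.sum_toFinset _ (by unfold window; exact List.nodup_range')]
  rw [h1]
  apply Finset.sum_subset
  · intro k hk
    simp only [window, List.mem_toFinset, List.mem_range'_1] at hk
    rw [Finset.mem_Icc]
    omega
  · intro k hk hk'
    have hk0 := Finset.mem_Icc.1 hk
    have hcase : N + i < k ∨ k + N < i := by
      by_contra hcon
      apply hk'
      simp only [window, List.mem_toFinset, List.mem_range'_1]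
      omega
    have hNr : (0 : ℝ) < N := by exact_mod_cast hN
    have hz : K (((k : ℝ) - i) / N) = 0 := by
      by_contra hne
      have hmem := hK hne
      rw [Set.mem_Icc, le_div_iff₀ hNr, div_le_iff₀ hNr] at hmem
      rcases hcase with hc | hc
      · have : (N : ℝ) + i < k := by exact_mod_cast hc
        linarith [hmem.2]
      · have : (k : ℝ) + N < i := by exact_mod_cast hc
        linarith [hmem.1]
    rw [hz, zero_mul]

/-- The first coordinate of a minimiser of a weighted least squares criterion, when one point with
`u = 0` has positive weight. -/
theorem leastSquares_val {ι : Type} (s : Finset ι) (w u y : ι → ℝ) (hw : ∀ k ∈ s, 0 ≤ w k)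
    {j : ι} (hj : j ∈ s) (hwj : 0 < w j) (huj : u j = 0) :
    let D := (∑ k ∈ s, w k) * (∑ k ∈ s, w k * u k * u k) - (∑ k ∈ s, w k * u k) ^ 2
    let a := if D = 0 then (∑ k ∈ s, w k * y k) / ∑ k ∈ s, w k
      else ((∑ k ∈ s, w k * u k * u k) * (∑ k ∈ s, w k * y k)
        - (∑ k ∈ s, w k * u k) * (∑ k ∈ s, w k * u k * y k)) / D
    (∃ θ : ℝ × ℝ, ∀ θ' : ℝ × ℝ, ∑ k ∈ s, (y k - (θ.1 + θ.2 * u k)) ^ 2 * w k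
        ≤ ∑ k ∈ s, (y k - (θ'.1 + θ'.2 * u k)) ^ 2 * w k) ∧
    ∀ θ : ℝ × ℝ, (∀ θ' : ℝ × ℝ, ∑ k ∈ s, (y k - (θ.1 + θ.2 * u k)) ^ 2 * w k
        ≤ ∑ k ∈ s, (y k - (θ'.1 + θ'.2 * u k)) ^ 2 * w k) → θ.1 = a := by
  intro D a
  set s0 := ∑ k ∈ s, w k with hs0
  set s1 := ∑ k ∈ s, w k * u k with hs1
  set s2 := ∑ k ∈ s, w k * u k * u k with hs2
  set t0 := ∑ k ∈ s, w k * y k with ht0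
  set t1 := ∑ k ∈ s, w k * u k * y k with ht1
  have hs0pos : 0 < s0 := Finset.sum_pos' hw ⟨j, hj, hwj⟩
  -- expansion of the criterion around a point
  have key : ∀ θ η : ℝ × ℝ, ∑ k ∈ s, (y k - ((θ.1 + η.1) + (θ.2 + η.2) * u k)) ^ 2 * w k
      = ∑ k ∈ s, (y k - (θ.1 + θ.2 * u k)) ^ 2 * w k
        - 2 * η.1 * (t0 - θ.1 * s0 - θ.2 * s1) - 2 * η.2 * (t1 - θ.1 * s1 - θ.2 * s2)
        + ∑ k ∈ s, (η.1 + η.2 * u k) ^ 2 * w k := by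
    intro θ η
    rw [hs0, hs1, hs2, ht0, ht1]
    simp only [Finset.mul_sum, ← Finset.sum_sub_distrib, ← Finset.sum_add_distrib]
    refine Finset.sum_congr rfl fun k _ => ?_
    ring
  have hq : ∀ η : ℝ × ℝ, ∑ k ∈ s, (η.1 + η.2 * u k) ^ 2 * w k
      = η.1 ^ 2 * s0 + 2 * η.1 * η.2 * s1 + η.2 ^ 2 * s2 := by
    intro η
    rw [hs0, hs1, hs2]
    simp only [Finset.mul_sum, ← Finset.sum_add_distrib]
    refine Finset.sum_congr rfl fun k _ => ?_
    ring
  have hqn : ∀ η : ℝ × ℝ, 0 ≤ ∑ k ∈ s, (η.1 + η.2 * u k) ^ 2 * w k := fun η =>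
    Finset.sum_nonneg fun k hk => mul_nonneg (sq_nonneg _) (hw k hk)
  -- the singular case
  have hsing : D = 0 → s1 = 0 ∧ s2 = 0 ∧ t1 = 0 := by
    intro hD
    have hD' : s0 * s2 - s1 ^ 2 = 0 := hD
    have hz : ∑ k ∈ s, (-s1 + s0 * u k) ^ 2 * w k = 0 := by
      have h := hq (-s1, s0)
      simp only at h
      rw [h]
      linear_combination s0 * hD'
    have hall := (Finset.sum_eq_zero_iff_of_nonneg
      (fun k hk => mul_nonneg (sq_nonneg _) (hw k hk))).1 hz
    have hs1z : s1 = 0 := by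
      have h := hall j hj
      rw [huj] at h
      rcases mul_eq_zero.1 h with h | h
      · have := pow_eq_zero_iff (two_ne_zero) |>.1 h
        linarith
      · exact absurd h hwj.ne'
    have hwu : ∀ k ∈ s, w k * u k = 0 := by
      intro k hk
      have h := hall k hk
      rw [hs1z] at h
      rcases mul_eq_zero.1 h with h | h
      · have h' := pow_eq_zero_iff (two_ne_zero) |>.1 h
        have h2 : s0 * u k = 0 := by linarith
        rcases mul_eq_zero.1 h2 with h3 | h3
        · exact absurd h3 hs0pos.ne'
        · rw [h3, mul_zero]
      · rw [h, zero_mul]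
    refine ⟨hs1z, ?_, ?_⟩
    · rw [hs2]; exact Finset.sum_eq_zero fun k hk => by rw [hwu k hk, zero_mul]
    · rw [ht1]; exact Finset.sum_eq_zero fun k hk => by rw [hwu k hk, zero_mul]
  constructor
  · -- a solution of the normal equations is a minimiser
    have hne : ∃ θ : ℝ × ℝ, t0 - θ.1 * s0 - θ.2 * s1 = 0 ∧ t1 - θ.1 * s1 - θ.2 * s2 = 0 := by
      by_cases hD : D = 0
      · obtain ⟨h1, h2, h3⟩ := hsing hD
        refine ⟨(t0 / s0, 0), ?_, ?_⟩
        · simp only [h1]; field_simp; ring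
        · simp only [h1, h2, h3]; ring
      · have hD' : s0 * s2 - s1 ^ 2 ≠ 0 := hD
        refine ⟨((s2 * t0 - s1 * t1) / (s0 * s2 - s1 ^ 2),
          (s0 * t1 - s1 * t0) / (s0 * s2 - s1 ^ 2)), ?_, ?_⟩
        · simp only
          rw [div_mul_eq_mul_div, div_mul_eq_mul_div, sub_sub, ← add_div, sub_eq_zero,
            eq_div_iff hD']
          ring
        · simp only
          rw [div_mul_eq_mul_div, div_mul_eq_mul_div, sub_sub, ← add_div, sub_eq_zero,
            eq_div_iff hD']
          ring
    obtain ⟨θ, h1, h2⟩ := hne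
    refine ⟨θ, fun θ' => ?_⟩
    have h := key θ (θ'.1 - θ.1, θ'.2 - θ.2)
    simp only [add_sub_cancel] at h
    rw [h, h1, h2]
    have := hqn (θ'.1 - θ.1, θ'.2 - θ.2)
    simp only at this
    linarith
  · intro θ hθ
    -- the normal equations hold at a minimiser
    have hlin : ∀ η : ℝ × ℝ, η.1 * (t0 - θ.1 * s0 - θ.2 * s1)
        + η.2 * (t1 - θ.1 * s1 - θ.2 * s2) = 0 := by
      intro η
      set b := η.1 * (t0 - θ.1 * s0 - θ.2 * s1) + η.2 * (t1 - θ.1 * s1 - θ.2 * s2) with hb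
      set q := η.1 ^ 2 * s0 + 2 * η.1 * η.2 * s1 + η.2 ^ 2 * s2 with hqdef
      have hqpos : 0 ≤ q := by
        have h := hqn η
        rw [hq η] at h
        exact h
      have hpoly : ∀ r : ℝ, 0 ≤ -(2 * r * b) + r ^ 2 * q := by
        intro r
        have h := hθ (θ.1 + r * η.1, θ.2 + r * η.2)
        have h' := key θ (r * η.1, r * η.2)
        rw [hq (r * η.1, r * η.2)] at h'
        simp only at h h'
        rw [h'] at h
        rw [hb, hqdef]
        nlinarith [h]
      by_contra hb0
      have h := hpoly (b / (q + 1))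
      have hq1 : 0 < q + 1 := by linarith
      have h2 : -(2 * (b / (q + 1)) * b) + (b / (q + 1)) ^ 2 * q
          = -(b ^ 2 * (q + 2) / (q + 1) ^ 2) := by
        field_simp
        ring
      rw [h2] at h
      have h3 : 0 < b ^ 2 * (q + 2) / (q + 1) ^ 2 := by positivity
      linarith
    have e1 : t0 - θ.1 * s0 - θ.2 * s1 = 0 := by simpa using hlin (1, 0)
    have e2 : t1 - θ.1 * s1 - θ.2 * s2 = 0 := by simpa using hlin (0, 1)
    change θ.1 = if D = 0 then t0 / s0 else (s2 * t0 - s1 * t1) / D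
    split_ifs with hD
    · obtain ⟨h1, -, -⟩ := hsing hD
      rw [h1] at e1
      field_simp
      linarith
    · have hD' : s0 * s2 - s1 ^ 2 ≠ 0 := hD
      change θ.1 = (s2 * t0 - s1 * t1) / (s0 * s2 - s1 ^ 2)
      rw [eq_div_iff hD']
      linear_combination s1 * e2 - s2 * e1

/-- At a design point the program computes the local linear estimator. -/
theorem lpeProg_val {K : ℝ → ℝ} {Kmax Kmin Δ LK : ℝ} (hK : KernelAssumptions K Kmax Kmin Δ LK)
    {n i : ℕ} (m : ℕ) (Y : ℕ → ℝ) (hi : i ∈ Finset.Icc 1 n) :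
    (lpeProg K n m Y i).val = lpe K n (bw n m) Y (i / n) := by
  have hi' := Finset.mem_Icc.1 hi
  have hn : (n : ℝ) ≠ 0 := by
    have : 0 < n := by omega
    positivity
  have hu : ∀ k : ℕ, ((k : ℝ) / n - i / n) / bw n m = ((k : ℝ) - i) / ((4 ^ (m - 1) : ℕ) : ℝ) := by
    intro k
    unfold bw
    push_cast
    field_simp
  have hK0 : 0 < K 0 := hK.Kmin_pos.trans_le (hK.lower 0 (by simpa using hK.Δ_pos.le))
  obtain ⟨hex, huniq⟩ := leastSquares_val (Finset.Icc 1 n)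
    (fun k : ℕ => K (((k : ℝ) - i) / ((4 ^ (m - 1) : ℕ) : ℝ)))
    (fun k : ℕ => ((k : ℝ) - i) / ((4 ^ (m - 1) : ℕ) : ℝ)) Y (fun k _ => hK.nonneg _)
    hi (by simpa using hK0) (by simp)
  have hloss : ∀ θ, lpeLoss K n (bw n m) Y (i / n) θ = ∑ k ∈ Finset.Icc 1 n,
      (Y k - (θ.1 + θ.2 * (((k : ℝ) - i) / ((4 ^ (m - 1) : ℕ) : ℝ)))) ^ 2
        * K (((k : ℝ) - i) / ((4 ^ (m - 1) : ℕ) : ℝ)) := by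
    intro θ
    simp only [lpeLoss, hu]
  have hex' : ∃ θ : ℝ × ℝ, ∀ θ' : ℝ × ℝ,
      lpeLoss K n (bw n m) Y (i / n) θ ≤ lpeLoss K n (bw n m) Y (i / n) θ' := by
    simpa only [hloss] using hex
  rw [lpe, dif_pos hex']
  have hc := Classical.choose_spec hex'
  generalize Classical.choose hex' = θ at hc ⊢
  simp only [hloss] at hc
  rw [huniq _ hc]
  have hN : 0 < 4 ^ (m - 1) := by positivity
  have w0 := window_sum hi hN hK.support_subset (fun _ => 1)
  have w1 := window_sum hi hN hK.support_subset
    (fun k => ((k : ℝ) - i) / ((4 ^ (m - 1) : ℕ) : ℝ))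
  have w2 := window_sum hi hN hK.support_subset
    (fun k => ((k : ℝ) - i) / ((4 ^ (m - 1) : ℕ) : ℝ) * (((k : ℝ) - i) / ((4 ^ (m - 1) : ℕ) : ℝ)))
  have w3 := window_sum hi hN hK.support_subset Y
  have w4 := window_sum hi hN hK.support_subset
    (fun k => ((k : ℝ) - i) / ((4 ^ (m - 1) : ℕ) : ℝ) * Y k)
  simp only [mul_one] at w0
  simp only [← mul_assoc] at w2 w4
  simp only [lpeProg, solveProg, bind, op, momentsProg_val, w0, w1, w2, w3, w4,
    decide_eq_true_eq, ← pow_two]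
  split_ifs <;> rfl

/-! ## Bandwidth selection -/

/-- The estimates at all points of `A`. -/
noncomputable def estimatesProg (K : ℝ → ℝ) (n m : ℕ) (Y : ℕ → ℝ) : List ℕ → Timed (List ℝ)
  | [] => pure []
  | i :: A => do
    op ()
    let v ← lpeProg K n m Y i
    let vs ← estimatesProg K n m Y A
    pure (v :: vs)

/-- The distance `max |a_i - b_i|` of two vectors of estimates. -/
noncomputable def distProg : List ℝ → List ℝ → Timed ℝ
  | a :: as, b :: bs => do
    op ()
    let r ← distProg as bs
    let d ← op (a - b)
    let d' ← op |d|
    op (max r d')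
  | _, _ => op 0

/-- Is `d_A(f̂_k, f̂_m) > 4 κ G₂(k)` for one of the stored pairs `(k, f̂_k)`, where `f̂_m = cur`? -/
noncomputable def violationProg (T : Tuning) (n : ℕ) (cur : List ℝ) :
    List (ℕ × List ℝ) → Timed Bool
  | [] => pure false
  | p :: rest => do
    op ()
    let d ← distProg p.2 cur
    let g ← charge 10 (4 * T.κ * T.G2 n p.1)
    let b ← op (decide (g < d))
    if b then pure true else violationProg T n cur rest

/-- The loop over the candidates `m, m + 1, …`; `fuel` is the number of those left, `prev` holds
the earlier estimates, `last` is the most recent one that was accepted. -/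
noncomputable def calmLoop (T : Tuning) (n : ℕ) (Y : ℕ → ℝ) (A : List ℕ) :
    ℕ → ℕ → List (ℕ × List ℝ) → ℕ × List ℝ → Timed (ℕ × List ℝ)
  | 0, _, _, last => pure last
  | fuel + 1, m, prev, last => do
    op ()
    let cur ← estimatesProg T.K n m Y A
    let b ← violationProg T n cur prev
    if b then pure last
    else do
      let prev' ← op (prev ++ [(m, cur)])
      calmLoop T n Y A fuel (m + 1) prev' (m, cur)

/-- The computationally adaptive Lepskii method; the result is `m̄` with the estimates on `A` at
the bandwidth `h_m̄`. -/
noncomputable def calm (T : Tuning) (n : ℕ) (Y : ℕ → ℝ) (A : List ℕ) : Timed (ℕ × List ℝ) := do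
  let M ← charge 10 (numBw n)
  calmLoop T n Y A M 1 [] (0, [])

/-! ## Generation of indices -/

/-- Append `x` to the list unless it is there already; the list is scanned. -/
def insertProg {β : Type} [DecidableEq β] (x : β) : List β → Timed (List β)
  | [] => op [x]
  | y :: l => do
    let b ← op (decide (x = y))
    if b then pure (y :: l)
    else do
      let l' ← insertProg x l
      op (y :: l')

/-- One-sided search over a list of levels `k`: draw `J ∼ Unif([2^k ∧ r])`, add the index `pt J` to
`A` and the pair `pr J` to `P`. The state is `(P, A)`. -/
noncomputable def searchProg (r : ℕ) (pt : ℕ → ℕ) (pr : ℕ → ℕ × ℕ) :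
    List ℕ → List (ℕ × ℕ) × List ℕ → Prog (List (ℕ × ℕ) × List ℕ)
  | [], s => pure s
  | k :: ks, s => do
    op ()
    let w ← op (2 ^ k)
    let w' ← op (min w r)
    let J ← draw w'
    let x ← op (pt J)
    let A ← insertProg x s.2
    let p ← op (pr J)
    let P ← insertProg p s.1
    searchProg r pt pr ks (P, A)

/-- The levels `0, …, ⌈log₂ r⌉`, repeated `⌈20 log n⌉` times. -/
noncomputable def levels (n r : ℕ) : List ℕ :=
  (List.replicate ⌈20 * Real.log n⌉₊ (List.range (Nat.clog 2 r + 1))).flatten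

/-- The indices generator: pairs `P` and indices `A` for the searches from `i` to the right and to
the left. -/
noncomputable def generator (n i : ℕ) : Prog (List (ℕ × ℕ) × List ℕ) := do
  let s₀ ← op (([], [i]) : List (ℕ × ℕ) × List ℕ)
  let b ← op (decide (i + 1 ≤ n))
  let s₁ ← (if b then searchProg (n - i) (fun J => i + J) (fun J => (i, i + J)) (levels n (n - i)) s₀
    else pure s₀ : Prog (List (ℕ × ℕ) × List ℕ))
  let b' ← op (decide (2 ≤ i))
  if b' then searchProg (i - 1) (fun J => i - J) (fun J => (i - J, i)) (levels n (i - 1)) s₁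
  else pure s₁

/-- The generator started from a uniform index. -/
noncomputable def randomIndices (n : ℕ) : Prog (List (ℕ × ℕ) × List ℕ) := do
  let i ← draw n
  generator n i

/-! ## The adaptive test -/

/-- The stored estimate at the index `i`, found by a scan of `A`. -/
noncomputable def lookupProg (i : ℕ) : List ℕ → List ℝ → Timed ℝ
  | a :: A, v :: vs => do
    let b ← op (decide (i = a))
    if b then pure v else lookupProg i A vs
  | _, _ => op 0

/-- The local tests for the pairs in the list, until one of them detects a violation. -/
noncomputable def testProg (T : Tuning) (α : ℝ) (n : ℕ) (h : ℝ) (A : List ℕ) (est : List ℝ) :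
    List (ℕ × ℕ) → Timed Bool
  | [] => pure false
  | p :: rest => do
    op ()
    let a ← lookupProg p.1 A est
    let b ← lookupProg p.2 A est
    let d ← op (a - b)
    let c ← charge 30 (T.critVal α n p.1 p.2 h)
    let z ← op (decide (c ≤ d))
    if z then pure true else testProg T α n h A est rest

/-- At most `l` rounds of the adaptive test; the result is `true` if a violation is detected, and
then the program stops. -/
noncomputable def afomtLoop (T : Tuning) (α : ℝ) (n : ℕ) (Y : ℕ → ℝ) : ℕ → Prog Bool
  | 0 => pure false
  | l + 1 => do
    op ()
    let s ← randomIndices n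
    let r ← calm T n Y s.2
    let h ← charge 3 (bw n r.1)
    let z ← testProg T α n h s.2 r.2 s.1
    if z then pure true else afomtLoop T α n Y l

/-- The adaptive test A-FOMT for the data `Y 1, …, Y n`. -/
noncomputable def afomt (T : Tuning) (α : ℝ) (n : ℕ) (Y : ℕ → ℝ) : Prog Bool := do
  let l ← charge 10 ⌊numRounds α n⌋₊
  afomtLoop T α n Y l

/-- The probability, over the data with regression function `f` and over the random indices, that
the adaptive test stops after at most `t` steps. -/
noncomputable def probSteps (T : Tuning) (α : ℝ) (n : ℕ) (f : ℝ → ℝ) (t : ℝ) : ENNReal :=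
  ∫⁻ e, PMF.toOuterMeasure (afomt T α n (obs f n e)) {r | (r.steps : ℝ) ≤ t} ∂(noiseLaw T.σ)

/-! ## Self-similarity -/

/-- `B_{f,A}(h)`, the maximal absolute bias over `A` of the local linear estimator. -/
noncomputable def biasMax (T : Tuning) (n : ℕ) (f : ℝ → ℝ) (A : Finset ℕ) (h : ℝ) : ℝ :=
  sSup ((fun i : ℕ =>
    |f (i / n) - ∫ e, lpe T.K n h (obs f n e) (i / n) ∂(noiseLaw T.σ)|) '' (A : Set ℕ))

/-- `c₀ h^β ≤ B_{f,A}(h) ≤ c₁ h^β` for all bandwidths from `(log n / n)^(1/(2β+1))` to `1/2`. -/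
def SelfSimilarOn (T : Tuning) (β c₀ c₁ : ℝ) (n : ℕ) (f : ℝ → ℝ) (A : Finset ℕ) : Prop :=
  ∀ h : ℝ, (Real.log n / n) ^ (1 / (2 * β + 1)) ≤ h → h ≤ 1 / 2 →
    c₀ * h ^ β ≤ biasMax T n f A h ∧ biasMax T n f A h ≤ c₁ * h ^ β

/-- Global self-similarity: the index sets `A` with at least `(log n)²` elements that violate
self-similarity are generated, from a uniform index, with probability at most `1 / n`. -/
def GloballySelfSimilar (T : Tuning) (β c₀ c₁ : ℝ) (n : ℕ) (f : ℝ → ℝ) : Prop :=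
  PMF.toOuterMeasure (randomIndices n)
    {r | Real.log n ^ 2 ≤ (r.val.2.toFinset.card : ℝ) ∧
      ¬ SelfSimilarOn T β c₀ c₁ n f r.val.2.toFinset} ≤ (n : ENNReal)⁻¹

/-- It suffices that self-similarity holds on all sets with at least `(log n)²` elements. -/
theorem globallySelfSimilar_of_forall {T : Tuning} {β c₀ c₁ : ℝ} {n : ℕ} {f : ℝ → ℝ}
    (hf : ∀ A : Finset ℕ, Real.log n ^ 2 ≤ (A.card : ℝ) → SelfSimilarOn T β c₀ c₁ n f A) :
    GloballySelfSimilar T β c₀ c₁ n f := by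
  have h0 : {r : Timed (List (ℕ × ℕ) × List ℕ) | Real.log n ^ 2 ≤ (r.val.2.toFinset.card : ℝ) ∧
      ¬ SelfSimilarOn T β c₀ c₁ n f r.val.2.toFinset} = ∅ := by
    ext r
    refine iff_of_false (fun hr => hr.2 (hf _ hr.1)) (Set.notMem_empty r)
  unfold GloballySelfSimilar
  rw [h0]
  simp

end AFOMT

/-!
The test needs few steps because one of its first rounds rejects, and because a round is cheap.

*Rejection.* At the design points the local linear estimator is a linear functional of the data,
with weights that reproduce affine functions, are absolutely summable up to a constant, and have a
sum of squares of the order of the reciprocal of the window size (`lpeProg_val_eq_sum`,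
`sum_abs_lpeWeight_le`, `sum_sq_lpeWeight_le`). So the bias at bandwidth `h` is `O(h ^ β)`
(`bias_le`), and the stochastic error is sub-Gaussian with variance `O(1 / (n h))`
(`measure_noisePart_gt_le_rpow`). At levels up to the one of the balancing bandwidth `optBw β n`,
the bias is dominated by the threshold of the bandwidth selector. If the stochastic errors are
dominated as well, the selector does not stop before that level, and its final estimates are
accurate up to a multiple of `optBw β n ^ β` (`calm_accurate`); then each pair of indices with a drop
of that order leads to a rejection (`roundProg_eq_true`).

Such pairs are found: an index `i` with many partners, i.e. such that at some scale a fixed fraction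
of the indices on one side of `i` forms a dropping pair with it, produces such a pair with
probability at least `1/8` (`le_pr_generator_good`). For `β ≤ 1`, `f` is almost monotone on the set
of the other indices, because between two indices with a drop every index drops against one of
them; for `β > 1`, a negative slope persists over the distance `optBw β n`. Hence the exceedance
fraction `ε` is at most the fraction of indices with many partners (`exceedance_bounds`).

*Random errors.* The thresholds are fixed by `κ` and `λ₀`, so that a large stochastic error at a
single point is unlikely, but with a probability that may decay slower than `1 / n`, and it cannot be
excluded at all points at once. It suffices that it is unlikely on the polylogarithmic index set of
one round: by Markov's inequality, with high probability over the errors, the index sets with a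
large stochastic error make up for at most half of the detections
(`measure_confusingErrors_le`). Then each round rejects with probability at least `ε / 16`
(`pr_round_not_reject_le`), and `O(1 / ε)` rounds suffice (`pr_afomtLoop_le`, `le_probSteps`).

*Cost.* A round costs a power of `log n` times the size of the last window (`roundProg_steps_le`),
at most `n ^ (4/5) (log n) ^ (1/5)`. If `f` is self-similar, then the bias at a large multiple of
`optBw β n` is visible above thresholds and errors, so that the selector stops before
(`violation_of_selfSimilar`), except with probability `O(1 / n)` per round, which is negligible even
when summed over all `O(n / log n)` rounds (`pr_round_cost_le`).
-/

namespace AFOMT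

open MeasureTheory ProbabilityTheory Filter

/-! ### Values and step counts of the deterministic programs -/

namespace Timed

variable {α β : Type}

@[simp] theorem val_bind (x : Timed α) (f : α → Timed β) : (x >>= f).val = (f x.val).val := rfl

@[simp] theorem steps_bind (x : Timed α) (f : α → Timed β) :
    (x >>= f).steps = x.steps + (f x.val).steps := rfl

@[simp] theorem val_pure (a : α) : (pure a : Timed α).val = a := rfl

@[simp] theorem steps_pure (a : α) : (pure a : Timed α).steps = 0 := rfl

@[simp] theorem val_op (a : α) : (op a).val = a := rfl

@[simp] theorem steps_op (a : α) : (op a).steps = 1 := rfl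

@[simp] theorem val_charge (c : ℕ) (a : α) : (charge c a).val = a := rfl

@[simp] theorem steps_charge (c : ℕ) (a : α) : (charge c a).steps = c := rfl

theorem val_bind_ite (x : Timed Bool) (f g : Timed α) :
    (x >>= fun b => if b = true then f else g).val = bif x.val then f.val else g.val := by
  rw [val_bind]
  cases x.val <;> rfl

theorem steps_bind_ite (x : Timed Bool) (f g : Timed α) :
    (x >>= fun b => if b = true then f else g).steps
      = x.steps + bif x.val then f.steps else g.steps := by
  rw [steps_bind]
  cases x.val <;> rfl

end Timed

theorem momentsProg_steps (K : ℝ → ℝ) (N i : ℕ) (Y : ℕ → ℝ) (l : List ℕ) :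
    (momentsProg K N i Y l).steps = 14 * l.length := by
  induction l with
  | nil => rfl
  | cons k ks ih =>
    simp only [momentsProg, Timed.steps_bind, Timed.steps_op, Timed.steps_pure, ih,
      List.length_cons]
    ring

theorem solveProg_steps_le (S : Moments) : (solveProg S).steps ≤ 8 := by
  simp only [solveProg, ↓Timed.steps_bind_ite, Timed.steps_bind, Timed.steps_op, Timed.val_op]
  rw [Bool.cond_eq_ite]
  split_ifs <;> simp

theorem window_length_le (n N i : ℕ) : (window n N i).length ≤ 2 * N + 1 := by
  simp only [window, List.length_range']
  omega

theorem lpeProg_steps_le (K : ℝ → ℝ) (n m : ℕ) (Y : ℕ → ℝ) (i : ℕ) :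
    (lpeProg K n m Y i).steps ≤ 51 * 4 ^ (m - 1) := by
  simp only [lpeProg, Timed.steps_bind, Timed.steps_op, Timed.val_op, momentsProg_steps]
  have h1 := window_length_le n (4 ^ (m - 1)) i
  have h2 := solveProg_steps_le (momentsProg K (4 ^ (m - 1)) i Y (window n (4 ^ (m - 1)) i)).val
  have h3 : 1 ≤ 4 ^ (m - 1) := Nat.one_le_pow _ _ (by norm_num)
  omega

/-- The vector of the estimates at bandwidth `h_m` at the points of `A`. -/
noncomputable def estimates (K : ℝ → ℝ) (n : ℕ) (Y : ℕ → ℝ) (A : List ℕ) (m : ℕ) : List ℝ :=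
  A.map fun i => (lpeProg K n m Y i).val

theorem estimatesProg_val (K : ℝ → ℝ) (n m : ℕ) (Y : ℕ → ℝ) (A : List ℕ) :
    (estimatesProg K n m Y A).val = estimates K n Y A m := by
  induction A with
  | nil => rfl
  | cons i A ih =>
    simp only [estimatesProg, Timed.val_bind, Timed.val_pure, ih, estimates, List.map_cons]

theorem estimatesProg_steps_le (K : ℝ → ℝ) (n m : ℕ) (Y : ℕ → ℝ) (A : List ℕ) :
    (estimatesProg K n m Y A).steps ≤ 52 * A.length * 4 ^ (m - 1) := by
  induction A with
  | nil => simp [estimatesProg]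
  | cons i A ih =>
    simp only [estimatesProg, Timed.steps_bind, Timed.steps_op, Timed.steps_pure,
      List.length_cons]
    have h1 := lpeProg_steps_le K n m Y i
    have h3 : 1 ≤ 4 ^ (m - 1) := Nat.one_le_pow _ _ (by norm_num)
    nlinarith

theorem distProg_map_le_iff {ι : Type} (A : List ι) (g g' : ι → ℝ) {c : ℝ} (hc : 0 ≤ c) :
    (distProg (A.map g) (A.map g')).val ≤ c ↔ ∀ a ∈ A, |g a - g' a| ≤ c := by
  induction A with
  | nil => simpa [distProg] using hc
  | cons a A ih =>
    simp only [List.map_cons, distProg, Timed.val_bind, Timed.val_op, max_le_iff, ih,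
      List.mem_cons, forall_eq_or_imp]
    exact and_comm

theorem distProg_steps_le (l l' : List ℝ) : (distProg l l').steps ≤ 4 * l'.length + 1 := by
  induction l generalizing l' with
  | nil => simp [distProg]
  | cons a l ih =>
    cases l' with
    | nil => simp [distProg]
    | cons b l' =>
      simp only [distProg, Timed.steps_bind, Timed.steps_op, List.length_cons]
      have := ih l'
      omega

theorem violationProg_val (T : Tuning) (n : ℕ) (cur : List ℝ) (prev : List (ℕ × List ℝ)) :
    (violationProg T n cur prev).val = true ↔
      ∃ p ∈ prev, 4 * T.κ * T.G2 n p.1 < (distProg p.2 cur).val := by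
  induction prev with
  | nil => simp [violationProg]
  | cons p prev ih =>
    simp only [violationProg, ↓Timed.val_bind_ite, Timed.val_bind, Timed.val_op, Timed.val_charge,
      List.mem_cons, exists_eq_or_imp, ← ih]
    rw [Bool.cond_eq_ite]
    split_ifs with h
    · simp [of_decide_eq_true h]
    · simp [of_decide_eq_false (Bool.eq_false_iff.2 h)]

theorem violationProg_steps_le (T : Tuning) (n : ℕ) (cur : List ℝ) (prev : List (ℕ × List ℝ)) :
    (violationProg T n cur prev).steps ≤ prev.length * (4 * cur.length + 13) := by
  induction prev with
  | nil => simp [violationProg]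
  | cons p prev ih =>
    simp only [violationProg, ↓Timed.steps_bind_ite, Timed.steps_bind, Timed.steps_op,
      Timed.val_op, Timed.val_charge, Timed.steps_charge, List.length_cons]
    have := distProg_steps_le p.2 cur
    rw [Bool.cond_eq_ite]
    split_ifs
    · simp only [Timed.steps_pure]
      nlinarith [Nat.zero_le (prev.length * (4 * cur.length + 13))]
    · nlinarith

/-- The bandwidth selector detects a violation between the candidates `k` and `m`: at some point
of `A`, the estimates differ by more than `4 κ G₂(k)`. -/
def Violation (T : Tuning) (n : ℕ) (Y : ℕ → ℝ) (A : List ℕ) (k m : ℕ) : Prop :=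
  4 * T.κ * T.G2 n k < (distProg (estimates T.K n Y A k) (estimates T.K n Y A m)).val

theorem violation_iff {T : Tuning} {n : ℕ} {Y : ℕ → ℝ} {A : List ℕ} {k m : ℕ}
    (h : 0 ≤ 4 * T.κ * T.G2 n k) : Violation T n Y A k m ↔
      ∃ a ∈ A, 4 * T.κ * T.G2 n k < |(lpeProg T.K n k Y a).val - (lpeProg T.K n m Y a).val| := by
  rw [Violation, ← not_le, estimates, estimates, distProg_map_le_iff _ _ _ h]
  push Not
  rfl

/-- The list of the candidates `1, …, m - 1` with their estimates. -/
noncomputable def history (T : Tuning) (n : ℕ) (Y : ℕ → ℝ) (A : List ℕ) (m : ℕ) :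
    List (ℕ × List ℝ) :=
  (List.range' 1 (m - 1)).map fun k => (k, estimates T.K n Y A k)

theorem history_succ (T : Tuning) (n : ℕ) (Y : ℕ → ℝ) (A : List ℕ) {m : ℕ} (hm : 1 ≤ m) :
    history T n Y A (m + 1) = history T n Y A m ++ [(m, estimates T.K n Y A m)] := by
  obtain ⟨j, rfl⟩ := Nat.exists_eq_add_of_le' hm
  simp only [history, Nat.add_sub_cancel, List.range'_concat, List.map_append, List.map_cons,
    List.map_nil, one_mul, Nat.add_comm 1 j]

/-- The loop of the bandwidth selector stops at the first candidate with a violation. -/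
theorem calmLoop_spec (T : Tuning) (n : ℕ) (Y : ℕ → ℝ) (A : List ℕ) (fuel : ℕ) :
    ∀ m last, 1 ≤ m → ∃ m', m ≤ m' ∧ m' ≤ m + fuel ∧
      (calmLoop T n Y A fuel m (history T n Y A m) last).val
        = (if m' = m then last else (m' - 1, estimates T.K n Y A (m' - 1))) ∧
      (∀ j, m ≤ j → j < m' → ∀ k, 1 ≤ k → k < j → ¬ Violation T n Y A k j) ∧
      (m' = m + fuel ∨ ∃ k, 1 ≤ k ∧ k < m' ∧ Violation T n Y A k m') ∧
      (calmLoop T n Y A fuel m (history T n Y A m) last).steps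
        ≤ ∑ j ∈ Finset.Ico m (m' + 1), 71 * (A.length + 1) * 4 ^ (j - 1) := by
  induction fuel with
  | zero =>
    intro m last hm
    refine ⟨m, le_rfl, le_rfl, by simp [calmLoop], fun j h1 h2 => by omega, Or.inl rfl, ?_⟩
    simp [calmLoop]
  | succ fuel ih =>
    intro m last hm
    have hv : (violationProg T n (estimates T.K n Y A m) (history T n Y A m)).val = true ↔
        ∃ k, 1 ≤ k ∧ k < m ∧ Violation T n Y A k m := by
      rw [violationProg_val]
      constructor
      · rintro ⟨p, hp, h⟩
        simp only [history, List.mem_map, List.mem_range'_1] at hp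
        obtain ⟨k, hk, rfl⟩ := hp
        exact ⟨k, hk.1, by omega, h⟩
      · rintro ⟨k, h1, h2, h⟩
        refine ⟨(k, estimates T.K n Y A k), ?_, h⟩
        simp only [history, List.mem_map, List.mem_range'_1]
        exact ⟨k, ⟨h1, by omega⟩, rfl⟩
    have hs1 := estimatesProg_steps_le T.K n m Y A
    have hs2 := violationProg_steps_le T n (estimates T.K n Y A m) (history T n Y A m)
    have hlen : (history T n Y A m).length = m - 1 := by simp [history]
    have hlen' : (estimates T.K n Y A m).length = A.length := by simp [estimates]
    rw [hlen, hlen'] at hs2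
    have hpow : 1 ≤ 4 ^ (m - 1) := Nat.one_le_pow _ _ (by norm_num)
    have hm4 : m - 1 ≤ 4 ^ (m - 1) := (Nat.lt_pow_self (by norm_num)).le
    -- estimates for the candidate `m` and comparisons with the `m - 1` earlier candidates
    have hcost : 1 + (52 * A.length * 4 ^ (m - 1)) + (m - 1) * (4 * A.length + 13) + 1
        ≤ 71 * (A.length + 1) * 4 ^ (m - 1) := by
      have : (m - 1) * (4 * A.length + 13) ≤ 4 ^ (m - 1) * (4 * A.length + 13) :=
        Nat.mul_le_mul_right _ hm4
      nlinarith [Nat.zero_le (A.length * 4 ^ (m - 1))]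
    by_cases hb : ∃ k, 1 ≤ k ∧ k < m ∧ Violation T n Y A k m
    · refine ⟨m, le_rfl, by omega, ?_, fun j h1 h2 => by omega, Or.inr hb, ?_⟩
      · simp [calmLoop, estimatesProg_val, hv.2 hb]
      · simp only [calmLoop, Timed.steps_bind, Timed.steps_op, estimatesProg_val, hv.2 hb,
          if_true, Timed.steps_pure, Nat.Ico_succ_singleton, Finset.sum_singleton]
        omega
    · have hb' : (violationProg T n (estimates T.K n Y A m) (history T n Y A m)).val = false := by
        rw [← Bool.not_eq_true, hv]; exact hb
      obtain ⟨m', h1, h2, h3, h4, h5, h6⟩ := ih (m + 1) (m, estimates T.K n Y A m) (by omega)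
      refine ⟨m', by omega, by omega, ?_, ?_, ?_, ?_⟩
      · simp only [calmLoop, Timed.val_bind, estimatesProg_val, hb']
        rw [if_neg (by simp), Timed.val_bind, Timed.val_op, ← history_succ T n Y A hm, h3,
          if_neg (by omega : m' ≠ m)]
        split_ifs with h
        · rw [h, Nat.add_sub_cancel]
        · rfl
      · intro j hj1 hj2 k hk1 hk2 hvio
        rcases Nat.eq_or_lt_of_le hj1 with rfl | hlt
        · exact hb ⟨k, hk1, hk2, hvio⟩
        · exact h4 j hlt hj2 k hk1 hk2 hvio
      · rcases h5 with h5 | h5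
        · left; omega
        · exact Or.inr h5
      · rw [Finset.sum_eq_sum_Ico_succ_bot (by omega)]
        simp only [calmLoop, Timed.steps_bind, estimatesProg_val, hb', Timed.steps_op]
        rw [if_neg (by simp), Timed.steps_bind, Timed.steps_op, Timed.val_op,
          ← history_succ T n Y A hm]
        omega

/-- The bandwidth selector returns a candidate `m` without earlier violations; it is the last one,
or the next one has a violation. The number of steps is of the order of the size of `A` times the
window size of the last candidate that is tried. -/
theorem calm_spec (T : Tuning) (n : ℕ) (Y : ℕ → ℝ) (A : List ℕ) :
    ∃ m, m ≤ numBw n ∧ (calm T n Y A).val.1 = m ∧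
      (1 ≤ m → (calm T n Y A).val.2 = estimates T.K n Y A m) ∧
      (∀ j ≤ m, ∀ k, 1 ≤ k → k < j → ¬ Violation T n Y A k j) ∧
      (m = numBw n ∨ ∃ k, 1 ≤ k ∧ k < m + 1 ∧ Violation T n Y A k (m + 1)) ∧
      (calm T n Y A).steps ≤ 81 * (A.length + 1) * 4 ^ (m + 1) := by
  obtain ⟨m', h1, h2, h3, h4, h5, h6⟩ := calmLoop_spec T n Y A (numBw n) 1 (0, []) le_rfl
  have hh : history T n Y A 1 = [] := rfl
  rw [hh] at h3 h6
  refine ⟨m' - 1, by omega, ?_, ?_, ?_, ?_, ?_⟩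
  · simp only [calm, Timed.val_bind, Timed.val_charge, h3]
    split_ifs with h
    · rw [h]
    · rfl
  · intro hm
    simp only [calm, Timed.val_bind, Timed.val_charge, h3]
    rw [if_neg (by omega)]
  · intro j hj k hk1 hk2
    exact h4 j (by omega) (by omega) k hk1 hk2
  · rcases h5 with h5 | h5
    · left; omega
    · right; rwa [Nat.sub_add_cancel h1]
  · simp only [calm, Timed.steps_bind, Timed.val_charge, Timed.steps_charge]
    rw [Nat.sub_add_cancel h1]
    -- the window sizes grow geometrically, so the last candidate dominates
    have hsum : ∀ q, ∑ j ∈ Finset.Ico 1 (q + 1), 71 * (A.length + 1) * 4 ^ (j - 1)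
        ≤ 71 * (A.length + 1) * 4 ^ q := by
      intro q
      induction q with
      | zero => simp
      | succ q ih =>
        rw [Finset.sum_Ico_succ_top (by omega), Nat.add_sub_cancel, pow_succ]
        nlinarith [Nat.zero_le ((A.length + 1) * 4 ^ q)]
    have := hsum m'
    have hp : 1 ≤ 4 ^ m' := Nat.one_le_pow _ _ (by norm_num)
    nlinarith [Nat.zero_le (A.length * 4 ^ m')]

theorem lookupProg_val {A : List ℕ} (g : ℕ → ℝ) {i : ℕ} (hi : i ∈ A) :
    (lookupProg i A (A.map g)).val = g i := by
  induction A with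
  | nil => simp at hi
  | cons a A ih =>
    rw [List.map_cons, lookupProg, Timed.val_bind_ite, Timed.val_op, Bool.cond_eq_ite]
    split_ifs with h
    · rw [of_decide_eq_true h]; rfl
    · refine ih ((List.mem_cons.1 hi).resolve_left fun h' => h (by simpa using h'))

theorem lookupProg_steps_le (i : ℕ) (A : List ℕ) (vs : List ℝ) :
    (lookupProg i A vs).steps ≤ A.length + 1 := by
  induction A generalizing vs with
  | nil => simp [lookupProg]
  | cons a A ih =>
    cases vs with
    | nil => simp [lookupProg]
    | cons v vs =>
      rw [lookupProg, Timed.steps_bind_ite]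
      simp only [Timed.steps_op, Timed.val_op, List.length_cons]
      have := ih vs
      rw [Bool.cond_eq_ite]
      split_ifs
      · simp
      · omega

/-- The local tests reject if the estimates of one of the pairs differ by the critical value. -/
theorem testProg_val (T : Tuning) (α : ℝ) (n : ℕ) (h : ℝ) {A : List ℕ} (g : ℕ → ℝ)
    {P : List (ℕ × ℕ)} (hP : ∀ p ∈ P, p.1 ∈ A ∧ p.2 ∈ A)
    (hex : ∃ p ∈ P, T.critVal α n p.1 p.2 h ≤ g p.1 - g p.2) :
    (testProg T α n h A (A.map g) P).val = true := by
  induction P with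
  | nil => simp at hex
  | cons p P ih =>
    have hp := hP p (by simp)
    simp only [testProg, ↓Timed.val_bind_ite, Timed.val_bind, Timed.val_op, Timed.val_charge,
      lookupProg_val g hp.1,
      lookupProg_val g hp.2]
    rw [Bool.cond_eq_ite]
    split_ifs with hz
    · rfl
    · refine ih (fun q hq => hP q (by simp [hq])) ?_
      obtain ⟨q, hq, hq'⟩ := hex
      rcases List.mem_cons.1 hq with rfl | hq
      · exact absurd (decide_eq_true hq') hz
      · exact ⟨q, hq, hq'⟩

theorem testProg_steps_le (T : Tuning) (α : ℝ) (n : ℕ) (h : ℝ) (A : List ℕ) (est : List ℝ)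
    (P : List (ℕ × ℕ)) :
    (testProg T α n h A est P).steps ≤ P.length * (2 * A.length + 35) := by
  induction P with
  | nil => simp [testProg]
  | cons p P ih =>
    simp only [testProg, ↓Timed.steps_bind_ite, Timed.steps_bind, Timed.steps_op,
      Timed.val_op, Timed.val_charge,
      Timed.steps_charge, List.length_cons]
    have h1 := lookupProg_steps_le p.1 A est
    have h2 := lookupProg_steps_le p.2 A est
    rw [Bool.cond_eq_ite]
    split_ifs
    · simp only [Timed.steps_pure]
      nlinarith [Nat.zero_le (P.length * (2 * A.length + 35))]
    · nlinarith

section Insert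

variable {β : Type} [DecidableEq β]

theorem mem_insertProg {x y : β} {l : List β} : y ∈ (insertProg x l).val ↔ y = x ∨ y ∈ l := by
  induction l with
  | nil => simp [insertProg]
  | cons z l ih =>
    rw [insertProg, Timed.val_bind_ite]
    simp only [Timed.val_bind, Timed.val_op]
    rw [Bool.cond_eq_ite]
    split_ifs with h
    · have := of_decide_eq_true h
      subst this
      simp
    · simp only [List.mem_cons, ih]
      tauto

theorem insertProg_length_le (x : β) (l : List β) :
    (insertProg x l).val.length ≤ l.length + 1 := by
  induction l with
  | nil => simp [insertProg]
  | cons z l ih =>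
    rw [insertProg, Timed.val_bind_ite]
    simp only [Timed.val_bind, Timed.val_op]
    rw [Bool.cond_eq_ite]
    split_ifs with h
    · simp
    · simpa using ih

theorem insertProg_steps_le (x : β) (l : List β) :
    (insertProg x l).steps ≤ 2 * l.length + 1 := by
  induction l with
  | nil => simp [insertProg]
  | cons z l ih =>
    rw [insertProg, Timed.steps_bind_ite]
    simp only [Timed.steps_bind, Timed.steps_op, Timed.val_op, List.length_cons]
    rw [Bool.cond_eq_ite]
    split_ifs with h
    · simp
    · omega

theorem insertProg_toFinset (x : β) (l : List β) :
    (insertProg x l).val.toFinset = insert x l.toFinset := by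
  ext y
  simp [mem_insertProg]

end Insert

/-! ### The local linear estimator as a linear functional of the data -/

section LeastSquares

variable {ι : Type} {s : Finset ι} {w u y : ι → ℝ}

theorem sum_weighted_sq_eq (s : Finset ι) (w u : ι → ℝ) (b : ℝ) :
    ∑ k ∈ s, w k * (1 + b * u k) ^ 2
      = ∑ k ∈ s, w k + 2 * b * ∑ k ∈ s, w k * u k + b ^ 2 * ∑ k ∈ s, w k * u k * u k := by
  simp only [Finset.mul_sum, ← Finset.sum_add_distrib]
  exact Finset.sum_congr rfl fun k _ => by ring

/-- The orthogonality relation for the best slope; if the second moment vanishes, so does the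
first one, and the slope is `0` by the convention for division. -/
theorem first_moment_eq (hw : ∀ k ∈ s, 0 ≤ w k) :
    ∑ k ∈ s, w k * u k + -(∑ k ∈ s, w k * u k) / (∑ k ∈ s, w k * u k * u k)
      * ∑ k ∈ s, w k * u k * u k = 0 := by
  by_cases h2 : ∑ k ∈ s, w k * u k * u k = 0
  · have h := (Finset.sum_eq_zero_iff_of_nonneg
      (fun k hk => by rw [mul_assoc]; exact mul_nonneg (hw k hk) (mul_self_nonneg _))).1 h2
    rw [h2, mul_zero, add_zero]
    refine Finset.sum_eq_zero fun k hk => ?_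
    rcases mul_eq_zero.1 (h k hk) with h | h
    · exact h
    · rw [h, mul_zero]
  · rw [div_mul_cancel₀ _ h2, add_neg_cancel]

theorem solveProg_val (S : Moments) : (solveProg S).val =
    if S.s0 * S.s2 - S.s1 * S.s1 = 0 then S.t0 / S.s0
    else (S.s2 * S.t0 - S.s1 * S.t1) / (S.s0 * S.s2 - S.s1 * S.s1) := by
  simp only [solveProg, ↓Timed.val_bind_ite, Timed.val_bind, Timed.val_op]
  split_ifs with h
  · exact (Bool.cond_eq_ite ..).trans (if_pos (decide_eq_true h))
  · exact (Bool.cond_eq_ite ..).trans (if_neg fun h' => h (of_decide_eq_true h'))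

/-- The solution of the normal equations for the intercept, as a weighted mean with the weights
`w k (1 + b u k)`, where `b` minimises `∑ w k (1 + b u k)²`. -/
theorem normalEquations_eq (hw : ∀ k ∈ s, 0 ≤ w k) {j : ι} (hj : j ∈ s) (hwj : 0 < w j)
    (huj : u j = 0) :
    (if (∑ k ∈ s, w k) * (∑ k ∈ s, w k * u k * u k) - (∑ k ∈ s, w k * u k) * ∑ k ∈ s, w k * u k = 0
      then (∑ k ∈ s, w k * y k) / ∑ k ∈ s, w k
      else ((∑ k ∈ s, w k * u k * u k) * (∑ k ∈ s, w k * y k)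
        - (∑ k ∈ s, w k * u k) * (∑ k ∈ s, w k * u k * y k))
        / ((∑ k ∈ s, w k) * (∑ k ∈ s, w k * u k * u k)
          - (∑ k ∈ s, w k * u k) * ∑ k ∈ s, w k * u k))
    = (∑ k ∈ s, w k * (1 + -(∑ k ∈ s, w k * u k) / (∑ k ∈ s, w k * u k * u k) * u k) * y k)
      / ∑ k ∈ s, w k * (1 + -(∑ k ∈ s, w k * u k) / (∑ k ∈ s, w k * u k * u k) * u k) ^ 2 := by
  have hlow : ∀ b : ℝ, w j ≤ ∑ k ∈ s, w k * (1 + b * u k) ^ 2 := by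
    intro b
    have h := Finset.single_le_sum (f := fun k => w k * (1 + b * u k) ^ 2)
      (fun k hk => mul_nonneg (hw k hk) (sq_nonneg _)) hj
    simpa [huj] using h
  have hfirst := first_moment_eq (u := u) hw
  have hnum : ∀ b : ℝ, ∑ k ∈ s, w k * (1 + b * u k) * y k
      = ∑ k ∈ s, w k * y k + b * ∑ k ∈ s, w k * u k * y k := by
    intro b
    simp only [Finset.mul_sum, ← Finset.sum_add_distrib]
    exact Finset.sum_congr rfl fun k _ => by ring
  have hlow' := hlow (-(∑ k ∈ s, w k * u k) / (∑ k ∈ s, w k * u k * u k))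
  rw [hnum]
  rw [sum_weighted_sq_eq] at hlow' ⊢
  set s0 := ∑ k ∈ s, w k
  set s1 := ∑ k ∈ s, w k * u k
  set s2 := ∑ k ∈ s, w k * u k * u k
  set t0 := ∑ k ∈ s, w k * y k
  set t1 := ∑ k ∈ s, w k * u k * y k
  by_cases h2 : s2 = 0
  · have h1 : s1 = 0 := by rw [h2, mul_zero, add_zero] at hfirst; exact hfirst
    simp [h1, h2]
  · have hD : 0 < (s0 + 2 * (-s1 / s2) * s1 + (-s1 / s2) ^ 2 * s2) := hwj.trans_le hlow'
    have he : s0 + 2 * (-s1 / s2) * s1 + (-s1 / s2) ^ 2 * s2 = (s0 * s2 - s1 * s1) / s2 := by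
      field_simp
      ring
    rw [he] at hD ⊢
    have hne : s0 * s2 - s1 * s1 ≠ 0 := fun h => by simp [h] at hD
    rw [if_neg hne]
    field_simp
    ring

end LeastSquares

/-- The position `(k - i) / N` of the index `k` in the window of radius `N` around `i`. -/
noncomputable def relPos (N i k : ℕ) : ℝ := ((k : ℝ) - i) / N

/-- The slope `b` for which `∑ K(u) (1 + b u)²` over the design points in the window is least. -/
noncomputable def lpeSlope (K : ℝ → ℝ) (n N i : ℕ) : ℝ :=
  -(∑ k ∈ Finset.Icc 1 n, K (relPos N i k) * relPos N i k)
    / ∑ k ∈ Finset.Icc 1 n, K (relPos N i k) * relPos N i k * relPos N i k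

/-- The least value of `∑ K(u) (1 + b u)²` over the design points in the window: the reciprocal of
the upper left entry of the inverse Gram matrix. -/
noncomputable def lpeMass (K : ℝ → ℝ) (n N i : ℕ) : ℝ :=
  ∑ k ∈ Finset.Icc 1 n, K (relPos N i k) * (1 + lpeSlope K n N i * relPos N i k) ^ 2

/-- The weight of the observation `k` in the local linear estimate at `i / n` with bandwidth
`N / n`. -/
noncomputable def lpeWeight (K : ℝ → ℝ) (n N i k : ℕ) : ℝ :=
  K (relPos N i k) * (1 + lpeSlope K n N i * relPos N i k) / lpeMass K n N i

section Weights

variable {K : ℝ → ℝ} {Kmax Kmin Δ LK : ℝ}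

theorem KernelAssumptions.le_apply_zero (hK : KernelAssumptions K Kmax Kmin Δ LK) : Kmin ≤ K 0 :=
  hK.lower 0 (by simpa using hK.Δ_pos.le)

theorem KernelAssumptions.Kmax_pos (hK : KernelAssumptions K Kmax Kmin Δ LK) : 0 < Kmax :=
  hK.Kmin_pos.trans_le (hK.le_apply_zero.trans (hK.upper 0))

theorem lpeProg_val_eq_sum (hK : KernelAssumptions K Kmax Kmin Δ LK) {n i : ℕ}
    (m : ℕ) (Y : ℕ → ℝ) (hi : i ∈ Finset.Icc 1 n) :
    (lpeProg K n m Y i).val = ∑ k ∈ Finset.Icc 1 n, lpeWeight K n (4 ^ (m - 1)) i k * Y k := by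
  have hN : 0 < 4 ^ (m - 1) := by positivity
  have w0 := window_sum hi hN hK.support_subset (fun _ => 1)
  have w1 := window_sum hi hN hK.support_subset
    (fun k => ((k : ℝ) - i) / ((4 ^ (m - 1) : ℕ) : ℝ))
  have w2 := window_sum hi hN hK.support_subset
    (fun k => ((k : ℝ) - i) / ((4 ^ (m - 1) : ℕ) : ℝ) * (((k : ℝ) - i) / ((4 ^ (m - 1) : ℕ) : ℝ)))
  have w3 := window_sum hi hN hK.support_subset Y
  have w4 := window_sum hi hN hK.support_subset
    (fun k => ((k : ℝ) - i) / ((4 ^ (m - 1) : ℕ) : ℝ) * Y k)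
  simp only [mul_one] at w0
  simp only [← mul_assoc] at w2 w4
  have h := normalEquations_eq (s := Finset.Icc 1 n) (w := fun k => K (relPos (4 ^ (m - 1)) i k))
    (u := fun k => relPos (4 ^ (m - 1)) i k) (y := Y) (fun k _ => hK.nonneg _) hi
    (by simpa [relPos] using hK.Kmin_pos.trans_le hK.le_apply_zero) (by simp [relPos])
  rw [lpeProg, Timed.val_bind, Timed.val_op, Timed.val_bind, solveProg_val, momentsProg_val]
  simp only [w0, w1, w2, w3, w4]
  refine h.trans ?_
  rw [Finset.sum_div]
  refine Finset.sum_congr rfl fun k _ => ?_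
  simp only [lpeWeight, lpeMass, lpeSlope]
  ring

theorem sum_orthogonal (hK : KernelAssumptions K Kmax Kmin Δ LK) (n N i : ℕ) :
    ∑ k ∈ Finset.Icc 1 n, K (relPos N i k) * (1 + lpeSlope K n N i * relPos N i k) * relPos N i k
      = 0 := by
  have h := first_moment_eq (s := Finset.Icc 1 n) (w := fun k => K (relPos N i k))
    (u := fun k => relPos N i k) (fun k _ => hK.nonneg _)
  rw [← h, lpeSlope, Finset.mul_sum, ← Finset.sum_add_distrib]
  exact Finset.sum_congr rfl fun k _ => by ring

theorem Kmin_le_lpeMass (hK : KernelAssumptions K Kmax Kmin Δ LK) {n i : ℕ} (N : ℕ)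
    (hi : i ∈ Finset.Icc 1 n) : Kmin ≤ lpeMass K n N i := by
  have h := Finset.single_le_sum
    (f := fun k => K (relPos N i k) * (1 + lpeSlope K n N i * relPos N i k) ^ 2)
    (fun k hk => mul_nonneg (hK.nonneg _) (sq_nonneg _)) hi
  refine hK.le_apply_zero.trans (le_trans ?_ h)
  simp [relPos]

theorem sum_lpeWeight (hK : KernelAssumptions K Kmax Kmin Δ LK) {n i : ℕ} (N : ℕ)
    (hi : i ∈ Finset.Icc 1 n) : ∑ k ∈ Finset.Icc 1 n, lpeWeight K n N i k = 1 := by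
  have hm : 0 < lpeMass K n N i := hK.Kmin_pos.trans_le (Kmin_le_lpeMass hK N hi)
  have h : ∑ k ∈ Finset.Icc 1 n, K (relPos N i k) * (1 + lpeSlope K n N i * relPos N i k)
      = lpeMass K n N i := by
    rw [← add_zero (∑ k ∈ Finset.Icc 1 n, _), ← mul_zero (lpeSlope K n N i),
      ← sum_orthogonal hK n N i, lpeMass, Finset.mul_sum, ← Finset.sum_add_distrib]
    exact Finset.sum_congr rfl fun k _ => by ring
  simp only [lpeWeight, ← Finset.sum_div, h]
  exact div_self hm.ne'

theorem sum_lpeWeight_mul (hK : KernelAssumptions K Kmax Kmin Δ LK) (n N i : ℕ) (hN : 0 < N) :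
    ∑ k ∈ Finset.Icc 1 n, lpeWeight K n N i k * ((k : ℝ) - i) = 0 := by
  have h : ∀ k ∈ Finset.Icc 1 n, lpeWeight K n N i k * ((k : ℝ) - i)
      = K (relPos N i k) * (1 + lpeSlope K n N i * relPos N i k) * relPos N i k
        * (N / lpeMass K n N i) := by
    intro k _
    have : (k : ℝ) - i = relPos N i k * N := by
      rw [relPos, div_mul_cancel₀ _ (by positivity)]
    rw [this, lpeWeight]
    ring
  rw [Finset.sum_congr rfl h, ← Finset.sum_mul, sum_orthogonal hK, zero_mul]

theorem lpeWeight_eq_zero (hK : KernelAssumptions K Kmax Kmin Δ LK) (n : ℕ) {N i k : ℕ}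
    (hN : 0 < N) (h : (N : ℝ) < |(k : ℝ) - i|) : lpeWeight K n N i k = 0 := by
  have hz : K (relPos N i k) = 0 := by
    by_contra hne
    have hmem := abs_le.2 (Set.mem_Icc.1 (hK.support_subset hne))
    have hNr : (0 : ℝ) < N := by exact_mod_cast hN
    rw [relPos, abs_div, abs_of_pos hNr, div_le_one hNr] at hmem
    linarith
  rw [lpeWeight, hz, zero_mul, zero_div]

theorem sum_comp_le_sum {n p : ℕ} {F : ℕ → ℝ} (hF : ∀ k, 0 ≤ F k) {φ : ℕ → ℕ}
    (hmaps : ∀ l ∈ Finset.Icc 1 p, φ l ∈ Finset.Icc 1 n)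
    (hinj : Set.InjOn φ (Finset.Icc 1 p)) :
    ∑ l ∈ Finset.Icc 1 p, F (φ l) ≤ ∑ k ∈ Finset.Icc 1 n, F k := by
  rw [← Finset.sum_image (f := F) hinj]
  refine Finset.sum_le_sum_of_subset_of_nonneg ?_ fun k _ _ => hF k
  intro k hk
  obtain ⟨l, hl, rfl⟩ := Finset.mem_image.1 hk
  exact hmaps l hl

/-- At least one of `1 + x` and `1 + 2 x` is bounded away from zero, so that on one side of `i` the
indices `i ± l` and `i ± 2 l` together contribute a fixed amount to the mass. -/
theorem le_lpeMass_of_side (hK : KernelAssumptions K Kmax Kmin Δ LK) {n N i p : ℕ} {ε : ℝ}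
    (hε : ε = 1 ∨ ε = -1) (hN : 0 < N) {φ : ℕ → ℕ}
    (hφ : ∀ l ∈ Finset.Icc 1 (2 * p), φ l ∈ Finset.Icc 1 n ∧ (φ l : ℝ) - i = ε * l)
    (hp : (2 * p : ℝ) ≤ Δ * N) : Kmin * p / 10 ≤ lpeMass K n N i := by
  have hNr : (0 : ℝ) < N := by exact_mod_cast hN
  have hε0 : ε ≠ 0 := by rcases hε with rfl | rfl <;> norm_num
  have hεa : |ε| = 1 := by rcases hε with rfl | rfl <;> norm_num
  set b := lpeSlope K n N i with hb
  set F : ℕ → ℝ := fun k => K (relPos N i k) * (1 + b * relPos N i k) ^ 2 with hF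
  have hF0 : ∀ k, 0 ≤ F k := fun k => mul_nonneg (hK.nonneg _) (sq_nonneg _)
  have hinj : ∀ l ∈ Finset.Icc 1 (2 * p), ∀ l' ∈ Finset.Icc 1 (2 * p), φ l = φ l' → l = l' := by
    intro l hl l' hl' h
    have h1 := (hφ l hl).2
    have h2 := (hφ l' hl').2
    rw [h] at h1
    have := mul_left_cancel₀ hε0 (h1.symm.trans h2)
    exact_mod_cast this
  have hFl : ∀ l ∈ Finset.Icc 1 (2 * p), Kmin * (1 + b * (ε * l / N)) ^ 2 ≤ F (φ l) := by
    intro l hl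
    have hr : relPos N i (φ l) = ε * l / N := by rw [relPos, (hφ l hl).2]
    simp only [hF, hr]
    refine mul_le_mul_of_nonneg_right (hK.lower _ ?_) (sq_nonneg _)
    rw [abs_div, abs_mul, hεa, one_mul, abs_of_nonneg (Nat.cast_nonneg _), abs_of_pos hNr,
      div_le_iff₀ hNr]
    refine le_trans ?_ hp
    exact_mod_cast (Finset.mem_Icc.1 hl).2
  have hm1 : ∀ l ∈ Finset.Icc 1 p, l ∈ Finset.Icc 1 (2 * p) := by
    intro l hl; rw [Finset.mem_Icc] at hl ⊢; omega
  have hm2 : ∀ l ∈ Finset.Icc 1 p, 2 * l ∈ Finset.Icc 1 (2 * p) := by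
    intro l hl; rw [Finset.mem_Icc] at hl ⊢; omega
  have e1 : ∑ l ∈ Finset.Icc 1 p, F (φ l) ≤ lpeMass K n N i :=
    sum_comp_le_sum hF0 (fun l hl => (hφ l (hm1 l hl)).1)
      fun l hl l' hl' h => hinj l (hm1 l hl) l' (hm1 l' hl') h
  have e2 : ∑ l ∈ Finset.Icc 1 p, F (φ (2 * l)) ≤ lpeMass K n N i :=
    sum_comp_le_sum (φ := fun l => φ (2 * l)) hF0 (fun l hl => (hφ _ (hm2 l hl)).1)
      fun l hl l' hl' h => by have := hinj _ (hm2 l hl) _ (hm2 l' hl') h; omega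
  have e3 : (p : ℝ) * (Kmin / 5) ≤ ∑ l ∈ Finset.Icc 1 p, (F (φ l) + F (φ (2 * l))) := by
    have := Finset.card_nsmul_le_sum (Finset.Icc 1 p) (fun l => F (φ l) + F (φ (2 * l)))
      (Kmin / 5) fun l hl => ?_
    · simpa using this
    · have h1 := hFl l (hm1 l hl)
      have h2 := hFl (2 * l) (hm2 l hl)
      have h3 : b * (ε * ((2 * l : ℕ) : ℝ) / N) = 2 * (b * (ε * l / N)) := by push_cast; ring
      rw [h3] at h2
      set x := b * (ε * l / N)
      -- the minimum is attained at `x = -3 / 5`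
      have h4 : (1 : ℝ) / 5 ≤ (1 + x) ^ 2 + (1 + 2 * x) ^ 2 := by nlinarith [sq_nonneg (5 * x + 3)]
      have h5 := mul_le_mul_of_nonneg_left h4 hK.Kmin_pos.le
      linarith
  rw [Finset.sum_add_distrib] at e3
  linarith

/-- The constant in the lower bound for the mass. -/
noncomputable def massConst (Kmin Δ : ℝ) : ℝ := Kmin * min Δ 1 / 40

theorem massConst_pos (hK : KernelAssumptions K Kmax Kmin Δ LK) : 0 < massConst Kmin Δ := by
  have h1 := hK.Kmin_pos
  have h2 := hK.Δ_pos
  unfold massConst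
  positivity

/-- The mass is of the order of the window size: as `2 N ≤ n`, at least one side of each design
point contains a full half window. -/
theorem le_lpeMass (hK : KernelAssumptions K Kmax Kmin Δ LK) {n N i : ℕ}
    (hi : i ∈ Finset.Icc 1 n) (hN : 0 < N) (hn : 2 * N ≤ n) :
    massConst Kmin Δ * N ≤ lpeMass K n N i := by
  have hi' := Finset.mem_Icc.1 hi
  have hNr : (0 : ℝ) < N := by exact_mod_cast hN
  set d := min Δ 1 with hd
  have hdpos : 0 < d := lt_min hK.Δ_pos one_pos
  have hKp := hK.Kmin_pos
  set q := ⌊d * N⌋₊ with hq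
  have hq1 : (q : ℝ) ≤ d * N := Nat.floor_le (by positivity)
  have hq2 : d * N < q + 1 := Nat.lt_floor_add_one _
  have hqN : q ≤ N := by
    have : (q : ℝ) ≤ N := hq1.trans (by nlinarith [min_le_right Δ 1])
    exact_mod_cast this
  obtain ⟨p, hp⟩ : ∃ p, p = q / 2 := ⟨_, rfl⟩
  have hpq : 2 * p ≤ q := by omega
  have hpΔ : (2 * p : ℝ) ≤ Δ * N := by
    have h1 : (2 * p : ℝ) ≤ q := by exact_mod_cast hpq
    have h2 : d * N ≤ Δ * N := mul_le_mul_of_nonneg_right (min_le_left _ _) hNr.le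
    linarith
  have hmass : Kmin * p / 10 ≤ lpeMass K n N i := by
    by_cases hside : i + q ≤ n
    · refine le_lpeMass_of_side hK (ε := 1) (Or.inl rfl) hN (φ := fun l => i + l)
        (fun l hl => ?_) hpΔ
      rw [Finset.mem_Icc] at hl ⊢
      refine ⟨⟨by omega, by omega⟩, by push_cast; ring⟩
    · refine le_lpeMass_of_side hK (ε := -1) (Or.inr rfl) hN (φ := fun l => i - l)
        (fun l hl => ?_) hpΔ
      rw [Finset.mem_Icc] at hl ⊢
      refine ⟨⟨by omega, by omega⟩, ?_⟩
      rw [Nat.cast_sub (by omega)]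
      ring
  have hmc : massConst Kmin Δ = Kmin * d / 40 := rfl
  rw [hmc]
  rcases Nat.eq_zero_or_pos p with h0 | hpos
  · have hq' : q ≤ 1 := by omega
    have : (q : ℝ) ≤ 1 := by exact_mod_cast hq'
    have hlow := Kmin_le_lpeMass hK N hi
    nlinarith
  · have hq' : q + 1 ≤ 4 * p := by omega
    have : (q : ℝ) + 1 ≤ 4 * p := by exact_mod_cast hq'
    nlinarith

theorem sum_sq_lpeWeight_le (hK : KernelAssumptions K Kmax Kmin Δ LK) {n N i : ℕ}
    (hi : i ∈ Finset.Icc 1 n) (hN : 0 < N) (hn : 2 * N ≤ n) :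
    ∑ k ∈ Finset.Icc 1 n, lpeWeight K n N i k ^ 2 ≤ Kmax / massConst Kmin Δ / N := by
  have hm := le_lpeMass hK hi hN hn
  have hc := massConst_pos hK
  have hNr : (0 : ℝ) < N := by exact_mod_cast hN
  have hv : 0 < lpeMass K n N i := (by positivity : 0 < massConst Kmin Δ * N).trans_le hm
  have hle : ∀ k ∈ Finset.Icc 1 n, lpeWeight K n N i k ^ 2
      ≤ Kmax / lpeMass K n N i ^ 2
        * (K (relPos N i k) * (1 + lpeSlope K n N i * relPos N i k) ^ 2) := by
    intro k _
    have h1 : lpeWeight K n N i k ^ 2 = K (relPos N i k) / lpeMass K n N i ^ 2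
        * (K (relPos N i k) * (1 + lpeSlope K n N i * relPos N i k) ^ 2) := by
      rw [lpeWeight]; ring
    rw [h1]
    refine mul_le_mul_of_nonneg_right ?_ (mul_nonneg (hK.nonneg _) (sq_nonneg _))
    exact div_le_div_of_nonneg_right (hK.upper _) (by positivity)
  refine (Finset.sum_le_sum hle).trans ?_
  rw [← Finset.mul_sum]
  change Kmax / lpeMass K n N i ^ 2 * lpeMass K n N i ≤ _
  rw [div_div, pow_two, div_mul_eq_mul_div, mul_div_mul_right _ _ hv.ne']
  exact div_le_div_of_nonneg_left hK.Kmax_pos.le (by positivity) hm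

/-- The Lebesgue constant of the estimator is bounded, by the Cauchy–Schwarz inequality on the at
most `3 N` points of the window. -/
theorem sum_abs_lpeWeight_le (hK : KernelAssumptions K Kmax Kmin Δ LK) {n N i : ℕ}
    (hi : i ∈ Finset.Icc 1 n) (hN : 0 < N) (hn : 2 * N ≤ n) :
    ∑ k ∈ Finset.Icc 1 n, |lpeWeight K n N i k| ≤ √(3 * (Kmax / massConst Kmin Δ)) := by
  have hNr : (0 : ℝ) < N := by exact_mod_cast hN
  have hi' := Finset.mem_Icc.1 hi
  have hsub : ∑ k ∈ Finset.Icc 1 n, |lpeWeight K n N i k|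
      = ∑ k ∈ (Finset.Icc 1 n).filter (fun k => k ∈ Finset.Icc (i - N) (i + N)),
        |lpeWeight K n N i k| := by
    rw [Finset.sum_filter_of_ne]
    intro k _ hne
    by_contra hcon
    refine hne ?_
    rw [abs_eq_zero]
    refine lpeWeight_eq_zero hK n hN ?_
    rw [Finset.mem_Icc, not_and_or, not_le, not_le] at hcon
    rcases hcon with h | h
    · have h' : (k : ℝ) + N < i := by exact_mod_cast (by omega : k + N < i)
      rw [lt_abs]; right; linarith
    · have h' : (i : ℝ) + N < k := by exact_mod_cast h
      rw [lt_abs]; left; linarith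
  rw [hsub]
  refine Real.le_sqrt_of_sq_le ?_
  refine (sq_sum_le_card_mul_sum_sq).trans ?_
  have hcard : (((Finset.Icc 1 n).filter (fun k => k ∈ Finset.Icc (i - N) (i + N))).card : ℝ)
      ≤ 3 * N := by
    have h1 : ((Finset.Icc 1 n).filter (fun k => k ∈ Finset.Icc (i - N) (i + N))).card
        ≤ (Finset.Icc (i - N) (i + N)).card :=
      Finset.card_le_card fun k hk => (Finset.mem_filter.1 hk).2
    rw [Nat.card_Icc] at h1
    exact_mod_cast h1.trans (by omega)
  have hsq : ∑ k ∈ (Finset.Icc 1 n).filter (fun k => k ∈ Finset.Icc (i - N) (i + N)),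
      |lpeWeight K n N i k| ^ 2 ≤ Kmax / massConst Kmin Δ / N := by
    refine le_trans ?_ (sum_sq_lpeWeight_le hK hi hN hn)
    simp only [sq_abs]
    exact Finset.sum_le_sum_of_subset_of_nonneg (Finset.filter_subset _ _)
      fun k _ _ => sq_nonneg _
  refine (mul_le_mul hcard hsq (Finset.sum_nonneg fun k _ => by positivity)
    (by positivity)).trans (le_of_eq ?_)
  field_simp

end Weights

/-! ### The bias on Hölder classes -/

theorem ceil_eq_one {β : ℝ} (h0 : 0 < β) (h1 : β ≤ 1) : ⌈β⌉₊ = 1 := by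
  rw [Nat.ceil_eq_iff (by norm_num)]
  constructor <;> norm_num <;> assumption

theorem ceil_eq_two {β : ℝ} (h1 : 1 < β) (h2 : β ≤ 2) : ⌈β⌉₊ = 2 := by
  rw [Nat.ceil_eq_iff (by norm_num)]
  constructor <;> norm_num <;> assumption

theorem Holder.abs_sub_le {β L : ℝ} (h0 : 0 < β) (h1 : β ≤ 1) {f : ℝ → ℝ} (hf : f ∈ Holder β L)
    {x y : ℝ} (hx : x ∈ Set.Icc (0 : ℝ) 1) (hy : y ∈ Set.Icc (0 : ℝ) 1) :
    |f x - f y| ≤ L * |x - y| ^ β := by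
  have h := hf.2 x hx y hy
  simpa [ceil_eq_one h0 h1] using h

theorem Holder.differentiableOn {β L : ℝ} (h1 : 1 < β) (h2 : β ≤ 2) {f : ℝ → ℝ}
    (hf : f ∈ Holder β L) : DifferentiableOn ℝ f (Set.Icc 0 1) := by
  have h := hf.1
  rw [ceil_eq_two h1 h2] at h
  exact h.differentiableOn (by norm_num)

theorem Holder.abs_derivWithin_sub_le {β L : ℝ} (h1 : 1 < β) (h2 : β ≤ 2) {f : ℝ → ℝ}
    (hf : f ∈ Holder β L) {x y : ℝ} (hx : x ∈ Set.Icc (0 : ℝ) 1) (hy : y ∈ Set.Icc (0 : ℝ) 1) :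
    |derivWithin f (Set.Icc 0 1) x - derivWithin f (Set.Icc 0 1) y| ≤ L * |x - y| ^ (β - 1) := by
  have h := hf.2 x hx y hy
  have e : β + 1 - 2 = β - 1 := by ring
  simpa [ceil_eq_two h1 h2, iteratedDerivWithin_one, e] using h

/-- First-order Taylor expansion with Hölder remainder. -/
theorem Holder.abs_taylor_le {β L : ℝ} (h1 : 1 < β) (h2 : β ≤ 2) (hL : 0 < L) {f : ℝ → ℝ}
    (hf : f ∈ Holder β L) {x y : ℝ} (hx : x ∈ Set.Icc (0 : ℝ) 1) (hy : y ∈ Set.Icc (0 : ℝ) 1) :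
    |f y - f x - derivWithin f (Set.Icc 0 1) x * (y - x)| ≤ L * |y - x| ^ β := by
  have hsub : Set.uIcc x y ⊆ Set.Icc 0 1 := Set.uIcc_subset_Icc hx hy
  have hd : ∀ z ∈ Set.uIcc x y, HasDerivWithinAt
      (fun z => f z - derivWithin f (Set.Icc 0 1) x * z)
      (derivWithin f (Set.Icc 0 1) z - derivWithin f (Set.Icc 0 1) x) (Set.uIcc x y) z := by
    intro z hz
    have hfz := (Holder.differentiableOn h1 h2 hf z (hsub hz)).hasDerivWithinAt.mono hsub
    have h := hfz.sub ((hasDerivWithinAt_id z _).const_mul (derivWithin f (Set.Icc 0 1) x))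
    rw [mul_one] at h
    exact h
  have hb : ∀ z ∈ Set.uIcc x y,
      ‖derivWithin f (Set.Icc 0 1) z - derivWithin f (Set.Icc 0 1) x‖ ≤ L * |y - x| ^ (β - 1) := by
    intro z hz
    refine (Holder.abs_derivWithin_sub_le h1 h2 hf (hsub hz) hx).trans ?_
    exact mul_le_mul_of_nonneg_left (Real.rpow_le_rpow (abs_nonneg _)
      (Set.abs_sub_left_of_mem_uIcc hz) (by linarith)) hL.le
  have h := Convex.norm_image_sub_le_of_norm_hasDerivWithin_le hd hb (convex_uIcc x y)
    Set.left_mem_uIcc Set.right_mem_uIcc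
  rw [Real.norm_eq_abs, Real.norm_eq_abs] at h
  have e : L * |y - x| ^ (β - 1) * |y - x| = L * |y - x| ^ β := by
    rcases eq_or_ne (y - x) 0 with h0 | h0
    · rw [h0, abs_zero, Real.zero_rpow (by linarith : β ≠ 0), mul_zero, mul_zero]
    · rw [mul_assoc, ← Real.rpow_add_one (abs_ne_zero.2 h0)]
      ring_nf
  rw [e] at h
  refine le_trans (le_of_eq ?_) h
  congr 1
  ring

theorem design_mem_Icc {n k : ℕ} (hk : k ∈ Finset.Icc 1 n) : (k / n : ℝ) ∈ Set.Icc (0 : ℝ) 1 := by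
  have hk' := Finset.mem_Icc.1 hk
  have h1 : (k : ℝ) ≤ n := by exact_mod_cast hk'.2
  exact ⟨by positivity, div_le_one_of_le₀ h1 (by positivity)⟩

/-- The bias of the local linear estimator; the weights reproduce affine functions. -/
theorem bias_le {K : ℝ → ℝ} {Kmax Kmin Δ LK : ℝ} (hK : KernelAssumptions K Kmax Kmin Δ LK)
    {β L : ℝ} (hβ : 0 < β) (hβ2 : β ≤ 2) (hL : 0 < L) {f : ℝ → ℝ} (hf : f ∈ Holder β L)
    {n N i : ℕ} (hi : i ∈ Finset.Icc 1 n) (hN : 0 < N) (hn : 2 * N ≤ n) :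
    |∑ k ∈ Finset.Icc 1 n, lpeWeight K n N i k * f (k / n) - f (i / n)|
      ≤ √(3 * (Kmax / massConst Kmin Δ)) * L * (N / n : ℝ) ^ β := by
  have hi' := Finset.mem_Icc.1 hi
  have hn0 : (0 : ℝ) < n := by exact_mod_cast (by omega : 0 < n)
  obtain ⟨s, hs⟩ : ∃ s : ℝ, ∀ k ∈ Finset.Icc 1 n,
      |f (k / n) - f (i / n) - s * ((k : ℝ) - i)| ≤ L * |(k / n : ℝ) - i / n| ^ β := by
    by_cases h1 : β ≤ 1
    · refine ⟨0, fun k hk => ?_⟩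
      rw [zero_mul, sub_zero]
      exact Holder.abs_sub_le hβ h1 hf (design_mem_Icc hk) (design_mem_Icc hi)
    · refine ⟨derivWithin f (Set.Icc 0 1) (i / n) / n, fun k hk => ?_⟩
      refine le_trans (le_of_eq ?_)
        (Holder.abs_taylor_le (not_le.1 h1) hβ2 hL hf (design_mem_Icc hi)
        (design_mem_Icc hk))
      congr 1
      ring
  have e : ∑ k ∈ Finset.Icc 1 n, lpeWeight K n N i k * f (k / n) - f (i / n)
      = ∑ k ∈ Finset.Icc 1 n, lpeWeight K n N i k
        * (f (k / n) - f (i / n) - s * ((k : ℝ) - i)) := by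
    have h1 := sum_lpeWeight hK N hi
    have h2 := sum_lpeWeight_mul hK n N i hN
    have h3 : ∀ k ∈ Finset.Icc 1 n, lpeWeight K n N i k
        * (f (k / n) - f (i / n) - s * ((k : ℝ) - i)) = lpeWeight K n N i k * f (k / n)
          - f (i / n) * lpeWeight K n N i k - s * (lpeWeight K n N i k * ((k : ℝ) - i)) := by
      intro k _; ring
    rw [Finset.sum_congr rfl h3, Finset.sum_sub_distrib, Finset.sum_sub_distrib,
      ← Finset.mul_sum, ← Finset.mul_sum, h1, h2]
    ring
  rw [e]
  have hle : ∀ k ∈ Finset.Icc 1 n, |lpeWeight K n N i k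
      * (f (k / n) - f (i / n) - s * ((k : ℝ) - i))|
        ≤ |lpeWeight K n N i k| * (L * (N / n : ℝ) ^ β) := by
    intro k hk
    rw [abs_mul]
    by_cases hkN : (N : ℝ) < |(k : ℝ) - i|
    · rw [lpeWeight_eq_zero hK n hN hkN]; simp
    · refine mul_le_mul_of_nonneg_left ((hs k hk).trans ?_) (abs_nonneg _)
      rw [← sub_div, abs_div, abs_of_pos hn0]
      gcongr
      exact not_lt.1 hkN
  refine (Finset.abs_sum_le_sum_abs _ _).trans ((Finset.sum_le_sum hle).trans ?_)
  rw [← Finset.sum_mul, mul_assoc]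
  exact mul_le_mul_of_nonneg_right (sum_abs_lpeWeight_le hK hi hN hn) (by positivity)

/-! ### The stochastic error of the estimator -/

instance (σ : ℝ) : IsProbabilityMeasure (noiseLaw σ) := by
  unfold noiseLaw
  infer_instance

theorem hasSubgaussianMGF_noise (σ : ℝ) (k : ℕ) :
    HasSubgaussianMGF (fun e : ℕ → ℝ => e k) (Real.toNNReal (σ ^ 2)) (noiseLaw σ) := by
  have hmap : (noiseLaw σ).map (fun e : ℕ → ℝ => e k) = gaussianReal 0 (Real.toNNReal (σ ^ 2)) :=
    Measure.infinitePi_map_eval _ k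
  refine HasSubgaussianMGF.of_map (X := id) (measurable_pi_apply k).aemeasurable ?_
  rw [hmap]
  refine ⟨fun t => integrable_exp_mul_gaussianReal t, fun t => ?_⟩
  simp [mgf_id_gaussianReal]

/-- The stochastic error of the estimate at `i / n` with bandwidth `N / n`. -/
noncomputable def noisePart (K : ℝ → ℝ) (n N i : ℕ) (e : ℕ → ℝ) : ℝ :=
  ∑ k ∈ Finset.Icc 1 n, lpeWeight K n N i k * e k

theorem measurable_noisePart (K : ℝ → ℝ) (n N i : ℕ) : Measurable (noisePart K n N i) := by
  unfold noisePart
  fun_prop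

theorem integrable_noise (σ : ℝ) (k : ℕ) : Integrable (fun e : ℕ → ℝ => e k) (noiseLaw σ) :=
  (hasSubgaussianMGF_noise σ k).integrable

theorem integral_noise (σ : ℝ) (k : ℕ) : ∫ e, e k ∂(noiseLaw σ) = 0 := by
  have hmap : (noiseLaw σ).map (fun e : ℕ → ℝ => e k) = gaussianReal 0 (Real.toNNReal (σ ^ 2)) :=
    Measure.infinitePi_map_eval _ k
  have h := integral_map (μ := noiseLaw σ) (φ := fun e : ℕ → ℝ => e k) (f := id)
    (measurable_pi_apply k).aemeasurable (by fun_prop)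
  rw [hmap] at h
  simpa using h.symm

theorem integrable_noisePart (σ : ℝ) (K : ℝ → ℝ) (n N i : ℕ) :
    Integrable (noisePart K n N i) (noiseLaw σ) :=
  integrable_finsetSum _ fun k _ => (integrable_noise σ k).const_mul _

theorem integral_noisePart (σ : ℝ) (K : ℝ → ℝ) (n N i : ℕ) :
    ∫ e, noisePart K n N i e ∂(noiseLaw σ) = 0 := by
  unfold noisePart
  rw [integral_finsetSum _ fun k _ => (integrable_noise σ k).const_mul _]
  simp only [integral_const_mul, integral_noise, mul_zero, Finset.sum_const_zero]

theorem lpeProg_obs {K : ℝ → ℝ} {Kmax Kmin Δ LK : ℝ} (hK : KernelAssumptions K Kmax Kmin Δ LK)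
    {n i : ℕ} (m : ℕ) (f : ℝ → ℝ) (e : ℕ → ℝ) (hi : i ∈ Finset.Icc 1 n) :
    (lpeProg K n m (obs f n e) i).val
      = ∑ k ∈ Finset.Icc 1 n, lpeWeight K n (4 ^ (m - 1)) i k * f (k / n)
        + noisePart K n (4 ^ (m - 1)) i e := by
  rw [lpeProg_val_eq_sum hK m _ hi, noisePart, ← Finset.sum_add_distrib]
  exact Finset.sum_congr rfl fun k _ => by rw [obs, mul_add]

theorem integral_lpe {K : ℝ → ℝ} {Kmax Kmin Δ LK : ℝ} (hK : KernelAssumptions K Kmax Kmin Δ LK)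
    {n i : ℕ} (m : ℕ) (f : ℝ → ℝ) (σ : ℝ) (hi : i ∈ Finset.Icc 1 n) :
    ∫ e, lpe K n (bw n m) (obs f n e) (i / n) ∂(noiseLaw σ)
      = ∑ k ∈ Finset.Icc 1 n, lpeWeight K n (4 ^ (m - 1)) i k * f (k / n) := by
  simp only [← lpeProg_val hK m _ hi, lpeProg_obs hK m f _ hi]
  rw [integral_add (integrable_const _) (integrable_noisePart _ _ _ _ _), integral_noisePart,
    integral_const]
  simp

/-- The sub-Gaussian tail bound for the stochastic error. -/
theorem measure_noisePart_gt_le {K : ℝ → ℝ} {σ V t : ℝ} {n N i : ℕ} (ht : 0 ≤ t)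
    (hV : σ ^ 2 * ∑ k ∈ Finset.Icc 1 n, lpeWeight K n N i k ^ 2 ≤ V) :
    noiseLaw σ {e | t < |noisePart K n N i e|}
      ≤ ENNReal.ofReal (2 * Real.exp (-t ^ 2 / (2 * V))) := by
  have hV0 : 0 ≤ V := le_trans (mul_nonneg (sq_nonneg _)
    (Finset.sum_nonneg fun k _ => sq_nonneg _)) hV
  have hind : iIndepFun (fun k (e : ℕ → ℝ) => lpeWeight K n N i k * e k) (noiseLaw σ) :=
    iIndepFun_infinitePi (P := fun _ => gaussianReal 0 (Real.toNNReal (σ ^ 2)))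
      (X := fun k x => lpeWeight K n N i k * x) (fun k => by fun_prop)
  have hsub := HasSubgaussianMGF.sum_of_iIndepFun hind (s := Finset.Icc 1 n)
    (fun k _ => (hasSubgaussianMGF_noise σ k).const_mul (lpeWeight K n N i k))
  have hsub' : HasSubgaussianMGF (noisePart K n N i) ⟨V, hV0⟩ (noiseLaw σ) := by
    refine ⟨hsub.integrable_exp_mul, fun t => (hsub.mgf_le t).trans ?_⟩
    rw [Real.exp_le_exp]
    gcongr
    push_cast
    refine le_trans (le_of_eq ?_) hV
    rw [Finset.mul_sum]
    refine Finset.sum_congr rfl fun k _ => ?_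
    refine (mul_comm _ _).trans ?_
    exact congrArg (· * lpeWeight K n N i k ^ 2) (Real.coe_toNNReal _ (sq_nonneg σ))
  have h1 := hsub'.measure_ge_le ht
  have h2 := hsub'.neg.measure_ge_le ht
  have hcover : {e | t < |noisePart K n N i e|}
      ⊆ {e | t ≤ noisePart K n N i e} ∪ {e | t ≤ (-noisePart K n N i) e} := by
    intro e he
    have he' : t < |noisePart K n N i e| := he
    rcases lt_abs.1 he' with h | h
    · exact Or.inl h.le
    · exact Or.inr h.le
  refine (measure_mono hcover).trans ((measure_union_le _ _).trans ?_)
  rw [← ofReal_measureReal, ← ofReal_measureReal, ← ENNReal.ofReal_add (by positivity)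
    (by positivity)]
  refine ENNReal.ofReal_le_ofReal ?_
  rw [two_mul]
  exact add_le_add h1 h2

/-- The stochastic error exceeds `τ √(log n / N)` with probability at most `2 n ^ (-c τ²)`. -/
theorem measure_noisePart_gt_le_rpow {K : ℝ → ℝ} {Kmax Kmin Δ LK : ℝ}
    (hK : KernelAssumptions K Kmax Kmin Δ LK) {σ τ : ℝ} (hσ : 0 < σ) (hτ : 0 ≤ τ) {n N i : ℕ}
    (hi : i ∈ Finset.Icc 1 n) (hN : 0 < N) (hn : 2 * N ≤ n) :
    noiseLaw σ {e | τ * √(Real.log n / N) < |noisePart K n N i e|}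
      ≤ ENNReal.ofReal (2 * (n : ℝ) ^ (-(τ ^ 2 / (2 * (σ ^ 2 * (Kmax / massConst Kmin Δ)))))) := by
  have hn0 : (0 : ℝ) < n := by exact_mod_cast (by omega : 0 < n)
  have hNr : (0 : ℝ) < N := by exact_mod_cast hN
  have hlog : 0 ≤ Real.log n := Real.log_natCast_nonneg n
  have h := measure_noisePart_gt_le (K := K) (σ := σ) (n := n) (N := N) (i := i)
    (t := τ * √(Real.log n / N)) (by positivity)
    (mul_le_mul_of_nonneg_left (sum_sq_lpeWeight_le hK hi hN hn) (sq_nonneg σ))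
  refine h.trans (ENNReal.ofReal_le_ofReal (le_of_eq ?_))
  rw [Real.rpow_def_of_pos hn0, mul_pow, Real.sq_sqrt (by positivity)]
  congr 2
  have hV : 0 < σ ^ 2 * (Kmax / massConst Kmin Δ) := by
    have h1 := massConst_pos hK
    have h2 := hK.Kmax_pos
    positivity
  field_simp

/-! ### Probabilities and sure bounds for randomised programs -/

namespace Prog

variable {α β : Type}

/-- The joint law of the result and of the number of steps. -/
def toPMF (x : Prog α) : PMF (Timed α) := x

/-- The probability of a set of outcomes (results with step counts). -/
noncomputable def pr (x : Prog α) (S : Set (Timed α)) : ENNReal := x.toPMF.toOuterMeasure S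

/-- All possible outcomes satisfy `Q`. -/
def Sure (x : Prog α) (Q : Timed α → Prop) : Prop := ∀ r ∈ x.toPMF.support, Q r

theorem toPMF_pure (a : α) : (pure a : Prog α).toPMF = PMF.pure ⟨a, 0⟩ := rfl

theorem toPMF_bind (x : Prog α) (f : α → Prog β) : (x >>= f).toPMF = x.toPMF.bind fun p =>
    (f p.val).toPMF.map fun q => (⟨q.val, p.steps + q.steps⟩ : Timed β) := rfl

theorem toPMF_lift (t : Timed α) : (liftM t : Prog α).toPMF = PMF.pure t := rfl

theorem toPMF_draw {w : ℕ} (hw : 1 ≤ w) : (draw w).toPMF =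
    (PMF.uniformOfFinset (Finset.Icc 1 w) (Finset.nonempty_Icc.2 hw)).map fun j => ⟨j, 1⟩ := by
  have h : max 1 w = w := max_eq_right hw
  change PMF.map _ (PMF.uniformOfFinset (Finset.Icc 1 (max 1 w)) _) = _
  congr 2
  rw [h]

theorem pr_mono {x : Prog α} {S S' : Set (Timed α)} (h : S ⊆ S') : x.pr S ≤ x.pr S' :=
  measure_mono h

theorem pr_le_one (x : Prog α) (S : Set (Timed α)) : x.pr S ≤ 1 := by
  refine (measure_mono (Set.subset_univ S)).trans (le_of_eq ?_)
  exact (PMF.toOuterMeasure_apply_eq_one_iff (p := x.toPMF) Set.univ).2 (Set.subset_univ _)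

theorem pr_eq_one {x : Prog α} {S : Set (Timed α)} (h : x.Sure fun r => r ∈ S) : x.pr S = 1 :=
  (PMF.toOuterMeasure_apply_eq_one_iff (p := x.toPMF) S).2 h

theorem pr_eq_zero {x : Prog α} {S : Set (Timed α)} (h : x.Sure fun r => r ∉ S) : x.pr S = 0 :=
  (PMF.toOuterMeasure_apply_eq_zero_iff (p := x.toPMF) S).2 (Set.disjoint_left.2 h)

theorem pr_union_le (x : Prog α) (S S' : Set (Timed α)) : x.pr (S ∪ S') ≤ x.pr S + x.pr S' :=
  measure_union_le S S'

/-- Outcomes of probability zero do not matter. -/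
theorem pr_le_of_sure {x : Prog α} {S S' : Set (Timed α)} (h : x.Sure fun r => r ∈ S → r ∈ S') :
    x.pr S ≤ x.pr S' :=
  PMF.toOuterMeasure_mono (p := x.toPMF) fun r hr => h r hr.2 hr.1

theorem pr_compl (x : Prog α) (S : Set (Timed α)) : x.pr S + x.pr Sᶜ = 1 := by
  have h : x.pr S + x.pr Sᶜ = ∑' r, x.toPMF r := by
    simp only [pr, PMF.toOuterMeasure_apply]
    rw [← ENNReal.tsum_add]
    exact tsum_congr fun r => by rw [Set.indicator_self_add_compl_apply]
  rw [h]
  exact PMF.tsum_coe _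

theorem pr_bind (x : Prog α) (f : α → Prog β) (S : Set (Timed β)) :
    (x >>= f).pr S = ∑' p, x.toPMF p
      * (f p.val).pr {q | (⟨q.val, p.steps + q.steps⟩ : Timed β) ∈ S} := by
  rw [pr, toPMF_bind, PMF.toOuterMeasure_bind_apply]
  refine tsum_congr fun p => ?_
  rw [PMF.toOuterMeasure_map_apply]
  rfl

theorem pr_lift_bind (t : Timed α) (f : α → Prog β) (S : Set (Timed β)) :
    ((liftM t : Prog α) >>= f).pr S
      = (f t.val).pr {q | (⟨q.val, t.steps + q.steps⟩ : Timed β) ∈ S} := by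
  rw [pr, toPMF_bind, toPMF_lift, PMF.pure_bind, PMF.toOuterMeasure_map_apply]
  rfl

theorem pr_op_bind (a : α) (f : α → Prog β) (S : Set (Timed β)) :
    ((liftM (op a) : Prog α) >>= f).pr S
      = (f a).pr {q | (⟨q.val, 1 + q.steps⟩ : Timed β) ∈ S} :=
  pr_lift_bind (op a) f S

theorem pr_draw_bind {w : ℕ} (hw : 1 ≤ w) (f : ℕ → Prog β) (S : Set (Timed β)) :
    (draw w >>= f).pr S
      = (∑ j ∈ Finset.Icc 1 w, (f j).pr {q | (⟨q.val, 1 + q.steps⟩ : Timed β) ∈ S}) / w := by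
  rw [pr, toPMF_bind, toPMF_draw hw, PMF.bind_map, PMF.toOuterMeasure_bind_apply,
    tsum_eq_sum (s := Finset.Icc 1 w)]
  · rw [div_eq_mul_inv, Finset.sum_mul]
    refine Finset.sum_congr rfl fun j hj => ?_
    rw [PMF.uniformOfFinset_apply, if_pos hj, mul_comm]
    simp only [Function.comp, PMF.toOuterMeasure_map_apply, Nat.card_Icc, Nat.add_sub_cancel]
    rfl
  · intro j hj
    rw [PMF.uniformOfFinset_apply, if_neg hj, zero_mul]

theorem Sure.mono {x : Prog α} {Q Q' : Timed α → Prop} (h : x.Sure Q) (h' : ∀ r, Q r → Q' r) :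
    x.Sure Q' := fun r hr => h' r (h r hr)

theorem sure_pure {a : α} {Q : Timed α → Prop} (h : Q ⟨a, 0⟩) : (pure a : Prog α).Sure Q := by
  intro r hr
  rw [toPMF_pure, PMF.mem_support_pure_iff] at hr
  rwa [hr]

theorem sure_bind {x : Prog α} {f : α → Prog β} {Q : Timed β → Prop} (Q₁ : Timed α → Prop)
    (h₁ : x.Sure Q₁)
    (h₂ : ∀ p, Q₁ p → (f p.val).Sure fun q => Q ⟨q.val, p.steps + q.steps⟩) :
    (x >>= f).Sure Q := by
  intro r hr
  rw [toPMF_bind, PMF.mem_support_bind_iff] at hr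
  obtain ⟨p, hp, hr⟩ := hr
  rw [PMF.mem_support_map_iff] at hr
  obtain ⟨q, hq, rfl⟩ := hr
  exact h₂ p (h₁ p hp) q hq

theorem sure_lift_bind {t : Timed α} {f : α → Prog β} {Q : Timed β → Prop}
    (h : (f t.val).Sure fun q => Q ⟨q.val, t.steps + q.steps⟩) :
    ((liftM t : Prog α) >>= f).Sure Q := by
  refine sure_bind (fun p => p = t) (fun r hr => ?_) ?_
  · rwa [toPMF_lift, PMF.mem_support_pure_iff] at hr
  · rintro p rfl
    exact h

theorem sure_op_bind {a : α} {f : α → Prog β} {Q : Timed β → Prop}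
    (h : (f a).Sure fun q => Q ⟨q.val, 1 + q.steps⟩) :
    ((liftM (op a) : Prog α) >>= f).Sure Q :=
  sure_lift_bind (t := op a) h

theorem sure_draw_bind {w : ℕ} (hw : 1 ≤ w) {f : ℕ → Prog β} {Q : Timed β → Prop}
    (h : ∀ j ∈ Finset.Icc 1 w, (f j).Sure fun q => Q ⟨q.val, 1 + q.steps⟩) :
    (draw w >>= f).Sure Q := by
  refine sure_bind (fun p => p.val ∈ Finset.Icc 1 w ∧ p.steps = 1) (fun r hr => ?_) ?_
  · rw [toPMF_draw hw, PMF.mem_support_map_iff] at hr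
    obtain ⟨j, hj, rfl⟩ := hr
    rw [PMF.support_uniformOfFinset] at hj
    exact ⟨hj, rfl⟩
  · rintro ⟨j, c⟩ ⟨hj, hc⟩
    have hc' : c = 1 := hc
    subst hc'
    exact h j hj

/-- A bound that holds for all possible results of the first program holds for the composition. -/
theorem pr_bind_le {x : Prog α} {f : α → Prog β} {S : Set (Timed β)} {B : ENNReal}
    (h : ∀ p ∈ x.toPMF.support, (f p.val).pr {q | (⟨q.val, p.steps + q.steps⟩ : Timed β) ∈ S} ≤ B) :
    (x >>= f).pr S ≤ B := by
  rw [pr_bind]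
  calc _ ≤ ∑' p, x.toPMF p * B := by
        refine ENNReal.tsum_le_tsum fun p => ?_
        by_cases hp : p ∈ x.toPMF.support
        · gcongr
          exact h p hp
        · rw [(PMF.apply_eq_zero_iff (p := x.toPMF) p).2 hp, zero_mul, zero_mul]
    _ = B := by rw [ENNReal.tsum_mul_right, PMF.tsum_coe, one_mul]

/-- If an event of the first program gives the second one a conditional probability of at least
`B`, the probabilities multiply. -/
theorem le_pr_bind {x : Prog α} {f : α → Prog β} {S : Set (Timed β)} {B : ENNReal}
    (E : Set (Timed α))
    (h : ∀ p ∈ x.toPMF.support, p ∈ E →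
      B ≤ (f p.val).pr {q | (⟨q.val, p.steps + q.steps⟩ : Timed β) ∈ S}) :
    x.pr E * B ≤ (x >>= f).pr S := by
  rw [pr_bind, pr, PMF.toOuterMeasure_apply, ← ENNReal.tsum_mul_right]
  refine ENNReal.tsum_le_tsum fun p => ?_
  by_cases hp : p ∈ x.toPMF.support
  · by_cases hE : p ∈ E
    · rw [Set.indicator_of_mem hE]
      gcongr
      exact h p hp hE
    · rw [Set.indicator_of_notMem hE, zero_mul]
      exact zero_le
  · have h0 := (PMF.apply_eq_zero_iff (p := x.toPMF) p).2 hp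
    have : E.indicator x.toPMF p = 0 := Set.indicator_apply_eq_zero.2 fun _ => h0
    rw [this, zero_mul]
    exact zero_le

/-- Upper bound for a composition: outcomes of the first program outside `E ∪ E'` are harmless,
those in `E'` leave a conditional probability of at most `B`. -/
theorem pr_bind_le_add {x : Prog α} {f : α → Prog β} {S : Set (Timed β)} {B : ENNReal}
    (E E' : Set (Timed α))
    (h : ∀ p ∈ x.toPMF.support, p ∉ E →
      p ∈ E' ∧ (f p.val).pr {q | (⟨q.val, p.steps + q.steps⟩ : Timed β) ∈ S} ≤ B
      ∨ (f p.val).pr {q | (⟨q.val, p.steps + q.steps⟩ : Timed β) ∈ S} = 0) :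
    (x >>= f).pr S ≤ x.pr E + x.pr E' * B := by
  rw [pr_bind, pr, pr, PMF.toOuterMeasure_apply, PMF.toOuterMeasure_apply,
    ← ENNReal.tsum_mul_right, ← ENNReal.tsum_add]
  refine ENNReal.tsum_le_tsum fun p => ?_
  by_cases hp : p ∈ x.toPMF.support
  · by_cases hE : p ∈ E
    · rw [Set.indicator_of_mem hE]
      refine le_add_right ?_
      calc _ ≤ x.toPMF p * 1 := by gcongr; exact pr_le_one _ _
        _ = _ := mul_one _
    · rcases h p hp hE with ⟨hE', hB⟩ | h0
      · rw [Set.indicator_of_mem hE']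
        refine le_add_left ?_
        gcongr
      · rw [h0, mul_zero]
        exact zero_le
  · rw [(PMF.apply_eq_zero_iff (p := x.toPMF) p).2 hp, zero_mul]
    exact zero_le

end Prog

/-! ### The index generator -/

section Search

variable {r : ℕ} {pt : ℕ → ℕ} {pq : ℕ → ℕ × ℕ}

theorem one_le_min_pow {r : ℕ} (hr : 1 ≤ r) (k : ℕ) : 1 ≤ min (2 ^ k) r :=
  le_min (Nat.one_le_pow _ _ (by norm_num)) hr

/-- An outcome of the search satisfies `Q` if every choice in the first level leads to it. -/
theorem sure_searchProg_cons (hr : 1 ≤ r) {k : ℕ} {ks : List ℕ} {s : List (ℕ × ℕ) × List ℕ}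
    {Q : Timed (List (ℕ × ℕ) × List ℕ) → Prop}
    (h : ∀ j ∈ Finset.Icc 1 (min (2 ^ k) r),
      (searchProg r pt pq ks ((insertProg (pq j) s.1).val, (insertProg (pt j) s.2).val)).Sure
        fun q => Q ⟨q.val, 6 + (insertProg (pt j) s.2).steps + (insertProg (pq j) s.1).steps
          + q.steps⟩) :
    (searchProg r pt pq (k :: ks) s).Sure Q := by
  rw [searchProg]
  refine Prog.sure_op_bind (Prog.sure_op_bind (Prog.sure_op_bind
    (Prog.sure_draw_bind (one_le_min_pow hr k) fun j hj => Prog.sure_op_bind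
    (Prog.sure_lift_bind (Prog.sure_op_bind (Prog.sure_lift_bind ?_))))))
  refine (h j hj).mono fun q hq => ?_
  convert hq using 2
  dsimp only
  ring

theorem pr_searchProg_cons (hr : 1 ≤ r) (k : ℕ) (ks : List ℕ) (s : List (ℕ × ℕ) × List ℕ)
    (Q : List (ℕ × ℕ) × List ℕ → Prop) :
    (searchProg r pt pq (k :: ks) s).pr {q | Q q.val}
      = (∑ j ∈ Finset.Icc 1 (min (2 ^ k) r),
        (searchProg r pt pq ks ((insertProg (pq j) s.1).val, (insertProg (pt j) s.2).val)).pr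
          {q | Q q.val}) / (min (2 ^ k) r : ℕ) := by
  rw [searchProg, Prog.pr_op_bind, Prog.pr_op_bind, Prog.pr_op_bind,
    Prog.pr_draw_bind (one_le_min_pow hr k)]
  congr 1
  refine Finset.sum_congr rfl fun j _ => ?_
  rw [Prog.pr_op_bind, Prog.pr_lift_bind, Prog.pr_op_bind, Prog.pr_lift_bind]
  rfl

/-- The lists only grow, by at most one element for each level. -/
theorem sure_searchProg_grow (hr : 1 ≤ r) (ks : List ℕ) (s : List (ℕ × ℕ) × List ℕ) :
    (searchProg r pt pq ks s).Sure fun q =>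
      s.1 ⊆ q.val.1 ∧ s.2 ⊆ q.val.2 ∧ q.val.1.length ≤ s.1.length + ks.length ∧
      q.val.2.length ≤ s.2.length + ks.length ∧
      q.steps ≤ ks.length * (2 * (s.1.length + ks.length) + 2 * (s.2.length + ks.length) + 8) := by
  induction ks generalizing s with
  | nil => exact Prog.sure_pure ⟨fun _ h => h, fun _ h => h, le_rfl, le_rfl, Nat.zero_le _⟩
  | cons k ks ih =>
    refine sure_searchProg_cons hr fun j hj => (ih _).mono fun q hq => ?_
    obtain ⟨h1, h2, h3, h4, h5⟩ := hq
    have e1 := insertProg_length_le (pq j) s.1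
    have e2 := insertProg_length_le (pt j) s.2
    have e3 := insertProg_steps_le (pq j) s.1
    have e4 := insertProg_steps_le (pt j) s.2
    refine ⟨fun p hp => h1 (mem_insertProg.2 (Or.inr hp)),
      fun p hp => h2 (mem_insertProg.2 (Or.inr hp)), ?_, ?_, ?_⟩
    · simp only [List.length_cons] at h3 ⊢; omega
    · simp only [List.length_cons] at h4 ⊢; omega
    · simp only [List.length_cons]
      dsimp only at h5
      have hc : 2 * ((insertProg (pq j) s.1).val.length + ks.length)
          + 2 * ((insertProg (pt j) s.2).val.length + ks.length) + 8
          ≤ 2 * (s.1.length + (ks.length + 1)) + 2 * (s.2.length + (ks.length + 1)) + 8 := by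
        omega
      have h6 := h5.trans (Nat.mul_le_mul_left ks.length hc)
      rw [Nat.add_mul, one_mul]
      omega

/-- What the search keeps true: the pairs consist of stored indices, and the indices are in
`{1, …, n}`. -/
def ValidIndices (n : ℕ) (s : List (ℕ × ℕ) × List ℕ) : Prop :=
  (∀ p ∈ s.1, p.1 ∈ s.2 ∧ p.2 ∈ s.2) ∧ ∀ a ∈ s.2, a ∈ Finset.Icc 1 n

theorem sure_searchProg_valid (hr : 1 ≤ r) {n i : ℕ}
    (hpt : ∀ j ∈ Finset.Icc 1 r, pt j ∈ Finset.Icc 1 n)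
    (hpq : ∀ j, pq j = (i, pt j) ∨ pq j = (pt j, i)) (ks : List ℕ)
    (s : List (ℕ × ℕ) × List ℕ) (hs : ValidIndices n s) (hi : i ∈ s.2) :
    (searchProg r pt pq ks s).Sure fun q => ValidIndices n q.val := by
  induction ks generalizing s with
  | nil => exact Prog.sure_pure hs
  | cons k ks ih =>
    refine sure_searchProg_cons hr fun j hj => ih _ ⟨?_, ?_⟩ (mem_insertProg.2 (Or.inr hi))
    · intro p hp
      simp only [mem_insertProg] at hp ⊢
      rcases hp with rfl | hp
      · rcases hpq j with h | h <;> rw [h] <;> simp [hi]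
      · exact ⟨Or.inr (hs.1 p hp).1, Or.inr (hs.1 p hp).2⟩
    · intro a ha
      simp only [mem_insertProg] at ha
      rcases ha with rfl | ha
      · refine hpt j ?_
        rw [Finset.mem_Icc] at hj ⊢
        exact ⟨hj.1, hj.2.trans (min_le_right _ _)⟩
      · exact hs.2 a ha

/-- If, at one of the levels, a fraction of at least `1/8` of the possible draws gives a pair
with the property `good`, such a pair is found with probability at least `1/8`. -/
theorem le_pr_searchProg_good (hr : 1 ≤ r) (good : ℕ × ℕ → Prop) [DecidablePred good] {k : ℕ}
    (hgood : min (2 ^ k) r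
      ≤ 8 * ((Finset.Icc 1 (min (2 ^ k) r)).filter fun j => good (pq j)).card)
    (ks : List ℕ) (hk : k ∈ ks) (s : List (ℕ × ℕ) × List ℕ) :
    8⁻¹ ≤ (searchProg r pt pq ks s).pr {q | ∃ p ∈ q.val.1, good p} := by
  induction ks generalizing s with
  | nil => simp at hk
  | cons k' ks ih =>
    rw [pr_searchProg_cons hr k' ks s fun v => ∃ p ∈ v.1, good p]
    have hw' := one_le_min_pow hr k'
    have hw0 : ((min (2 ^ k') r : ℕ) : ENNReal) ≠ 0 := by
      exact_mod_cast (by omega : min (2 ^ k') r ≠ 0)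
    rw [ENNReal.le_div_iff_mul_le (Or.inl hw0) (Or.inl (ENNReal.natCast_ne_top _))]
    rcases List.mem_cons.1 hk with rfl | hk
    · calc 8⁻¹ * ((min (2 ^ k) r : ℕ) : ENNReal)
          ≤ 8⁻¹ * (8 * (((Finset.Icc 1 (min (2 ^ k) r)).filter fun j => good (pq j)).card
              : ENNReal)) := by
            gcongr
            exact_mod_cast hgood
        _ = ∑ j ∈ (Finset.Icc 1 (min (2 ^ k) r)).filter fun j => good (pq j), (1 : ENNReal) := by
            rw [← mul_assoc, ENNReal.inv_mul_cancel (by norm_num) (by norm_num), one_mul]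
            simp
        _ ≤ ∑ j ∈ (Finset.Icc 1 (min (2 ^ k) r)).filter fun j => good (pq j),
            (searchProg r pt pq ks ((insertProg (pq j) s.1).val, (insertProg (pt j) s.2).val)).pr
              {q | ∃ p ∈ q.val.1, good p} := by
            refine Finset.sum_le_sum fun j hj => le_of_eq (Prog.pr_eq_one ?_).symm
            refine (sure_searchProg_grow hr ks _).mono fun q hq => ?_
            exact ⟨pq j, hq.1 (mem_insertProg.2 (Or.inl rfl)), (Finset.mem_filter.1 hj).2⟩
        _ ≤ _ := Finset.sum_le_sum_of_subset (Finset.filter_subset _ _)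
    · calc 8⁻¹ * ((min (2 ^ k') r : ℕ) : ENNReal)
          = ∑ j ∈ Finset.Icc 1 (min (2 ^ k') r), (8⁻¹ : ENNReal) := by
            simp [mul_comm]
        _ ≤ _ := Finset.sum_le_sum fun j _ => ih hk _

/-- The search rarely ends with fewer than `D` indices: at each of the levels where at least `4 D`
different draws are possible, a new index is found with probability at least `3/4`, as long as there
are fewer than `D`. So the factor `4 ^ (number of missing indices)` is at least halved on average at
such a level. -/
theorem pr_searchProg_card_lt_le (hr : 1 ≤ r) (hinj : Set.InjOn pt (Set.Icc 1 r)) (D : ℕ)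
    (ks : List ℕ) (s : List (ℕ × ℕ) × List ℕ) :
    (searchProg r pt pq ks s).pr {q | q.val.2.toFinset.card < D}
      ≤ 4 ^ (D - s.2.toFinset.card) * 2⁻¹ ^ (ks.countP fun k => 4 * D ≤ min (2 ^ k) r) := by
  induction ks generalizing s with
  | nil =>
    refine (Prog.pr_le_one _ _).trans ?_
    simp only [List.countP_nil, pow_zero, mul_one]
    exact one_le_pow₀ (by norm_num)
  | cons k ks ih =>
    by_cases hsD : D ≤ s.2.toFinset.card
    · rw [Prog.pr_eq_zero]
      · exact zero_le
      · refine (sure_searchProg_grow hr _ s).mono fun q hq hlt => ?_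
        have hsub : s.2.toFinset ⊆ q.val.2.toFinset := fun a ha => by
          rw [List.mem_toFinset] at ha ⊢
          exact hq.2.1 ha
        have h1 := Finset.card_le_card hsub
        have h2 : q.val.2.toFinset.card < D := hlt
        omega
    rw [pr_searchProg_cons hr k ks s fun v => v.2.toFinset.card < D]
    have hw' := one_le_min_pow hr k
    set w := min (2 ^ k) r with hw
    have hw0 : (w : ENNReal) ≠ 0 := by exact_mod_cast (by omega : w ≠ 0)
    set c := ks.countP fun k => 4 * D ≤ min (2 ^ k) r with hc
    set d := D - s.2.toFinset.card with hd
    refine ENNReal.div_le_of_le_mul ?_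
    by_cases hk : 4 * D ≤ w
    · rw [List.countP_cons_of_pos (by rw [decide_eq_true_eq]; exact hk)]
      have hrep : ((Finset.Icc 1 w).filter fun j => pt j ∈ s.2.toFinset).card
          ≤ s.2.toFinset.card := by
        refine Finset.card_le_card_of_injOn pt (fun j hj => (Finset.mem_filter.1 hj).2) ?_
        intro j hj j' hj' h
        have h1 := Finset.mem_Icc.1 (Finset.mem_filter.1 hj).1
        have h2 := Finset.mem_Icc.1 (Finset.mem_filter.1 hj').1
        exact hinj ⟨h1.1, h1.2.trans (min_le_right _ _)⟩ ⟨h2.1, h2.2.trans (min_le_right _ _)⟩ h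
      have hterm : ∀ j ∈ Finset.Icc 1 w,
          (searchProg r pt pq ks ((insertProg (pq j) s.1).val, (insertProg (pt j) s.2).val)).pr
            {q | q.val.2.toFinset.card < D}
          ≤ (if pt j ∈ s.2.toFinset then 4 ^ d * 2⁻¹ ^ c else 0) + 4⁻¹ * (4 ^ d * 2⁻¹ ^ c) := by
        intro j _
        refine (ih _).trans ?_
        rw [insertProg_toFinset]
        split_ifs with hmem
        · rw [Finset.insert_eq_of_mem hmem]
          exact le_add_right le_rfl
        · rw [Finset.card_insert_of_notMem hmem, zero_add]
          have : d = (D - (s.2.toFinset.card + 1)) + 1 := by omega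
          rw [this, pow_succ, ← mul_assoc, mul_comm (4⁻¹ : ENNReal), mul_assoc (4 ^ _) 4 4⁻¹,
            ENNReal.mul_inv_cancel (by norm_num) (by norm_num), mul_one]
      refine (Finset.sum_le_sum hterm).trans ?_
      rw [Finset.sum_add_distrib, ← Finset.sum_filter, Finset.sum_const, Finset.sum_const,
        Nat.card_Icc, Nat.add_sub_cancel, nsmul_eq_mul, nsmul_eq_mul]
      have h4 : (((Finset.Icc 1 w).filter fun j => pt j ∈ s.2.toFinset).card : ENNReal)
          ≤ w * 4⁻¹ := by
        rw [← div_eq_mul_inv, ENNReal.le_div_iff_mul_le (Or.inl (by norm_num))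
          (Or.inl (by norm_num))]
        exact_mod_cast (by omega)
      calc _ ≤ (w * 4⁻¹ : ENNReal) * (4 ^ d * 2⁻¹ ^ c) + w * (4⁻¹ * (4 ^ d * 2⁻¹ ^ c)) := by
            gcongr
        _ = w * ((4⁻¹ + 4⁻¹) * (4 ^ d * 2⁻¹ ^ c)) := by ring
        _ = w * (2⁻¹ * (4 ^ d * 2⁻¹ ^ c)) := by
            congr 2
            rw [← two_mul, show (4 : ENNReal) = 2 * 2 by norm_num,
              ENNReal.mul_inv (by norm_num) (by norm_num), ← mul_assoc,
              ENNReal.mul_inv_cancel (by norm_num) (by norm_num), one_mul]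
        _ = _ := by rw [pow_succ]; ring
    · rw [List.countP_cons_of_neg (by rw [decide_eq_true_eq]; exact hk)]
      have hterm : ∀ j ∈ Finset.Icc 1 w,
          (searchProg r pt pq ks ((insertProg (pq j) s.1).val, (insertProg (pt j) s.2).val)).pr
            {q | q.val.2.toFinset.card < D} ≤ 4 ^ d * 2⁻¹ ^ c := by
        intro j _
        refine (ih _).trans ?_
        gcongr
        · norm_num
        · rw [hd]
          refine Nat.sub_le_sub_left (Finset.card_le_card ?_) _
          rw [insertProg_toFinset]
          exact Finset.subset_insert _ _
      refine (Finset.sum_le_sum hterm).trans ?_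
      rw [Finset.sum_const, Nat.card_Icc, Nat.add_sub_cancel, nsmul_eq_mul, mul_comm]

end Search

/-- A bound for the number of levels in a one-sided search. -/
noncomputable def levelBound (n : ℕ) : ℕ := ⌈20 * Real.log n⌉₊ * (Nat.clog 2 n + 1)

theorem levels_length (n r : ℕ) :
    (levels n r).length = ⌈20 * Real.log n⌉₊ * (Nat.clog 2 r + 1) := by
  simp [levels, List.length_flatten]

theorem levels_length_le {n r : ℕ} (h : r ≤ n) : (levels n r).length ≤ levelBound n := by
  rw [levels_length, levelBound]
  gcongr

theorem mem_levels {n r k : ℕ} (hn : 2 ≤ n) (hk : k ≤ Nat.clog 2 r) : k ∈ levels n r := by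
  have h0 : ⌈20 * Real.log n⌉₊ ≠ 0 := by
    have : 0 < Real.log n := Real.log_pos (by exact_mod_cast hn)
    exact (Nat.ceil_pos.2 (by positivity)).ne'
  rw [levels, List.mem_flatten]
  exact ⟨_, List.mem_replicate.2 ⟨h0, rfl⟩, List.mem_range.2 (by omega)⟩

theorem le_countP_range {p : ℕ → Bool} {a : ℕ} (hp : ∀ k, a ≤ k → p k = true) (m : ℕ) :
    m - a ≤ (List.range m).countP p := by
  induction m with
  | zero => simp
  | succ m ih =>
    rw [List.range_succ, List.countP_append]
    by_cases h : a ≤ m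
    · have : List.countP p [m] = 1 := by simp [hp m h]
      omega
    · omega

theorem le_countP_levels {n r D : ℕ} (hD : 4 * D ≤ r) :
    ⌈20 * Real.log n⌉₊ * (Nat.clog 2 r + 1 - Nat.clog 2 (4 * D))
      ≤ (levels n r).countP fun k => 4 * D ≤ min (2 ^ k) r := by
  rw [levels, List.countP_flatten, List.map_replicate, List.sum_replicate, smul_eq_mul]
  refine Nat.mul_le_mul_left _ (le_countP_range (fun k hk => ?_) _)
  rw [decide_eq_true_eq, le_min_iff]
  exact ⟨(Nat.clog_le_iff_le_pow (by norm_num)).1 hk, hD⟩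

/-- The search to the right of `i`. -/
noncomputable def searchRight (n i : ℕ) (s : List (ℕ × ℕ) × List ℕ) :
    Prog (List (ℕ × ℕ) × List ℕ) :=
  if i + 1 ≤ n then searchProg (n - i) (fun J => i + J) (fun J => (i, i + J)) (levels n (n - i)) s
  else pure s

/-- The search to the left of `i`. -/
noncomputable def searchLeft (n i : ℕ) (s : List (ℕ × ℕ) × List ℕ) :
    Prog (List (ℕ × ℕ) × List ℕ) :=
  if 2 ≤ i then searchProg (i - 1) (fun J => i - J) (fun J => (i - J, i)) (levels n (i - 1)) s
  else pure s

/-- The result of an elementary step may be substituted in what follows. -/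
theorem Prog.op_bind_eq {α β : Type} (a : α) (f : α → Prog β) :
    ((liftM (op a) : Prog α) >>= f) = ((liftM (op a) : Prog α) >>= fun _ => f a) :=
  (PMF.pure_bind (op a) _).trans (PMF.pure_bind (op a) fun p =>
    PMF.map (fun q => (⟨q.val, p.steps + q.steps⟩ : Timed β)) (f a)).symm

theorem generator_eq (n i : ℕ) : generator n i =
    ((liftM (op (([], [i]) : List (ℕ × ℕ) × List ℕ)) : Prog _) >>= fun s₀ =>
      (liftM (op (decide (i + 1 ≤ n))) : Prog _) >>= fun _ => searchRight n i s₀ >>= fun s₁ =>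
      (liftM (op (decide (2 ≤ i))) : Prog _) >>= fun _ => searchLeft n i s₁) := by
  rw [generator]
  refine congrArg (Bind.bind _) (funext fun s₀ => ?_)
  rw [Prog.op_bind_eq]
  refine congrArg (Bind.bind _) (funext fun _ => ?_)
  simp only [decide_eq_true_eq]
  refine congrArg (Bind.bind _) (funext fun s₁ => ?_)
  rw [Prog.op_bind_eq]
  refine congrArg (Bind.bind _) (funext fun _ => ?_)
  simp only [decide_eq_true_eq]
  rfl

theorem pr_generator (n i : ℕ) (Q : List (ℕ × ℕ) × List ℕ → Prop) :
    (generator n i).pr {q | Q q.val}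
      = (searchRight n i ([], [i]) >>= searchLeft n i).pr {q | Q q.val} := by
  rw [generator_eq, Prog.pr_op_bind, Prog.pr_op_bind, Prog.pr_bind, Prog.pr_bind]
  refine tsum_congr fun p => ?_
  rw [Prog.pr_op_bind]
  rfl

theorem sure_generator {n i : ℕ} {Q : Timed (List (ℕ × ℕ) × List ℕ) → Prop}
    (h : (searchRight n i ([], [i]) >>= searchLeft n i).Sure fun q => Q ⟨q.val, 3 + q.steps⟩) :
    (generator n i).Sure Q := by
  rw [generator_eq]
  refine Prog.sure_op_bind (Prog.sure_op_bind ?_)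
  refine Prog.sure_bind (fun p => p ∈ (searchRight n i ([], [i])).toPMF.support)
    (fun r hr => hr) fun p hp => Prog.sure_op_bind fun q hq => ?_
  have := h ⟨q.val, p.steps + q.steps⟩ (by
    rw [Prog.toPMF_bind, PMF.mem_support_bind_iff]
    refine ⟨p, hp, ?_⟩
    rw [PMF.mem_support_map_iff]
    exact ⟨q, hq, rfl⟩)
  have e : 1 + (1 + (p.steps + (1 + q.steps))) = 3 + (p.steps + q.steps) := by ring
  dsimp only at this ⊢
  rwa [e]

theorem sure_searchRight_grow (n i : ℕ) (s : List (ℕ × ℕ) × List ℕ) :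
    (searchRight n i s).Sure fun q =>
      s.1 ⊆ q.val.1 ∧ s.2 ⊆ q.val.2 ∧ q.val.1.length ≤ s.1.length + levelBound n ∧
      q.val.2.length ≤ s.2.length + levelBound n ∧
      q.steps ≤ levelBound n * (2 * (s.1.length + levelBound n)
        + 2 * (s.2.length + levelBound n) + 8) := by
  unfold searchRight
  split_ifs with h
  · have hl := levels_length_le (n := n) (r := n - i) (Nat.sub_le _ _)
    refine (sure_searchProg_grow (by omega) _ s).mono fun q hq => ?_
    refine ⟨hq.1, hq.2.1, by omega, by omega, hq.2.2.2.2.trans ?_⟩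
    gcongr
  · exact Prog.sure_pure ⟨fun _ h => h, fun _ h => h, Nat.le_add_right _ _, Nat.le_add_right _ _,
      Nat.zero_le _⟩

theorem sure_searchLeft_grow {n i : ℕ} (hi : i ≤ n) (s : List (ℕ × ℕ) × List ℕ) :
    (searchLeft n i s).Sure fun q =>
      s.1 ⊆ q.val.1 ∧ s.2 ⊆ q.val.2 ∧ q.val.1.length ≤ s.1.length + levelBound n ∧
      q.val.2.length ≤ s.2.length + levelBound n ∧
      q.steps ≤ levelBound n * (2 * (s.1.length + levelBound n)
        + 2 * (s.2.length + levelBound n) + 8) := by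
  unfold searchLeft
  split_ifs with h
  · have hl := levels_length_le (n := n) (r := i - 1) (by omega)
    refine (sure_searchProg_grow (by omega) _ s).mono fun q hq => ?_
    refine ⟨hq.1, hq.2.1, by omega, by omega, hq.2.2.2.2.trans ?_⟩
    gcongr
  · exact Prog.sure_pure ⟨fun _ h => h, fun _ h => h, Nat.le_add_right _ _, Nat.le_add_right _ _,
      Nat.zero_le _⟩

theorem sure_searchRight_valid {n i : ℕ} {s : List (ℕ × ℕ) × List ℕ} (hs : ValidIndices n s)
    (hi : i ∈ s.2) : (searchRight n i s).Sure fun q => ValidIndices n q.val := by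
  have h1 := Finset.mem_Icc.1 (hs.2 i hi)
  unfold searchRight
  split_ifs with h
  · refine sure_searchProg_valid (by omega) (fun j hj => ?_) (fun j => Or.inl rfl) _ s hs hi
    rw [Finset.mem_Icc] at hj ⊢
    omega
  · exact Prog.sure_pure hs

theorem sure_searchLeft_valid {n i : ℕ} {s : List (ℕ × ℕ) × List ℕ} (hs : ValidIndices n s)
    (hi : i ∈ s.2) : (searchLeft n i s).Sure fun q => ValidIndices n q.val := by
  have h1 := Finset.mem_Icc.1 (hs.2 i hi)
  unfold searchLeft
  split_ifs with h
  · refine sure_searchProg_valid (by omega) (fun j hj => ?_) (fun j => Or.inr rfl) _ s hs hi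
    rw [Finset.mem_Icc] at hj ⊢
    omega
  · exact Prog.sure_pure hs

/-- The generator produces a polylogarithmic number of valid indices and pairs. -/
theorem sure_generator_bounds {n i : ℕ} (hi : i ∈ Finset.Icc 1 n) :
    (generator n i).Sure fun q => ValidIndices n q.val ∧
      q.val.1.length ≤ 2 * levelBound n ∧ q.val.2.length ≤ 2 * levelBound n + 1 ∧
      q.steps ≤ 12 * levelBound n ^ 2 + 20 * levelBound n + 3 := by
  have hi' := Finset.mem_Icc.1 hi
  have hv : ValidIndices n (([], [i]) : List (ℕ × ℕ) × List ℕ) :=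
    ⟨fun p hp => by simp at hp, fun a ha => by rw [List.mem_singleton.1 ha]; exact hi⟩
  refine sure_generator ?_
  refine Prog.sure_bind (fun p => ValidIndices n p.val ∧ i ∈ p.val.2 ∧
      p.val.1.length ≤ levelBound n ∧ p.val.2.length ≤ levelBound n + 1 ∧
      p.steps ≤ levelBound n * (4 * levelBound n + 10)) (fun p hp => ?_) ?_
  · have h1 := sure_searchRight_grow n i ([], [i]) p hp
    have h2 := sure_searchRight_valid hv (by simp) p hp
    simp only [List.length_nil, List.length_singleton, zero_add] at h1
    refine ⟨h2, h1.2.1 (by simp), h1.2.2.1, by omega, h1.2.2.2.2.trans (Nat.mul_le_mul_left _ ?_)⟩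
    omega
  · rintro p ⟨h1, h2, h3, h4, h5⟩ q hq
    have h6 := sure_searchLeft_grow hi'.2 p.val q hq
    have h7 := sure_searchLeft_valid h1 h2 q hq
    refine ⟨h7, by dsimp only; omega, by dsimp only; omega, ?_⟩
    dsimp only
    have h8 : q.steps ≤ levelBound n * (8 * levelBound n + 10) :=
      h6.2.2.2.2.trans (Nat.mul_le_mul_left _ (by omega))
    nlinarith

/-- The index `i` has many partners, at some scale, with which it forms a pair with the property
`good`: on one side of `i`, a fraction of at least `1/8` of the indices up to some distance. -/
def ManyPartners (n i : ℕ) (good : ℕ × ℕ → Prop) [DecidablePred good] : Prop :=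
  (i + 1 ≤ n ∧ ∃ k ≤ Nat.clog 2 (n - i), min (2 ^ k) (n - i)
      ≤ 8 * ((Finset.Icc 1 (min (2 ^ k) (n - i))).filter fun J => good (i, i + J)).card) ∨
  (2 ≤ i ∧ ∃ k ≤ Nat.clog 2 (i - 1), min (2 ^ k) (i - 1)
      ≤ 8 * ((Finset.Icc 1 (min (2 ^ k) (i - 1))).filter fun J => good (i - J, i)).card)

theorem le_pr_generator_good {n i : ℕ} (hn : 2 ≤ n) (hi : i ≤ n) (good : ℕ × ℕ → Prop)
    [DecidablePred good] (h : ManyPartners n i good) :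
    8⁻¹ ≤ (generator n i).pr {q | ∃ p ∈ q.val.1, good p} := by
  rw [pr_generator n i fun v => ∃ p ∈ v.1, good p]
  rcases h with ⟨hin, k, hk, hgood⟩ | ⟨hi2, k, hk, hgood⟩
  · have h1 : 8⁻¹ ≤ (searchRight n i ([], [i])).pr {q | ∃ p ∈ q.val.1, good p} := by
      rw [searchRight, if_pos hin]
      exact le_pr_searchProg_good (by omega) good hgood _ (mem_levels hn hk) _
    refine h1.trans ?_
    rw [← mul_one (Prog.pr _ _)]
    refine Prog.le_pr_bind _ fun p _ hpE => ?_
    rw [Prog.pr_eq_one]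
    refine (sure_searchLeft_grow hi p.val).mono fun q hq => ?_
    obtain ⟨x, hx, hx'⟩ := hpE
    exact ⟨x, hq.1 hx, hx'⟩
  · have h1 : (searchRight n i ([], [i])).pr Set.univ * 8⁻¹
        ≤ (searchRight n i ([], [i]) >>= searchLeft n i).pr {q | ∃ p ∈ q.val.1, good p} := by
      refine Prog.le_pr_bind _ fun p _ _ => ?_
      rw [searchLeft, if_pos hi2]
      exact le_pr_searchProg_good (by omega) good hgood _ (mem_levels hn hk) _
    rwa [Prog.pr_eq_one (fun r _ => Set.mem_univ r), one_mul] at h1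

/-- The generator produces fewer than `D` indices only with small probability; the longer one of
the two sides is used. -/
theorem pr_generator_card_lt_le {n i D : ℕ} (hi : i ∈ Finset.Icc 1 n)
    (hD : 8 * D + 3 ≤ n) :
    ∃ r, n ≤ 2 * r + 1 ∧ (generator n i).pr {q | q.val.2.toFinset.card < D}
      ≤ 4 ^ D * 2⁻¹ ^ (⌈20 * Real.log n⌉₊ * (Nat.clog 2 r + 1 - Nat.clog 2 (4 * D))) := by
  have hi' := Finset.mem_Icc.1 hi
  have hpow : ∀ a b c : ℕ, a ≤ D → b ≤ c →
      (4 : ENNReal) ^ a * 2⁻¹ ^ c ≤ 4 ^ D * 2⁻¹ ^ b := by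
    intro a b c ha hb
    exact mul_le_mul' (pow_le_pow_right₀ (by norm_num) ha)
      (pow_le_pow_of_le_one zero_le (ENNReal.inv_le_one.2 (by norm_num)) hb)
  by_cases hside : n ≤ 2 * (n - i) + 1
  · refine ⟨n - i, hside, ?_⟩
    rw [pr_generator n i fun v => v.2.toFinset.card < D]
    have h1 : (searchRight n i ([], [i])).pr {q | q.val.2.toFinset.card < D}
        ≤ 4 ^ D * 2⁻¹ ^ (⌈20 * Real.log n⌉₊ * (Nat.clog 2 (n - i) + 1 - Nat.clog 2 (4 * D))) := by
      rw [searchRight, if_pos (by omega)]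
      refine (pr_searchProg_card_lt_le (by omega) (fun a _ b _ h => by simpa using h) D _ _).trans
        (hpow _ _ _ (Nat.sub_le _ _) (le_countP_levels (by omega)))
    refine le_trans ?_ h1
    refine (Prog.pr_bind_le_add {q | q.val.2.toFinset.card < D} ∅ (B := 0)
      fun p _ hpE => Or.inr ?_).trans (by simp)
    rw [Prog.pr_eq_zero]
    refine (sure_searchLeft_grow hi'.2 p.val).mono fun q hq hlt => hpE ?_
    refine lt_of_le_of_lt (Finset.card_le_card fun a ha => ?_) hlt
    rw [List.mem_toFinset] at ha ⊢
    exact hq.2.1 ha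
  · refine ⟨i - 1, by omega, ?_⟩
    rw [pr_generator n i fun v => v.2.toFinset.card < D]
    refine Prog.pr_bind_le fun p _ => ?_
    rw [searchLeft, if_pos (by omega)]
    refine (pr_searchProg_card_lt_le (by omega) (fun a ha b hb h => ?_) D _ _).trans
      (hpow _ _ _ (Nat.sub_le _ _) (le_countP_levels (by omega)))
    have h1 := ha.2
    have h2 := hb.2
    have h' : i - a = i - b := h
    omega

/-! ### Rounds starting from a uniform index -/

theorem sure_randomIndices_bounds {n : ℕ} (hn : 1 ≤ n) :
    (randomIndices n).Sure fun q => ValidIndices n q.val ∧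
      q.val.1.length ≤ 2 * levelBound n ∧ q.val.2.length ≤ 2 * levelBound n + 1 ∧
      q.steps ≤ 12 * levelBound n ^ 2 + 20 * levelBound n + 4 := by
  refine Prog.sure_draw_bind hn fun i hi => (sure_generator_bounds hi).mono fun q hq => ?_
  refine ⟨hq.1, hq.2.1, hq.2.2.1, ?_⟩
  dsimp only
  omega

theorem pr_randomIndices {n : ℕ} (hn : 1 ≤ n) (Q : List (ℕ × ℕ) × List ℕ → Prop) :
    (randomIndices n).pr {q | Q q.val}
      = (∑ i ∈ Finset.Icc 1 n, (generator n i).pr {q | Q q.val}) / n :=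
  Prog.pr_draw_bind hn _ _

/-! ### Indices with many partners and the exceedance fraction -/

/-- The pair of indices witnesses a drop of `f` by at least `θ`. -/
def Drop (f : ℝ → ℝ) (n : ℕ) (θ : ℝ) (p : ℕ × ℕ) : Prop := θ ≤ f (p.1 / n) - f (p.2 / n)

noncomputable instance (f : ℝ → ℝ) (n : ℕ) (θ : ℝ) : DecidablePred (Drop f n θ) :=
  fun _ => Classical.dec _

open Classical in
/-- The indices with many partners for a drop by `θ`. -/
noncomputable def dropIndices (f : ℝ → ℝ) (n : ℕ) (θ : ℝ) : Finset ℕ :=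
  (Finset.Icc 1 n).filter fun i => ManyPartners n i (Drop f n θ)

theorem mem_dropIndices {f : ℝ → ℝ} {n : ℕ} {θ : ℝ} {i : ℕ} :
    i ∈ dropIndices f n θ ↔ i ∈ Finset.Icc 1 n ∧ ManyPartners n i (Drop f n θ) := by
  simp [dropIndices]

theorem two_pow_clog_lt {d : ℕ} (hd : 1 ≤ d) : 2 ^ Nat.clog 2 d < 2 * d := by
  rcases Nat.eq_or_lt_of_le hd with rfl | h
  · simp
  · have h1 := Nat.pow_pred_clog_lt_self (b := 2) (by norm_num) h
    have h2 : 0 < Nat.clog 2 d := Nat.clog_pos (by norm_num) h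
    obtain ⟨c, hc⟩ := Nat.exists_eq_add_of_le' h2
    rw [hc] at h1 ⊢
    simp only [Nat.pred_eq_sub_one, Nat.add_sub_cancel] at h1
    rw [pow_succ]
    omega

/-- Off the indices with many partners, `f` is monotone up to `2 θ`: otherwise each index between
`i` and `j` would form a dropping pair with `i` or with `j`. -/
theorem sub_lt_of_not_manyPartners {f : ℝ → ℝ} {n : ℕ} {θ : ℝ} (hθ : 0 < θ) {i j : ℕ} (hi : 1 ≤ i)
    (hij : i < j) (hj : j ≤ n) (hGi : ¬ ManyPartners n i (Drop f n θ))
    (hGj : ¬ ManyPartners n j (Drop f n θ)) : f (i / n) - f (j / n) < 2 * θ := by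
  by_contra hcon
  rw [not_lt] at hcon
  have hd : 1 ≤ j - i := by omega
  have hp := two_pow_clog_lt hd
  have hp' : j - i ≤ 2 ^ Nat.clog 2 (j - i) := Nat.le_pow_clog (by norm_num) _
  set w := min (2 ^ Nat.clog 2 (j - i)) (n - i) with hw
  set w' := min (2 ^ Nat.clog 2 (j - i)) (j - 1) with hw'
  have hR : 8 * ((Finset.Icc 1 w).filter fun J => Drop f n θ (i, i + J)).card < w := by
    by_contra h
    exact hGi (Or.inl ⟨by omega, _, Nat.clog_mono_right 2 (by omega), not_lt.1 h⟩)
  have hL : 8 * ((Finset.Icc 1 w').filter fun J => Drop f n θ (j - J, j)).card < w' := by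
    by_contra h
    exact hGj (Or.inr ⟨by omega, _, Nat.clog_mono_right 2 (by omega), not_lt.1 h⟩)
  have hcover : Finset.Ioc i j ⊆
      ((Finset.Icc 1 w).filter fun J => Drop f n θ (i, i + J)).image (fun J => i + J) ∪
      ((Finset.Icc 1 w').filter fun J => Drop f n θ (j - J, j)).image (fun J => j - J) := by
    intro z hz
    rw [Finset.mem_Ioc] at hz
    rw [Finset.mem_union]
    by_cases h1 : θ ≤ f (i / n) - f (z / n)
    · left
      refine Finset.mem_image.2 ⟨z - i, Finset.mem_filter.2 ⟨?_, ?_⟩, by omega⟩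
      · rw [Finset.mem_Icc, hw, le_min_iff]; omega
      · have e : i + (z - i) = z := by omega
        rw [e]
        exact h1
    · right
      have hzj : z ≠ j := by
        rintro rfl
        exact h1 (by linarith)
      refine Finset.mem_image.2 ⟨j - z, Finset.mem_filter.2 ⟨?_, ?_⟩, by omega⟩
      · rw [Finset.mem_Icc, hw', le_min_iff]; omega
      · have e : j - (j - z) = z := by omega
        rw [e]
        change θ ≤ f (z / n) - f (j / n)
        linarith
  have hcard := (Finset.card_le_card hcover).trans ((Finset.card_union_le _ _).trans
    (add_le_add Finset.card_image_le Finset.card_image_le))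
  rw [Nat.card_Ioc] at hcard
  have hwle : w ≤ 2 ^ Nat.clog 2 (j - i) := min_le_left _ _
  have hwle' : w' ≤ 2 ^ Nat.clog 2 (j - i) := min_le_left _ _
  omega

theorem ceil_mul_mem {n : ℕ} (hn : 1 ≤ n) {x : ℝ} (h0 : 0 < x) (h1 : x ≤ 1) :
    ⌈n * x⌉₊ ∈ Finset.Icc 1 n ∧ x ≤ ⌈n * x⌉₊ / n ∧ (⌈n * x⌉₊ : ℝ) / n < x + 1 / n := by
  have hn0 : (0 : ℝ) < n := by exact_mod_cast hn
  refine ⟨?_, ?_, ?_⟩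
  · rw [Finset.mem_Icc]
    refine ⟨Nat.ceil_pos.2 (by positivity), Nat.ceil_le.2 (by nlinarith)⟩
  · rw [le_div_iff₀ hn0, mul_comm]
    exact Nat.le_ceil _
  · have h := Nat.ceil_lt_add_one (a := n * x) (by positivity)
    rw [div_lt_iff₀ hn0, add_mul, one_div, inv_mul_cancel₀ hn0.ne', mul_comm x]
    exact h

/-- A set of points in cells with index in `G` has measure at most `|G| / n`. -/
theorem volume_le_of_ceil_mem {n : ℕ} (hn : 1 ≤ n) (G : Finset ℕ) {S : Set ℝ}
    (hS : ∀ x ∈ S, x ∈ Set.Icc (0 : ℝ) 1) (hG : ∀ x ∈ S, 0 < x → ⌈n * x⌉₊ ∈ G) :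
    volume S ≤ ENNReal.ofReal (G.card / n) := by
  have hn0 : (0 : ℝ) < n := by exact_mod_cast hn
  have hsub : S ⊆ {0} ∪ ⋃ i ∈ G, Set.Ioc (((i : ℝ) - 1) / n) (i / n) := by
    intro x hx
    rcases (hS x hx).1.eq_or_lt with h0 | h0
    · exact Or.inl h0.symm
    · right
      obtain ⟨h1, h2, h3⟩ := ceil_mul_mem hn h0 (hS x hx).2
      simp only [Set.mem_iUnion, Set.mem_Ioc]
      refine ⟨_, hG x hx h0, ?_, h2⟩
      rw [sub_div]
      linarith
  calc volume S ≤ volume ({0} : Set ℝ) + volume (⋃ i ∈ G, Set.Ioc (((i : ℝ) - 1) / n) (i / n)) :=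
        (measure_mono hsub).trans (measure_union_le _ _)
    _ ≤ 0 + ∑ i ∈ G, volume (Set.Ioc (((i : ℝ) - 1) / n) (i / n)) := by
        gcongr
        · exact Real.volume_singleton.le
        · exact measure_biUnion_finset_le _ _
    _ = ∑ i ∈ G, ENNReal.ofReal (1 / n) := by
        rw [zero_add]
        refine Finset.sum_congr rfl fun i _ => ?_
        rw [Real.volume_Ioc]
        congr 1
        ring
    _ = ENNReal.ofReal (G.card / n) := by
        rw [Finset.sum_const, nsmul_eq_mul, ← ENNReal.ofReal_natCast,
          ← ENNReal.ofReal_mul (by positivity), mul_one_div]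

/-- A monotone function that is within `θ` of `f` at the indices with few partners. -/
theorem exists_monotone_approx {f : ℝ → ℝ} {n : ℕ} {θ : ℝ} (hθ : 0 < θ) :
    ∃ g : ℕ → ℝ, Monotone g ∧ ∀ i ∈ Finset.Icc 1 n, i ∉ dropIndices f n θ →
      |f (i / n) - g i| ≤ θ := by
  classical
  set N := (Finset.Icc 1 n).filter fun i => i ∉ dropIndices f n θ with hN
  -- the index `0` is no design point; its value lies below all others and makes the maximum nonvoid
  set v : ℕ → ℝ := fun j => if j = 0 then -∑ k ∈ Finset.Icc 1 n, |f (k / n)| else f (j / n) with hv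
  have hne : ∀ i, (insert 0 (N.filter fun j => j ≤ i)).Nonempty := fun i => ⟨0, by simp⟩
  refine ⟨fun i => (insert 0 (N.filter fun j => j ≤ i)).sup' (hne i) v - θ, ?_, ?_⟩
  · intro i i' hii
    refine sub_le_sub_right (Finset.sup'_mono v ?_ (hne i)) θ
    refine Finset.insert_subset_insert _ fun j hj => ?_
    rw [Finset.mem_filter] at hj ⊢
    exact ⟨hj.1, hj.2.trans hii⟩
  · intro i hi hG
    have hi' := Finset.mem_Icc.1 hi
    have hiN : i ∈ N := Finset.mem_filter.2 ⟨hi, hG⟩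
    have hlow : f (i / n) ≤ (insert 0 (N.filter fun j => j ≤ i)).sup' (hne i) v := by
      have h := Finset.le_sup' v (s := insert 0 (N.filter fun j => j ≤ i)) (b := i)
        (by simp [hiN])
      have hvi : v i = f (i / n) := if_neg (by omega)
      rwa [hvi] at h
    have hup : (insert 0 (N.filter fun j => j ≤ i)).sup' (hne i) v ≤ f (i / n) + 2 * θ := by
      refine Finset.sup'_le _ _ fun j hj => ?_
      rcases Finset.mem_insert.1 hj with rfl | hj
      · have h1 : |f (i / n)| ≤ ∑ k ∈ Finset.Icc 1 n, |f (k / n)| :=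
          Finset.single_le_sum (f := fun k : ℕ => |f (k / n)|) (fun k _ => abs_nonneg _) hi
        have h2 := neg_abs_le (f (i / n))
        simp only [hv, if_true]
        linarith
      · obtain ⟨hjN, hji⟩ := Finset.mem_filter.1 hj
        obtain ⟨hj1, hjG⟩ := Finset.mem_filter.1 hjN
        have hj1' := Finset.mem_Icc.1 hj1
        have hvj : v j = f (j / n) := if_neg (by omega)
        rw [hvj]
        rcases hji.eq_or_lt with rfl | hlt
        · linarith
        · have h := sub_lt_of_not_manyPartners hθ hj1'.1 hlt hi'.2
            (fun h => hjG (mem_dropIndices.2 ⟨hj1, h⟩)) (fun h => hG (mem_dropIndices.2 ⟨hi, h⟩))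
          linarith
    rw [abs_le]
    constructor <;> linarith

/-- The step function through a monotone approximation at the design points shows that `f` is far
from monotone only in the cells of the indices with many partners. -/
theorem exceedance_zero_le_card {β L : ℝ} (hβ : 0 < β) (hβ1 : β ≤ 1) (hL : 0 < L) {f : ℝ → ℝ}
    (hf : f ∈ Holder β L) {n : ℕ} (hn : 1 ≤ n) {θ γ : ℝ} (hθ : 0 < θ)
    (hγ : θ + L * (1 / n : ℝ) ^ β ≤ γ) :
    exceedance 0 γ f ≤ (dropIndices f n θ).card / n := by
  have hn0 : (0 : ℝ) < n := by exact_mod_cast hn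
  obtain ⟨g, hg, hfg⟩ := exists_monotone_approx (f := f) (n := n) hθ
  have hgm : MonotoneOn (fun x : ℝ => g ⌈n * x⌉₊) (Set.Icc 0 1) := by
    intro x _ y _ hxy
    exact hg (Nat.ceil_mono (by gcongr))
  have hvol : volume {x : ℝ | x ∈ Set.Icc (0 : ℝ) 1 ∧ γ < |f x - g ⌈n * x⌉₊|}
      ≤ ENNReal.ofReal ((dropIndices f n θ).card / n) := by
    refine volume_le_of_ceil_mem hn _ (fun x hx => hx.1) fun x hx h0 => ?_
    by_contra hG
    obtain ⟨h1, h2, h3⟩ := ceil_mul_mem hn h0 hx.1.2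
    have hA := hfg _ h1 hG
    have hB := Holder.abs_sub_le hβ hβ1 hf hx.1 (design_mem_Icc h1)
    have hC : L * |x - (⌈n * x⌉₊ : ℝ) / n| ^ β ≤ L * (1 / n : ℝ) ^ β := by
      gcongr
      rw [abs_le]
      constructor <;> linarith [show (0 : ℝ) ≤ 1 / n by positivity]
    have hD := abs_sub_le (f x) (f ((⌈n * x⌉₊ : ℝ) / n)) (g ⌈n * x⌉₊)
    have hE : γ < |f x - g ⌈n * x⌉₊| := hx.2
    linarith
  rw [exceedance, if_pos rfl]
  refine ENNReal.toReal_le_of_le_ofReal (by positivity) (le_trans ?_ hvol)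
  exact iInf₂_le (fun x : ℝ => g ⌈n * x⌉₊) hgm

/-- A steep descent at `i / n` gives many partners, at the distances between `H / 4` and `H`. -/
theorem manyPartners_of_deriv {β L : ℝ} (hβ1 : 1 < β) (hβ2 : β ≤ 2) (hL : 0 < L) {f : ℝ → ℝ}
    (hf : f ∈ Holder β L) {n i : ℕ} (hn : 4 ≤ n) (hi : i ∈ Finset.Icc 1 n) {θ d H : ℝ}
    (hH : 1 / n ≤ H) (hH1 : H ≤ 1 / 4) (hd : derivWithin f (Set.Icc 0 1) (i / n) ≤ -d)
    (hdL : L * H ^ (β - 1) ≤ d / 3) (hθ : 6 * θ ≤ d * H) : ManyPartners n i (Drop f n θ) := by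
  have hi' := Finset.mem_Icc.1 hi
  have hn0 : (0 : ℝ) < n := by exact_mod_cast (by omega : 0 < n)
  have hHpos : 0 < H := lt_of_lt_of_le (by positivity) hH
  have hnH : 1 ≤ n * H := by rwa [div_le_iff₀' hn0] at hH
  have hd0 : 0 < d := by
    have : 0 < L * H ^ (β - 1) := by positivity
    linarith
  set q := ⌊n * H⌋₊ with hq
  have hq1 : 1 ≤ q := Nat.le_floor (by simpa using hnH)
  set k := Nat.log 2 q with hk
  have hk1 : 2 ^ k ≤ q := Nat.pow_log_le_self 2 (by omega)
  have hk2 : q < 2 ^ (k + 1) := Nat.lt_pow_succ_log_self (by norm_num) q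
  have hqH : (q : ℝ) ≤ n * H := Nat.floor_le (by positivity)
  have hqH' : n * H < q + 1 := Nat.lt_floor_add_one _
  have hkH : ((2 ^ k : ℕ) : ℝ) ≤ n * H := le_trans (by exact_mod_cast hk1) hqH
  have hkH' : n * H < 2 * ((2 ^ k : ℕ) : ℝ) := by
    have : ((q + 1 : ℕ) : ℝ) ≤ ((2 ^ (k + 1) : ℕ) : ℝ) := by exact_mod_cast hk2
    push_cast at this ⊢
    rw [pow_succ] at this
    linarith
  have hkn : 4 * 2 ^ k ≤ n := by
    have : (4 : ℝ) * ((2 ^ k : ℕ) : ℝ) ≤ n := by nlinarith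
    exact_mod_cast this
  -- the drop along a distance `t ∈ [H/4, H]`
  have key : ∀ t : ℝ, H / 4 ≤ t → t ≤ H → θ ≤ d * t - L * t ^ β := by
    intro t ht1 ht2
    have htpos : 0 < t := by linarith
    have e : t ^ β = t ^ (β - 1) * t := by
      rw [← Real.rpow_add_one htpos.ne']; ring_nf
    have h1 : L * t ^ (β - 1) ≤ d / 3 := le_trans (by gcongr) hdL
    rw [e, ← mul_assoc]
    nlinarith
  have hcard : ∀ P : ℕ → Prop, ∀ _ : DecidablePred P,
      (∀ J, 2 ^ k ≤ 2 * J → J ≤ 2 ^ k → P J) →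
      2 ^ k ≤ 8 * ((Finset.Icc 1 (2 ^ k)).filter P).card := by
    intro P _ hP
    have hsub : Finset.Ioc (2 ^ k / 2) (2 ^ k) ⊆ (Finset.Icc 1 (2 ^ k)).filter P := by
      intro J hJ
      rw [Finset.mem_Ioc] at hJ
      rw [Finset.mem_filter, Finset.mem_Icc]
      exact ⟨⟨by omega, hJ.2⟩, hP J (by omega) hJ.2⟩
    have := Finset.card_le_card hsub
    rw [Nat.card_Ioc] at this
    omega
  have hdist : ∀ J : ℕ, 2 ^ k ≤ 2 * J → J ≤ 2 ^ k → H / 4 ≤ (J : ℝ) / n ∧ (J : ℝ) / n ≤ H := by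
    intro J h1 h2
    have h1' : ((2 ^ k : ℕ) : ℝ) ≤ 2 * J := by exact_mod_cast h1
    have h2' : (J : ℝ) ≤ ((2 ^ k : ℕ) : ℝ) := by exact_mod_cast h2
    rw [le_div_iff₀ hn0, div_le_iff₀ hn0]
    constructor <;> linarith
  by_cases hside : 2 * i ≤ n
  · refine Or.inl ⟨by omega, k, ?_, ?_⟩
    · rw [← Nat.clog_pow 2 k (by norm_num)]
      exact Nat.clog_mono_right 2 (by omega)
    · rw [min_eq_left (by omega)]
      refine hcard _ _ fun J h1 h2 => ?_
      obtain ⟨g1, g2⟩ := hdist J h1 h2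
      have hy : ((i + J : ℕ) : ℝ) / n ∈ Set.Icc (0 : ℝ) 1 := design_mem_Icc (by
        rw [Finset.mem_Icc]; omega)
      have hyi : ((i + J : ℕ) : ℝ) / n - i / n = J / n := by push_cast; ring
      have hJ0 : (0 : ℝ) ≤ (J : ℝ) / n := by positivity
      have hk' := key (J / n) g1 g2
      have hT := Holder.abs_taylor_le hβ1 hβ2 hL hf (design_mem_Icc hi) hy
      rw [hyi, abs_of_nonneg hJ0, abs_le] at hT
      change θ ≤ f (i / n) - f ((i + J : ℕ) / n)
      have := mul_le_mul_of_nonneg_right hd hJ0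
      linarith [hT.2]
  · refine Or.inr ⟨by omega, k, ?_, ?_⟩
    · rw [← Nat.clog_pow 2 k (by norm_num)]
      exact Nat.clog_mono_right 2 (by omega)
    · rw [min_eq_left (by omega)]
      refine hcard _ _ fun J h1 h2 => ?_
      obtain ⟨g1, g2⟩ := hdist J h1 h2
      have hy : ((i - J : ℕ) : ℝ) / n ∈ Set.Icc (0 : ℝ) 1 := design_mem_Icc (by
        rw [Finset.mem_Icc]; omega)
      have hyi : ((i - J : ℕ) : ℝ) / n - i / n = -(J / n) := by
        rw [Nat.cast_sub (by omega)]; ring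
      have hJ0 : (0 : ℝ) ≤ (J : ℝ) / n := by positivity
      have hk' := key (J / n) g1 g2
      have hT := Holder.abs_taylor_le hβ1 hβ2 hL hf (design_mem_Icc hi) hy
      rw [hyi, abs_neg, abs_of_nonneg hJ0, abs_le] at hT
      change θ ≤ f ((i - J : ℕ) / n) - f (i / n)
      have := mul_le_mul_of_nonneg_right hd hJ0
      linarith [hT.1]

/-- A descent with slope `γ` somewhere in a cell persists, up to a factor, at the design point of
the cell. -/
theorem exceedance_one_le_card {β L : ℝ} (hβ1 : 1 < β) (hβ2 : β ≤ 2) (hL : 0 < L) {f : ℝ → ℝ}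
    (hf : f ∈ Holder β L) {n : ℕ} (hn : 4 ≤ n) {θ γ H : ℝ} (hH : 1 / n ≤ H) (hH1 : H ≤ 1 / 4)
    (hγL : 4 * L * H ^ (β - 1) ≤ γ) (hθ : 8 * θ ≤ γ * H) :
    exceedance 1 γ f ≤ (dropIndices f n θ).card / n := by
  have hn0 : (0 : ℝ) < n := by exact_mod_cast (by omega : 0 < n)
  have hHpos : 0 < H := lt_of_lt_of_le (by positivity) hH
  rw [exceedance, if_neg one_ne_zero]
  refine ENNReal.toReal_le_of_le_ofReal (by positivity)
    (volume_le_of_ceil_mem (by omega) _ (fun x hx => hx.1) fun x hx h0 => ?_)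
  obtain ⟨h1, h2, h3⟩ := ceil_mul_mem (by omega : 1 ≤ n) h0 hx.1.2
  refine mem_dropIndices.2 ⟨h1, ?_⟩
  have hB := Holder.abs_derivWithin_sub_le hβ1 hβ2 hf (design_mem_Icc h1) hx.1
  have hC : L * |(⌈n * x⌉₊ : ℝ) / n - x| ^ (β - 1) ≤ L * H ^ (β - 1) := by
    refine mul_le_mul_of_nonneg_left (Real.rpow_le_rpow (abs_nonneg _) ?_ (by linarith)) hL.le
    rw [abs_le]
    constructor <;> linarith
  have hx2 : derivWithin f (Set.Icc 0 1) x ≤ -γ := hx.2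
  have hB' := (abs_le.1 hB).2
  refine manyPartners_of_deriv hβ1 hβ2 hL hf hn h1 (d := 3 / 4 * γ) hH hH1 ?_ ?_ ?_ <;> linarith

theorem exists_small_rpow {L r c s : ℝ} (hL : 0 < L) (hr : 0 < r) (hc : 0 < c) (hs : 0 < s) :
    ∃ η : ℝ, 0 < η ∧ η ≤ c ∧ L * η ^ s ≤ r := by
  refine ⟨min c ((r / L) ^ s⁻¹), lt_min hc (by positivity), min_le_left _ _, ?_⟩
  calc L * (min c ((r / L) ^ s⁻¹)) ^ s ≤ L * ((r / L) ^ s⁻¹) ^ s := by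
        gcongr
        exact min_le_right _ _
    _ = r := by rw [Real.rpow_inv_rpow (by positivity) hs.ne']; field_simp

/-- A monotone function cannot be within `γ` of `f` both near the start and near the end of a drop
by `4 γ`. -/
theorem exceedance_zero_pos {β L : ℝ} (hβ : 0 < β) (hβ1 : β ≤ 1) (hL : 0 < L) {f : ℝ → ℝ}
    (hf : f ∈ Holder β L) {a b γ δ : ℝ} (ha : 0 ≤ a) (hab : a < b) (hb : b ≤ 1) (hγ : 0 < γ)
    (hδ : 4 * γ ≤ δ) (hdrop : δ ≤ f a - f b) : 0 < exceedance 0 γ f := by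
  obtain ⟨η, h0, h1, h2⟩ := exists_small_rpow hL (half_pos hγ) (by linarith : 0 < (b - a) / 3) hβ
  have hvol : ∀ g : ℝ → ℝ, MonotoneOn g (Set.Icc 0 1) → ENNReal.ofReal η
      ≤ volume {x : ℝ | x ∈ Set.Icc (0 : ℝ) 1 ∧ γ < |f x - g x|} := by
    intro g hg
    have hcase : Set.Icc a (a + η) ⊆ {x : ℝ | x ∈ Set.Icc (0 : ℝ) 1 ∧ γ < |f x - g x|} ∨
        Set.Icc (b - η) b ⊆ {x : ℝ | x ∈ Set.Icc (0 : ℝ) 1 ∧ γ < |f x - g x|} := by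
      by_contra hcon
      rw [not_or, Set.not_subset, Set.not_subset] at hcon
      obtain ⟨⟨x, hx, hx'⟩, y, hy, hy'⟩ := hcon
      have hx0 : x ∈ Set.Icc (0 : ℝ) 1 := ⟨ha.trans hx.1, by linarith [hx.2]⟩
      have hy0 : y ∈ Set.Icc (0 : ℝ) 1 := ⟨by linarith [hy.1], hy.2.trans hb⟩
      have hx1 : |f x - g x| ≤ γ := not_lt.1 fun h => hx' ⟨hx0, h⟩
      have hy1 : |f y - g y| ≤ γ := not_lt.1 fun h => hy' ⟨hy0, h⟩
      have hxy := hg hx0 hy0 (by linarith [hx.2, hy.1])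
      have hfa := Holder.abs_sub_le hβ hβ1 hf (⟨ha, by linarith⟩ : a ∈ Set.Icc (0 : ℝ) 1) hx0
      have hfb := Holder.abs_sub_le hβ hβ1 hf hy0 (⟨by linarith, hb⟩ : b ∈ Set.Icc (0 : ℝ) 1)
      have e1 : L * |a - x| ^ β ≤ γ / 2 := by
        refine le_trans ?_ h2
        gcongr
        rw [abs_le]; constructor <;> linarith [hx.1, hx.2]
      have e2 : L * |y - b| ^ β ≤ γ / 2 := by
        refine le_trans ?_ h2
        gcongr
        rw [abs_le]; constructor <;> linarith [hy.1, hy.2]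
      rw [abs_le] at hx1 hy1 hfa hfb
      linarith [hx1.2, hy1.1, hfa.2, hfb.2]
    rcases hcase with h | h
    · refine le_trans (le_of_eq ?_) (measure_mono h)
      rw [Real.volume_Icc]; congr 1; ring
    · refine le_trans (le_of_eq ?_) (measure_mono h)
      rw [Real.volume_Icc]; congr 1; ring
  rw [exceedance, if_pos rfl]
  refine ENNReal.toReal_pos ?_ ?_
  · refine ne_of_gt (lt_of_lt_of_le (ENNReal.ofReal_pos.2 h0) ?_)
    exact le_iInf₂ hvol
  · refine ne_of_lt (lt_of_le_of_lt (iInf₂_le (fun _ : ℝ => (0 : ℝ))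
      (monotoneOn_const : MonotoneOn (fun _ : ℝ => (0 : ℝ)) (Set.Icc 0 1))) ?_)
    refine lt_of_le_of_lt (measure_mono (fun x hx => hx.1)) (?_ : volume (Set.Icc (0 : ℝ) 1) < ⊤)
    simp

theorem exceedance_one_pos {β L : ℝ} (hβ1 : 1 < β) (hβ2 : β ≤ 2) (hL : 0 < L) {f : ℝ → ℝ}
    (hf : f ∈ Holder β L) {x γ δ : ℝ} (hx : x ∈ Set.Icc (0 : ℝ) 1) (hγ : 0 < γ)
    (hδ : 2 * γ ≤ δ) (hd : derivWithin f (Set.Icc 0 1) x ≤ -δ) : 0 < exceedance 1 γ f := by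
  obtain ⟨η, h0, h1, h2⟩ := exists_small_rpow hL hγ (by norm_num : (0 : ℝ) < 1 / 2)
    (by linarith : 0 < β - 1)
  have hin : ∀ y ∈ Set.Icc (0 : ℝ) 1, |y - x| ≤ η → derivWithin f (Set.Icc 0 1) y ≤ -γ := by
    intro y hy hyx
    have h := (abs_le.1 (Holder.abs_derivWithin_sub_le hβ1 hβ2 hf hy hx)).2
    have h' : L * |y - x| ^ (β - 1) ≤ γ := le_trans (mul_le_mul_of_nonneg_left
      (Real.rpow_le_rpow (abs_nonneg _) hyx (by linarith)) hL.le) h2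
    linarith
  have hvol : ENNReal.ofReal η
      ≤ volume {x : ℝ | x ∈ Set.Icc (0 : ℝ) 1 ∧ derivWithin f (Set.Icc 0 1) x ≤ -γ} := by
    by_cases hside : x ≤ 1 / 2
    · have hsub : Set.Icc x (x + η)
          ⊆ {x : ℝ | x ∈ Set.Icc (0 : ℝ) 1 ∧ derivWithin f (Set.Icc 0 1) x ≤ -γ} := by
        intro y hy
        have hy0 : y ∈ Set.Icc (0 : ℝ) 1 := ⟨hx.1.trans hy.1, by linarith [hy.2]⟩
        exact ⟨hy0, hin y hy0 (by rw [abs_le]; constructor <;> linarith [hy.1, hy.2])⟩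
      refine le_trans (le_of_eq ?_) (measure_mono hsub)
      rw [Real.volume_Icc]; congr 1; ring
    · have hsub : Set.Icc (x - η) x
          ⊆ {x : ℝ | x ∈ Set.Icc (0 : ℝ) 1 ∧ derivWithin f (Set.Icc 0 1) x ≤ -γ} := by
        intro y hy
        have hy0 : y ∈ Set.Icc (0 : ℝ) 1 := ⟨by linarith [hy.1], hy.2.trans hx.2⟩
        exact ⟨hy0, hin y hy0 (by rw [abs_le]; constructor <;> linarith [hy.1, hy.2])⟩
      refine le_trans (le_of_eq ?_) (measure_mono hsub)
      rw [Real.volume_Icc]; congr 1; ring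
  rw [exceedance, if_neg one_ne_zero]
  refine ENNReal.toReal_pos (ne_of_gt (lt_of_lt_of_le (ENNReal.ofReal_pos.2 h0) hvol)) ?_
  refine ne_of_lt (lt_of_le_of_lt (measure_mono (fun x hx => hx.1))
    (?_ : volume (Set.Icc (0 : ℝ) 1) < ⊤))
  simp

/-- For a function of the alternative, the exceedance fraction is positive, and it is at most the
fraction of the indices with many partners. -/
theorem exceedance_bounds {β L : ℝ} (hβ : 0 < β) (hβ2 : β ≤ 2) (hL : 0 < L) {f : ℝ → ℝ}
    {δ γ θ H : ℝ} (hf : f ∈ Alternative β L δ) {n : ℕ} (hn : 4 ≤ n) (hθ : 0 < θ) (hγ : 0 < γ)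
    (hδ : 4 * γ ≤ δ) (hH : 1 / n ≤ H) (hH1 : H ≤ 1 / 4)
    (hsmall : β ≤ 1 → θ + L * H ^ β ≤ γ)
    (hlarge : 1 < β → 4 * L * H ^ (β - 1) ≤ γ ∧ 8 * θ ≤ γ * H) :
    0 < exceedance (⌈β⌉₊ - 1) γ f ∧
      exceedance (⌈β⌉₊ - 1) γ f ≤ (dropIndices f n θ).card / n := by
  by_cases h1 : β ≤ 1
  · have hf2 := hf.2
    rw [if_pos h1] at hf2
    obtain ⟨a, b, ha, hab, hb, hdrop⟩ := hf2
    rw [ceil_eq_one hβ h1]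
    refine ⟨exceedance_zero_pos hβ h1 hL hf.1 ha hab hb hγ hδ hdrop,
      exceedance_zero_le_card hβ h1 hL hf.1 (by omega) hθ (le_trans ?_ (hsmall h1))⟩
    gcongr
  · have hf2 := hf.2
    rw [if_neg h1] at hf2
    obtain ⟨x, hx, hd⟩ := hf2
    rw [not_le] at h1
    rw [ceil_eq_two h1 hβ2]
    exact ⟨exceedance_one_pos h1 hβ2 hL hf.1 hx hγ (by linarith) hd,
      exceedance_one_le_card h1 hβ2 hL hf.1 hn hH hH1 (hlarge h1).1 (hlarge h1).2⟩

/-! ### Bandwidths -/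

/-- The bandwidth `(log n / n) ^ (1 / (2 β + 1))` that balances bias and stochastic error. -/
noncomputable def optBw (β : ℝ) (n : ℕ) : ℝ := (Real.log n / n) ^ (1 / (2 * β + 1))

theorem one_lt_log {n : ℕ} (hn : 3 ≤ n) : 1 < Real.log n := by
  have h3 : (3 : ℝ) ≤ n := by exact_mod_cast hn
  rw [Real.lt_log_iff_exp_lt (by linarith)]
  exact lt_of_lt_of_le (by linarith [Real.exp_one_lt_d9]) h3

theorem log_div_pos {n : ℕ} (hn : 3 ≤ n) : 0 < Real.log n / n := by
  have h1 := one_lt_log hn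
  have h2 : (0 : ℝ) < n := by exact_mod_cast (by omega : 0 < n)
  positivity

theorem log_div_le_one {n : ℕ} (hn : 3 ≤ n) : Real.log n / n ≤ 1 := by
  have h2 : (0 : ℝ) < n := by exact_mod_cast (by omega : 0 < n)
  rw [div_le_one h2]
  linarith [Real.log_le_sub_one_of_pos h2]

theorem optBw_pos {n : ℕ} (hn : 3 ≤ n) (β : ℝ) : 0 < optBw β n :=
  Real.rpow_pos_of_pos (log_div_pos hn) _

theorem optBw_le_one {n : ℕ} (hn : 3 ≤ n) {β : ℝ} (hβ : 0 < β) : optBw β n ≤ 1 :=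
  Real.rpow_le_one (log_div_pos hn).le (log_div_le_one hn) (by positivity)

theorem optBw_rpow {n : ℕ} (hn : 3 ≤ n) {β : ℝ} (hβ : 0 < β) :
    optBw β n ^ (2 * β + 1) = Real.log n / n := by
  rw [optBw, ← Real.rpow_mul (log_div_pos hn).le, one_div_mul_cancel (by positivity), Real.rpow_one]

theorem sepRate_eq {n : ℕ} (hn : 3 ≤ n) (β : ℝ) :
    sepRate β n = optBw β n ^ (β - ⌈β⌉₊ + 1) := by
  rw [sepRate, optBw, ← Real.rpow_mul (log_div_pos hn).le]
  congr 1
  ring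

/-- The balance of bias and stochastic error at the optimal bandwidth. -/
theorem sqrt_log_div_optBw {n : ℕ} (hn : 3 ≤ n) {β : ℝ} (hβ : 0 < β) :
    √(Real.log n / (n * optBw β n)) = optBw β n ^ β := by
  have h0 := optBw_pos hn β
  rw [← div_div, ← optBw_rpow hn hβ, Real.sqrt_eq_iff_eq_sq (by positivity) (by positivity),
    div_eq_iff h0.ne', ← Real.rpow_natCast (optBw β n ^ β), ← Real.rpow_mul h0.le,
    ← Real.rpow_add_one h0.ne']
  congr 1
  push_cast
  ring

/-- The bound `n ^ (4/5) (log n) ^ (1/5)` for the radius of the largest window that bandwidth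
selection looks at; it is `n` times `optBw 2 n`. -/
noncomputable def maxWindow (n : ℕ) : ℝ := (n : ℝ) ^ (4 / 5 : ℝ) * Real.log n ^ (1 / 5 : ℝ)

theorem maxWindow_pos {n : ℕ} (hn : 3 ≤ n) : 0 < maxWindow n := by
  have h1 := one_lt_log hn
  have h2 : (0 : ℝ) < n := by exact_mod_cast (by omega : 0 < n)
  unfold maxWindow
  positivity

theorem logb_maxWindow {n : ℕ} (hn : 3 ≤ n) : Real.logb 4 (maxWindow n) =
    4 / 5 * Real.logb 4 n + 1 / 5 * Real.logb 4 (Real.log n) := by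
  have h1 := one_lt_log hn
  have h2 : (0 : ℝ) < n := by exact_mod_cast (by omega : 0 < n)
  rw [maxWindow, Real.logb_mul (by positivity) (by positivity),
    Real.logb_rpow_eq_mul_logb_of_pos h2, Real.logb_rpow_eq_mul_logb_of_pos (by linarith)]

theorem one_le_maxWindow {n : ℕ} (hn : 3 ≤ n) : 1 ≤ maxWindow n := by
  have h1 := one_lt_log hn
  have h2 : (1 : ℝ) ≤ n := by exact_mod_cast (by omega : 1 ≤ n)
  exact one_le_mul_of_one_le_of_one_le (Real.one_le_rpow h2 (by norm_num))
    (Real.one_le_rpow h1.le (by norm_num))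

theorem le_numBw_iff {n : ℕ} (hn : 3 ≤ n) {m : ℕ} : m ≤ numBw n ↔ (4 : ℝ) ^ m ≤ maxWindow n := by
  rw [numBw, ← logb_maxWindow hn,
    Nat.le_floor_iff (Real.logb_nonneg (by norm_num) (one_le_maxWindow hn)),
    Real.le_logb_iff_rpow_le (by norm_num) (maxWindow_pos hn), Real.rpow_natCast]

theorem mul_optBw_le_maxWindow {n : ℕ} (hn : 3 ≤ n) {β : ℝ} (hβ : 0 < β) (hβ2 : β ≤ 2) :
    n * optBw β n ≤ maxWindow n := by
  have h1 := one_lt_log hn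
  have h2 : (0 : ℝ) < n := by exact_mod_cast (by omega : 0 < n)
  calc n * optBw β n ≤ n * (Real.log n / n) ^ (1 / 5 : ℝ) := by
        unfold optBw
        refine mul_le_mul_of_nonneg_left ?_ h2.le
        refine Real.rpow_le_rpow_of_exponent_ge (log_div_pos hn) (log_div_le_one hn) ?_
        exact one_div_le_one_div_of_le (by positivity) (by linarith)
    _ = maxWindow n := by
        rw [maxWindow, Real.div_rpow (by linarith) h2.le, show (4 / 5 : ℝ) = 1 - 1 / 5 by norm_num,
          Real.rpow_sub h2, Real.rpow_one]
        ring

theorem exists_level {x : ℝ} (hx : 1 ≤ x) :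
    ∃ k : ℕ, 1 ≤ k ∧ (4 : ℝ) ^ (k - 1) ≤ x ∧ x < 4 * 4 ^ (k - 1) := by
  obtain ⟨j, h1, h2⟩ := exists_nat_pow_near hx (by norm_num : (1 : ℝ) < 4)
  exact ⟨j + 1, by omega, by simpa using h1, by
    rw [Nat.add_sub_cancel]; rw [pow_succ] at h2; linarith⟩

/-! ### Bandwidth selection adapts to the unknown smoothness -/

theorem mul_bw {n : ℕ} (hn : 1 ≤ n) (m : ℕ) : n * bw n m = ((4 ^ (m - 1) : ℕ) : ℝ) := by
  have h2 : (0 : ℝ) < n := by exact_mod_cast hn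
  rw [bw]
  push_cast
  field_simp

theorem bw_mono {n k m : ℕ} (h : k ≤ m) : bw n k ≤ bw n m := by
  unfold bw
  have : (4 : ℝ) ^ (k - 1) ≤ 4 ^ (m - 1) := pow_le_pow_right₀ (by norm_num) (by omega)
  gcongr

theorem bw_pos {n : ℕ} (hn : 1 ≤ n) (m : ℕ) : 0 < bw n m := by
  have h2 : (0 : ℝ) < n := by exact_mod_cast hn
  unfold bw
  positivity

theorem G2_nonneg (T : Tuning) (n m : ℕ) : 0 ≤ T.G2 n m := by
  unfold Tuning.G2 Tuning.Crho
  positivity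

theorem G2_anti (T : Tuning) {n k m : ℕ} (hn : 1 ≤ n) (h : k ≤ m) : T.G2 n m ≤ T.G2 n k := by
  unfold Tuning.G2
  have h1 := bw_mono (n := n) h
  have h2 := bw_pos hn k
  have h3 : (0 : ℝ) < n := by exact_mod_cast hn
  have h4 : 0 ≤ T.Crho := Real.sqrt_nonneg _
  have h5 : 0 ≤ Real.log n := Real.log_natCast_nonneg n
  gcongr

/-- As long as the error is at most `2 κ G₂(k)` at all levels `k ≤ k₀`, the selected level is at
least `k₀`, and the selected estimates are as accurate as at level `k₀`, up to a factor. -/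
theorem calm_accurate {T : Tuning} (hκ : 0 ≤ T.κ) {n : ℕ} (hn : 1 ≤ n) {Y : ℕ → ℝ} {g : ℕ → ℝ}
    {A : List ℕ} {k₀ : ℕ} (hk₀ : 1 ≤ k₀) (hk₁ : k₀ ≤ numBw n)
    (herr : ∀ k, 1 ≤ k → k ≤ k₀ → ∀ a ∈ A,
      |(lpeProg T.K n k Y a).val - g a| ≤ 2 * T.κ * T.G2 n k) :
    k₀ ≤ (calm T n Y A).val.1 ∧ ∃ est : ℕ → ℝ, (calm T n Y A).val.2 = A.map est ∧
      ∀ a ∈ A, |est a - g a| ≤ 6 * T.κ * T.G2 n k₀ := by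
  obtain ⟨m, -, hm, hest, hno, hend, -⟩ := calm_spec T n Y A
  have hG : ∀ k, 0 ≤ T.κ * T.G2 n k := fun k => mul_nonneg hκ (G2_nonneg T n k)
  have hvio : ∀ k j, Violation T n Y A k j ↔ ∃ a ∈ A, 4 * T.κ * T.G2 n k
      < |(lpeProg T.K n k Y a).val - (lpeProg T.K n j Y a).val| := fun k j =>
    violation_iff (by linarith [hG k])
  have hmk : k₀ ≤ m := by
    rcases hend with h | ⟨k, hk1, hkm, hv⟩
    · omega
    by_contra hlt
    rw [not_le] at hlt
    obtain ⟨a, ha, hlt'⟩ := (hvio k (m + 1)).1 hv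
    have h1 := abs_le.1 (herr k hk1 (by omega) a ha)
    have h2 := abs_le.1 (herr (m + 1) (by omega) (by omega) a ha)
    have h3 := mul_le_mul_of_nonneg_left (G2_anti T hn hkm.le) hκ
    refine absurd hlt' (not_lt.2 ?_)
    rw [abs_le]
    constructor <;> linarith [h1.1, h1.2, h2.1, h2.2]
  refine ⟨hm ▸ hmk, fun a => (lpeProg T.K n m Y a).val, hest (hk₀.trans hmk), fun a ha => ?_⟩
  have h1 := herr k₀ hk₀ le_rfl a ha
  rcases hmk.eq_or_lt with rfl | hlt
  · exact h1.trans (by linarith [hG k₀])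
  · have h2 := hno m le_rfl k₀ hk₀ hlt
    rw [hvio] at h2
    push Not at h2
    have h2' := abs_le.1 (h2 a ha)
    have h1' := abs_le.1 h1
    rw [abs_le]
    constructor <;> linarith [h1'.1, h1'.2, h2'.1, h2'.2]

/-- If all is well up to level `k₀`, a pair with a large enough drop leads to a rejection at the
selected level. -/
theorem testProg_calm {T : Tuning} (hκ : 0 ≤ T.κ) {n : ℕ} (hn : 1 ≤ n) {α : ℝ} {Y : ℕ → ℝ}
    {f : ℝ → ℝ} {s : List (ℕ × ℕ) × List ℕ} (hs : ValidIndices n s) {k₀ : ℕ} (hk₀ : 1 ≤ k₀)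
    (hk₁ : k₀ ≤ numBw n)
    (herr : ∀ k, 1 ≤ k → k ≤ k₀ → ∀ a ∈ s.2,
      |(lpeProg T.K n k Y a).val - f (a / n)| ≤ 2 * T.κ * T.G2 n k)
    {ψ θ : ℝ} (hcrit : ∀ i j h, bw n k₀ ≤ h → T.critVal α n i j h ≤ ψ)
    (hθ : 12 * T.κ * T.G2 n k₀ + ψ ≤ θ) (hex : ∃ p ∈ s.1, Drop f n θ p) :
    (testProg T α n (bw n (calm T n Y s.2).val.1) s.2 (calm T n Y s.2).val.2 s.1).val = true := by
  obtain ⟨hle, est, hest, hacc⟩ :=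
    calm_accurate (T := T) (g := fun a => f (a / n)) hκ hn hk₀ hk₁ herr
  rw [hest]
  refine testProg_val T α n _ est hs.1 ?_
  obtain ⟨p, hp, hd⟩ := hex
  refine ⟨p, hp, ?_⟩
  have hd' : θ ≤ f (p.1 / n) - f (p.2 / n) := hd
  have h1 := abs_le.1 (hacc p.1 (hs.1 p hp).1)
  have h2 := abs_le.1 (hacc p.2 (hs.1 p hp).2)
  have h3 := hcrit p.1 p.2 _ (bw_mono hle)
  linarith [h1.1, h2.2]

/-! ### The level of the optimal bandwidth -/

theorem mu2_pos {K : ℝ → ℝ} {Kmax Kmin Δ LK : ℝ} (hK : KernelAssumptions K Kmax Kmin Δ LK) :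
    0 < mu2 K := by
  have hcont : Continuous K := by
    refine (LipschitzWith.of_dist_le_mul (K := Real.toNNReal LK) fun u v => ?_).continuous
    rw [Real.coe_toNNReal _ hK.LK_pos.le]
    exact hK.lipschitz u v
  have hsupp : HasCompactSupport fun u => K u ^ 2 := by
    refine HasCompactSupport.of_support_subset_isCompact (isCompact_Icc (a := (-1 : ℝ)) (b := 1)) ?_
    intro u hu
    refine hK.support_subset fun h0 => hu ?_
    change K u ^ 2 = 0
    rw [h0]; ring
  refine ((hcont.pow 2).integral_pos_of_hasCompactSupport_nonneg_nonzero (x := 0) hsupp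
    (fun u => sq_nonneg _) ?_)
  have := hK.Kmin_pos.trans_le hK.le_apply_zero
  exact (pow_pos this 2).ne'

theorem Crho_pos {T : Tuning} (hmu : 0 < mu2 T.K) (hσ : 0 < T.σ) (hlam : 0 < T.lam0) :
    0 < T.Crho := by
  unfold Tuning.Crho
  positivity

theorem kappa_pos {T : Tuning} (hmax : 0 < T.Kmax)
    (hκ : 1 + 2 * T.Kmax / √(mu2 T.K) < T.κ) : 0 < T.κ := by
  have : 0 ≤ 2 * T.Kmax / √(mu2 T.K) := by positivity
  linarith

/-- The constant of the bias bound. -/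
noncomputable def biasConst (Kmax Kmin Δ L : ℝ) : ℝ := √(3 * (Kmax / massConst Kmin Δ)) * L

/-- The ratio of the largest bandwidth at which the bias is known to be dominated by the threshold
of the bandwidth selector to `optBw β n`. -/
noncomputable def bwRatio (T : Tuning) (Kmin Δ L : ℝ) : ℝ :=
  min (1 / 4) ((T.κ * T.Crho / (biasConst T.Kmax Kmin Δ L + 1)) ^ 2)

section
variable {T : Tuning} {Kmin Δ : ℝ} {L : ℝ}

theorem biasConst_nonneg {Kmax : ℝ} (hL : 0 < L) : 0 ≤ biasConst Kmax Kmin Δ L := by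
  unfold biasConst; positivity

theorem bwRatio_pos (hκ : 0 < T.κ) (hC : 0 < T.Crho) (hL : 0 < L) : 0 < bwRatio T Kmin Δ L := by
  have := biasConst_nonneg (Kmax := T.Kmax) (Kmin := Kmin) (Δ := Δ) hL
  unfold bwRatio
  refine lt_min (by norm_num) ?_
  positivity

/-- The bias at bandwidth `N / n`, for `N / n` at most `bwRatio` times the optimal one. -/
theorem bias_le_threshold (hκ : 0 < T.κ) (hC : 0 < T.Crho) {β : ℝ} (hβ : 0 < β) (hL : 0 < L)
    {n N : ℕ} (hn : 3 ≤ n) (hN : 0 < N) (hle : (N : ℝ) ≤ bwRatio T Kmin Δ L * (n * optBw β n)) :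
    biasConst T.Kmax Kmin Δ L * (N / n : ℝ) ^ β ≤ T.κ * (T.Crho * √(Real.log n / N)) := by
  set B := biasConst T.Kmax Kmin Δ L with hB
  set q := bwRatio T Kmin Δ L with hq
  have hB0 : 0 ≤ B := biasConst_nonneg hL
  have hq0 : 0 < q := bwRatio_pos hκ hC hL
  have hn0 : (0 : ℝ) < n := by exact_mod_cast (by omega : 0 < n)
  have hN0 : (0 : ℝ) < N := by exact_mod_cast hN
  have hlog := one_lt_log hn
  have hs := optBw_pos hn β
  have hNn : (N / n : ℝ) ≤ q * optBw β n := by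
    rw [div_le_iff₀ hn0]; linarith
  have hq14 : q ≤ 1 / 4 := min_le_left _ _
  have hsq : √q ≤ T.κ * T.Crho / (B + 1) := by
    rw [Real.sqrt_le_left (by positivity)]
    exact min_le_right _ _
  have hNp : (0 : ℝ) < N / n := by positivity
  have hrew : √(Real.log n / N) = optBw β n ^ (β + 1 / 2) / √(N / n : ℝ) := by
    rw [eq_div_iff (by positivity), ← Real.sqrt_mul (by positivity),
      show Real.log n / N * (N / n : ℝ) = Real.log n / n by field_simp, ← optBw_rpow hn hβ,
      Real.sqrt_eq_rpow, ← Real.rpow_mul hs.le]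
    congr 1; ring
  rw [hrew, ← mul_div_assoc, ← mul_div_assoc, le_div_iff₀ (by positivity), Real.sqrt_eq_rpow,
    mul_assoc, ← Real.rpow_add hNp]
  have h1 : (N / n : ℝ) ^ (β + 1 / 2) ≤ √q * optBw β n ^ (β + 1 / 2) := by
    refine (Real.rpow_le_rpow hNp.le hNn (by positivity)).trans ?_
    rw [Real.mul_rpow hq0.le hs.le]
    refine mul_le_mul_of_nonneg_right ?_ (by positivity)
    rw [Real.sqrt_eq_rpow]
    exact Real.rpow_le_rpow_of_exponent_ge hq0 (by linarith) (by linarith)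
  have h2 : B * √q ≤ T.κ * T.Crho := by
    calc B * √q ≤ (B + 1) * (T.κ * T.Crho / (B + 1)) := by gcongr; linarith
      _ = T.κ * T.Crho := by field_simp
  calc B * (N / n : ℝ) ^ (β + 1 / 2) ≤ B * (√q * optBw β n ^ (β + 1 / 2)) := by gcongr
    _ = B * √q * optBw β n ^ (β + 1 / 2) := by ring
    _ ≤ T.κ * T.Crho * optBw β n ^ (β + 1 / 2) := by gcongr
    _ = _ := by ring

/-- Some level has a bandwidth of the order of `optBw β n`, with small enough bias. -/
theorem exists_optLevel {β : ℝ} (hβ : 0 < β) (hβ2 : β ≤ 2) {n : ℕ} (hn : 3 ≤ n)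
    (hbig : 1 ≤ bwRatio T Kmin Δ L * (n * optBw β n)) :
    ∃ k₀, 1 ≤ k₀ ∧ k₀ ≤ numBw n ∧ (4 : ℝ) ^ (k₀ - 1) ≤ bwRatio T Kmin Δ L * (n * optBw β n) ∧
      bwRatio T Kmin Δ L * (n * optBw β n) < 4 * 4 ^ (k₀ - 1) := by
  obtain ⟨k₀, h1, h2, h3⟩ := exists_level hbig
  refine ⟨k₀, h1, ?_, h2, h3⟩
  rw [le_numBw_iff hn]
  have h4 : (4 : ℝ) ^ k₀ = 4 * 4 ^ (k₀ - 1) := by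
    rw [← pow_succ']; congr 1; omega
  have h5 : bwRatio T Kmin Δ L ≤ 1 / 4 := min_le_left _ _
  have h6 : 0 ≤ n * optBw β n := by have := optBw_pos hn β; positivity
  refine le_trans ?_ (mul_optBw_le_maxWindow hn hβ hβ2)
  rw [h4]
  nlinarith

/-- At levels up to the optimal one, at least one side of each design point has a full window. -/
theorem two_mul_pow_le (hκ : 0 < T.κ) (hC : 0 < T.Crho) {β : ℝ} (hβ : 0 < β) (hL : 0 < L) {n : ℕ}
    (hn : 3 ≤ n) {k : ℕ} (hle : (4 : ℝ) ^ (k - 1) ≤ bwRatio T Kmin Δ L * (n * optBw β n)) :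
    2 * 4 ^ (k - 1) ≤ n := by
  have hn0 : (0 : ℝ) < n := by exact_mod_cast (by omega : 0 < n)
  have h5 : bwRatio T Kmin Δ L ≤ 1 / 4 := min_le_left _ _
  have h0 := bwRatio_pos (Kmin := Kmin) (Δ := Δ) hκ hC hL
  have h6 := optBw_le_one hn hβ
  have h7 := optBw_pos hn β
  have h8 : n * optBw β n ≤ n := by nlinarith
  have h9 : (4 : ℝ) ^ (k - 1) ≤ n / 4 := by
    have : 0 ≤ n * optBw β n := by positivity
    nlinarith
  have : ((2 * 4 ^ (k - 1) : ℕ) : ℝ) ≤ n := by push_cast; linarith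
  exact_mod_cast this

/-- At levels up to the optimal one, the bias is below a quarter of the threshold of the bandwidth
selector. -/
theorem abs_lpeProg_sub_le (hK : KernelAssumptions T.K T.Kmax Kmin Δ T.LK)
    (hκ : 0 < T.κ) (hC : 0 < T.Crho) {β : ℝ} (hβ : 0 < β) (hβ2 : β ≤ 2) (hL : 0 < L)
    {f : ℝ → ℝ} (hf : f ∈ Holder β L) {n : ℕ} (hn : 3 ≤ n) {k : ℕ}
    (hle : (4 : ℝ) ^ (k - 1) ≤ bwRatio T Kmin Δ L * (n * optBw β n)) {e : ℕ → ℝ} {a : ℕ}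
    (ha : a ∈ Finset.Icc 1 n) :
    |(lpeProg T.K n k (obs f n e) a).val - f (a / n)|
      ≤ T.κ * T.G2 n k + |noisePart T.K n (4 ^ (k - 1)) a e| := by
  have hN : 0 < 4 ^ (k - 1) := by positivity
  have hle' : ((4 ^ (k - 1) : ℕ) : ℝ) ≤ bwRatio T Kmin Δ L * (n * optBw β n) := by
    push_cast; exact hle
  have h2N := two_mul_pow_le hκ hC hβ hL hn hle
  have hb := bias_le hK hβ hβ2 hL hf ha hN h2N
  have ht := bias_le_threshold hκ hC hβ hL hn hN hle'
  rw [biasConst] at ht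
  rw [lpeProg_obs hK k f e ha, Tuning.G2, mul_bw (by omega) k]
  have he := abs_le.1 (le_refl |noisePart T.K n (4 ^ (k - 1)) a e|)
  rw [abs_le] at hb ⊢
  constructor <;> linarith [hb.1, hb.2, he.1, he.2]

theorem sqrt_optLevel_le (hq : 0 < bwRatio T Kmin Δ L) {β : ℝ} (hβ : 0 < β) {n : ℕ} (hn : 3 ≤ n)
    {x : ℝ} (hx : bwRatio T Kmin Δ L * (n * optBw β n) ≤ 4 * x) :
    √(Real.log n / x) ≤ 2 / √(bwRatio T Kmin Δ L) * optBw β n ^ β := by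
  set q := bwRatio T Kmin Δ L
  have hn0 : (0 : ℝ) < n := by exact_mod_cast (by omega : 0 < n)
  have hs := optBw_pos hn β
  have hlog := one_lt_log hn
  have hx0 : 0 < x := by
    have : 0 < q * (n * optBw β n) := by positivity
    linarith
  rw [← sqrt_log_div_optBw hn hβ,
    show 2 / √q = √(4 / q) by
      rw [Real.sqrt_div (by norm_num), show (4 : ℝ) = 2 ^ 2 by norm_num,
        Real.sqrt_sq (by norm_num)],
    ← Real.sqrt_mul (by positivity)]
  refine Real.sqrt_le_sqrt ?_
  rw [div_mul_div_comm, div_le_div_iff₀ (by positivity) (by positivity)]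
  nlinarith

theorem G2_optLevel_le (hq : 0 < bwRatio T Kmin Δ L) {β : ℝ} (hβ : 0 < β) {n : ℕ} (hn : 3 ≤ n)
    {k₀ : ℕ} (hk : bwRatio T Kmin Δ L * (n * optBw β n) < 4 * 4 ^ (k₀ - 1)) :
    T.G2 n k₀ ≤ T.Crho * (2 / √(bwRatio T Kmin Δ L) * optBw β n ^ β) := by
  unfold Tuning.G2
  refine mul_le_mul_of_nonneg_left ?_ (Real.sqrt_nonneg _)
  rw [mul_bw (by omega)]
  push_cast
  exact sqrt_optLevel_le hq hβ hn hk.le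

/-- The critical values are of the order of the minimax rate at bandwidths beyond the optimal
one. -/
theorem critVal_le (hσ : 0 < T.σ) (hq : 0 < bwRatio T Kmin Δ L) {β : ℝ} (hβ : 0 < β) {n : ℕ}
    (hn : 3 ≤ n) {α : ℝ} (hα : -2 * Real.log (α / Tuning.Nmax α n) ≤ 6 * Real.log n) {k₀ : ℕ}
    (hk : bwRatio T Kmin Δ L * (n * optBw β n) < 4 * 4 ^ (k₀ - 1)) (i j : ℕ) {h : ℝ}
    (hh : bw n k₀ ≤ h) :
    T.critVal α n i j h
      ≤ T.σ * √(6 * T.W) * (2 / √(bwRatio T Kmin Δ L) * optBw β n ^ β) := by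
  set q := bwRatio T Kmin Δ L
  have hn0 : (0 : ℝ) < n := by exact_mod_cast (by omega : 0 < n)
  have hs := optBw_pos hn β
  have hlog := one_lt_log hn
  have hh0 : 0 < h := (bw_pos (by omega) k₀).trans_le hh
  have hW : 0 ≤ T.W := le_max_of_le_left (by positivity)
  have h1 : T.critVal α n i j h ≤ T.σ * √(6 * Real.log n * T.W) * (n : ℝ) ^ (-(1 / 2) : ℝ)
      * h ^ (-(3 / 2) : ℝ) * h := by
    unfold Tuning.critVal
    refine (mul_le_mul_of_nonneg_left (min_le_right _ _) (by positivity)).trans ?_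
    gcongr
  refine h1.trans ?_
  have h2 : T.σ * √(6 * Real.log n * T.W) * (n : ℝ) ^ (-(1 / 2) : ℝ) * h ^ (-(3 / 2) : ℝ) * h
      = T.σ * √(6 * T.W) * √(Real.log n / (n * h)) := by
    rw [mul_right_comm 6 (Real.log n), Real.sqrt_mul (by positivity),
      Real.sqrt_div (zero_le_one.trans hlog.le), Real.sqrt_mul hn0.le, mul_assoc,
      ← Real.rpow_add_one hh0.ne',
      Real.rpow_neg hn0.le, show (-(3 / 2) + 1 : ℝ) = -(1 / 2) by norm_num, Real.rpow_neg hh0.le,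
      ← Real.sqrt_eq_rpow, ← Real.sqrt_eq_rpow]
    field_simp
  rw [h2]
  refine mul_le_mul_of_nonneg_left ?_ (by positivity)
  refine sqrt_optLevel_le hq hβ hn ?_
  have h4 := mul_bw (n := n) (by omega) k₀
  have h5 := mul_le_mul_of_nonneg_left hh hn0.le
  push_cast at h4
  linarith

end

/-! ### The rounds of the test -/

/-- The deterministic part of a round: bandwidth selection and the local tests, for given
indices. -/
noncomputable def roundProg (T : Tuning) (α : ℝ) (n : ℕ) (Y : ℕ → ℝ)
    (s : List (ℕ × ℕ) × List ℕ) : Timed Bool := do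
  let r ← calm T n Y s.2
  let h ← charge 3 (bw n r.1)
  testProg T α n h s.2 r.2 s.1

/-- The rounds from the choice of the bandwidth on, after the indices have been drawn. -/
noncomputable def afterIndices (T : Tuning) (α : ℝ) (n : ℕ) (Y : ℕ → ℝ) (l : ℕ)
    (s : List (ℕ × ℕ) × List ℕ) : Prog Bool :=
  (liftM (roundProg T α n Y s) : Prog Bool) >>= fun z =>
    if z then pure true else afomtLoop T α n Y l

theorem afomtLoop_succ (T : Tuning) (α : ℝ) (n : ℕ) (Y : ℕ → ℝ) (l : ℕ) :
    afomtLoop T α n Y (l + 1) = ((liftM (op ()) : Prog Unit) >>= fun _ =>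
      randomIndices n >>= fun s => afterIndices T α n Y l s) := by
  rw [afomtLoop]
  congr 1
  funext _
  congr 1
  funext s
  unfold afterIndices
  refine (PMF.pure_bind (calm T n Y s.2) _).trans (Eq.trans ?_ (PMF.pure_bind _ _).symm)
  refine (congrArg (PMF.map _) ((PMF.pure_bind (charge 3 _) _).trans
    (congrArg (PMF.map _) (PMF.pure_bind (testProg T α n _ s.2 _ s.1) _)))).trans ?_
  refine (PMF.map_comp _ _ _).trans ((PMF.map_comp _ _ _).trans ?_)
  refine congrArg₂ PMF.map ?_ rfl
  funext q
  have h : ∀ a b c d : ℕ, a + (b + (c + d)) = a + (b + c) + d := by omega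
  exact congrArg (Timed.mk q.val) (h _ _ _ _)

theorem pr_afomtLoop_succ (T : Tuning) (α : ℝ) (n : ℕ) (Y : ℕ → ℝ) (l : ℕ) (S : Set (Timed Bool)) :
    (afomtLoop T α n Y (l + 1)).pr S = (randomIndices n >>= fun s => afterIndices T α n Y l s).pr
      {q | (⟨q.val, 1 + q.steps⟩ : Timed Bool) ∈ S} := by
  rw [afomtLoop_succ, Prog.pr_op_bind]

/-- Bound for the steps of a round, when the largest window used has `x` points up to a
constant. -/
noncomputable def roundCost (n x : ℕ) : ℕ :=
  20 * levelBound n ^ 2 + 94 * levelBound n + 8 + 162 * (levelBound n + 1) * x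

theorem roundProg_steps_le (T : Tuning) (α : ℝ) {n x : ℕ} (Y : ℕ → ℝ)
    {q : Timed (List (ℕ × ℕ) × List ℕ)}
    (hP : q.val.1.length ≤ 2 * levelBound n) (hA : q.val.2.length ≤ 2 * levelBound n + 1)
    (hq : q.steps ≤ 12 * levelBound n ^ 2 + 20 * levelBound n + 4)
    (hx : 4 ^ ((calm T n Y q.val.2).val.1 + 1) ≤ x) :
    1 + (q.steps + (roundProg T α n Y q.val).steps) ≤ roundCost n x := by
  obtain ⟨m, -, hm, -, -, -, hcost⟩ := calm_spec T n Y q.val.2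
  rw [hm] at hx
  have h1 : (calm T n Y q.val.2).steps ≤ 162 * (levelBound n + 1) * x := by
    refine hcost.trans (Nat.mul_le_mul ?_ hx)
    omega
  have h2 := testProg_steps_le T α n (bw n (calm T n Y q.val.2).val.1) q.val.2
    (calm T n Y q.val.2).val.2 q.val.1
  have h3 : q.val.1.length * (2 * q.val.2.length + 35)
      ≤ 2 * levelBound n * (2 * (2 * levelBound n + 1) + 35) :=
    Nat.mul_le_mul hP (by omega)
  have h4 : (roundProg T α n Y q.val).steps = (calm T n Y q.val.2).steps + (3 +
      (testProg T α n (bw n (calm T n Y q.val.2).val.1) q.val.2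
        (calm T n Y q.val.2).val.2 q.val.1).steps) := by
    simp [roundProg]
  rw [h4, roundCost]
  have h5 : 2 * levelBound n * (2 * (2 * levelBound n + 1) + 35)
      = 8 * levelBound n ^ 2 + 74 * levelBound n := by ring
  omega

/-- A bound for the cost of every round bounds the cost of the loop. -/
theorem sure_afomtLoop {T : Tuning} {α : ℝ} {n B : ℕ} {Y : ℕ → ℝ}
    (hB : (randomIndices n).Sure fun q => 1 + (q.steps + (roundProg T α n Y q.val).steps) ≤ B)
    (l : ℕ) : (afomtLoop T α n Y l).Sure fun r => r.steps ≤ l * B := by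
  induction l with
  | zero => exact Prog.sure_pure (by simp)
  | succ l ih =>
    rw [afomtLoop_succ]
    refine Prog.sure_op_bind (Prog.sure_bind _ hB fun p hp => ?_)
    refine Prog.sure_lift_bind ?_
    dsimp only at hp ⊢
    have hexp : (l + 1) * B = l * B + B := by ring
    split_ifs
    · refine Prog.sure_pure ?_
      dsimp only
      omega
    · refine ih.mono fun r hr => ?_
      omega

/-- Until a round rejects, each one does so with probability at least `p`, so that `t` rounds
suffice with probability `1 - (1 - p) ^ t`, unless one of them costs more than `B`. -/
theorem pr_afomtLoop_le {T : Tuning} {α : ℝ} {n B : ℕ} {Y : ℕ → ℝ} {η π : ENNReal}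
    (hη : (randomIndices n).pr {q | B < 1 + (q.steps + (roundProg T α n Y q.val).steps)} ≤ η)
    (hπ : (randomIndices n).pr {q | (roundProg T α n Y q.val).val ≠ true} ≤ π) (l t : ℕ) :
    (afomtLoop T α n Y l).pr {r | t * B < r.steps} ≤ π ^ t + l * η := by
  induction l generalizing t with
  | zero =>
    refine le_of_eq_of_le (Prog.pr_eq_zero (Prog.sure_pure ?_)) zero_le
    simp
  | succ l ih =>
    cases t with
    | zero =>
      rw [pow_zero]
      exact (Prog.pr_le_one _ _).trans le_self_add
    | succ t =>
      rw [pr_afomtLoop_succ]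
      refine (Prog.pr_bind_le_add {q | B < 1 + (q.steps + (roundProg T α n Y q.val).steps)}
        {q | (roundProg T α n Y q.val).val ≠ true} (B := π ^ t + l * η) fun p hp hE => ?_).trans ?_
      · have hE' : ¬ B < 1 + (p.steps + (roundProg T α n Y p.val).steps) := hE
        have hexp : (t + 1) * B = t * B + B := by ring
        by_cases hz : (roundProg T α n Y p.val).val = true
        · right
          rw [afterIndices, Prog.pr_lift_bind, if_pos hz]
          refine Prog.pr_eq_zero (Prog.sure_pure ?_)
          intro h
          have h' : (t + 1) * B < 1 + (p.steps + ((roundProg T α n Y p.val).steps + 0)) := h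
          have := Nat.zero_le (t * B)
          omega
        · refine Or.inl ⟨hz, ?_⟩
          rw [afterIndices, Prog.pr_lift_bind, if_neg hz]
          refine le_trans (Prog.pr_mono ?_) (ih t)
          intro r hr
          have h' : (t + 1) * B
            < 1 + (p.steps + ((roundProg T α n Y p.val).steps + r.steps)) := hr
          change t * B < r.steps
          omega
      · have h1 : (randomIndices n).pr {q | (roundProg T α n Y q.val).val ≠ true} * (l * η)
            ≤ l * η := mul_le_of_le_one_left zero_le (Prog.pr_le_one _ _)
        calc _ ≤ η + (randomIndices n).pr {q | (roundProg T α n Y q.val).val ≠ true}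
              * (π ^ t + l * η) := by gcongr
          _ = η + ((randomIndices n).pr {q | (roundProg T α n Y q.val).val ≠ true} * π ^ t
              + (randomIndices n).pr {q | (roundProg T α n Y q.val).val ≠ true} * (l * η)) := by
              rw [mul_add]
          _ ≤ η + (π * π ^ t + l * η) := by gcongr
          _ = π ^ (t + 1) + ((l + 1 : ℕ) : ENNReal) * η := by
              push_cast
              ring

theorem afomt_eq (T : Tuning) (α : ℝ) (n : ℕ) (Y : ℕ → ℝ) : afomt T α n Y =
    ((liftM (charge 10 ⌊numRounds α n⌋₊) : Prog ℕ) >>= fun l => afomtLoop T α n Y l) := rfl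

/-! ### From rounds to the number of steps -/

theorem ofReal_one_sub_le_lintegral {Ω : Type} [MeasurableSpace Ω] {μ : Measure Ω}
    [IsProbabilityMeasure μ] {α : ℝ} (h0 : 0 < α) (h1 : α < 1) {Bad : Set Ω}
    (hBad : μ Bad ≤ ENNReal.ofReal (α / 2)) {F : Ω → ENNReal}
    (hF : ∀ e ∉ Bad, ENNReal.ofReal (1 - α / 2) ≤ F e) :
    ENNReal.ofReal (1 - α) ≤ ∫⁻ e, F e ∂μ := by
  set E := toMeasurable μ Bad with hE
  have hEm : MeasurableSet E := measurableSet_toMeasurable μ Bad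
  have hEc : ENNReal.ofReal (1 - α / 2) ≤ μ Eᶜ := by
    rw [prob_compl_eq_one_sub hEm, measure_toMeasurable,
      ENNReal.ofReal_sub _ (by linarith), ENNReal.ofReal_one]
    exact tsub_le_tsub_left hBad 1
  calc ENNReal.ofReal (1 - α) ≤ ENNReal.ofReal (1 - α / 2) * ENNReal.ofReal (1 - α / 2) := by
        rw [← ENNReal.ofReal_mul (by linarith)]
        refine ENNReal.ofReal_le_ofReal ?_
        nlinarith [sq_nonneg α]
    _ ≤ ENNReal.ofReal (1 - α / 2) * μ Eᶜ := by gcongr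
    _ = ∫⁻ _ in Eᶜ, ENNReal.ofReal (1 - α / 2) ∂μ := (setLIntegral_const _ _).symm
    _ ≤ ∫⁻ e in Eᶜ, F e ∂μ := by
        refine setLIntegral_mono' hEm.compl fun e he => hF e fun hb => he ?_
        exact subset_toMeasurable μ Bad hb
    _ ≤ ∫⁻ e, F e ∂μ := setLIntegral_le_lintegral _ _

theorem one_sub_pow_le {α ε : ℝ} (h0 : 0 < α) (hε : 0 < ε) (hε1 : ε ≤ 1) :
    (1 - ENNReal.ofReal (ε / 16)) ^ ⌈Real.log (4 / α) * (16 / ε)⌉₊ ≤ ENNReal.ofReal (α / 4) := by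
  rw [← ENNReal.ofReal_one, ← ENNReal.ofReal_sub _ (by positivity),
    ← ENNReal.ofReal_pow (by linarith)]
  refine ENNReal.ofReal_le_ofReal ?_
  have h1 : 1 - ε / 16 ≤ Real.exp (-(ε / 16)) := by
    have := Real.add_one_le_exp (-(ε / 16)); linarith
  calc (1 - ε / 16) ^ ⌈Real.log (4 / α) * (16 / ε)⌉₊
      ≤ Real.exp (-(ε / 16)) ^ ⌈Real.log (4 / α) * (16 / ε)⌉₊ :=
        pow_le_pow_left₀ (by linarith) h1 _
    _ = Real.exp (-(⌈Real.log (4 / α) * (16 / ε)⌉₊ * (ε / 16))) := by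
        rw [← Real.exp_nat_mul]; congr 1; ring
    _ ≤ Real.exp (-Real.log (4 / α)) := by
        refine Real.exp_le_exp.2 (neg_le_neg ?_)
        have h2 := Nat.le_ceil (Real.log (4 / α) * (16 / ε))
        calc Real.log (4 / α) = Real.log (4 / α) * (16 / ε) * (ε / 16) := by field_simp
          _ ≤ _ := by gcongr
    _ = α / 4 := by
        rw [Real.exp_neg, Real.exp_log (by positivity), inv_div]

/-- If, outside a small set of errors, each round rejects with probability at least `ε / 16` and
the rounds rarely cost more than `B`, then the test takes `O(B / ε)` steps. -/
theorem le_probSteps {T : Tuning} {α : ℝ} (h0 : 0 < α) (h1 : α < 1) {n B : ℕ} {f : ℝ → ℝ} {ε : ℝ}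
    (hε : 0 < ε) (hε1 : ε ≤ 1) {Bad : Set (ℕ → ℝ)}
    (hBad : noiseLaw T.σ Bad ≤ ENNReal.ofReal (α / 2)) {η : ENNReal}
    (hη : ∀ e ∉ Bad, (randomIndices n).pr
      {q | B < 1 + (q.steps + (roundProg T α n (obs f n e) q.val).steps)} ≤ η)
    (hl : ⌊numRounds α n⌋₊ * η ≤ ENNReal.ofReal (α / 4))
    (hπ : ∀ e ∉ Bad, (randomIndices n).pr {q | (roundProg T α n (obs f n e) q.val).val ≠ true}
      ≤ 1 - ENNReal.ofReal (ε / 16))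
    {x : ℝ} (hx : 10 + (16 * Real.log (4 / α) + 1) / ε * B ≤ x) :
    ENNReal.ofReal (1 - α) ≤ probSteps T α n f x := by
  refine ofReal_one_sub_le_lintegral h0 h1 hBad fun e he => ?_
  set t := ⌈Real.log (4 / α) * (16 / ε)⌉₊ with ht
  have hlog : 0 ≤ Real.log (4 / α) := Real.log_nonneg (by rw [le_div_iff₀ h0]; linarith)
  have hloop := pr_afomtLoop_le (hη e he) (hπ e he) ⌊numRounds α n⌋₊ t
  have htail : (afomt T α n (obs f n e)).pr {r | (r.steps : ℝ) ≤ x}ᶜ ≤ ENNReal.ofReal (α / 2) := by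
    rw [afomt_eq, Prog.pr_lift_bind]
    refine (Prog.pr_mono ?_).trans (hloop.trans ?_)
    · intro r hr
      have hr' : ¬ ((10 + r.steps : ℕ) : ℝ) ≤ x := hr
      change t * B < r.steps
      by_contra hle
      rw [not_lt] at hle
      refine hr' (le_trans ?_ hx)
      have h2 : (r.steps : ℝ) ≤ t * B := by exact_mod_cast hle
      have h3 : (t : ℝ) ≤ Real.log (4 / α) * (16 / ε) + 1 :=
        (Nat.ceil_lt_add_one (by positivity)).le
      have h4 : Real.log (4 / α) * (16 / ε) + 1 ≤ (16 * Real.log (4 / α) + 1) / ε := by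
        rw [add_div]
        have : 1 ≤ 1 / ε := by rw [le_div_iff₀ hε]; linarith
        have h5 : Real.log (4 / α) * (16 / ε) = 16 * Real.log (4 / α) / ε := by ring
        linarith
      have h6 : (t : ℝ) * B ≤ (16 * Real.log (4 / α) + 1) / ε * B := by gcongr; linarith
      push_cast
      linarith
    · calc _ ≤ ENNReal.ofReal (α / 4) + ENNReal.ofReal (α / 4) :=
            add_le_add (one_sub_pow_le h0 hε hε1) hl
        _ = ENNReal.ofReal (α / 2) := by
            rw [← ENNReal.ofReal_add (by linarith) (by linarith)]; congr 1; ring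
  have hsum := Prog.pr_compl (afomt T α n (obs f n e)) {r | (r.steps : ℝ) ≤ x}
  change ENNReal.ofReal (1 - α / 2)
    ≤ (afomt T α n (obs f n e)).pr {r | (r.steps : ℝ) ≤ x}
  rw [ENNReal.ofReal_sub _ (by linarith), ENNReal.ofReal_one, tsub_le_iff_right, ← hsum]
  gcongr

/-! ### Exceptional errors -/

theorem countable_timed {α : Type} [Countable α] : Countable (Timed α) :=
  Function.Injective.countable (f := fun t : Timed α => (t.val, t.steps)) fun s t h => by
    cases s; cases t; simpa using h

theorem pr_eq_tsum_indicator {α Ω : Type} (x : Prog α) (R : Ω → α → Prop) (e : Ω) :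
    x.pr {q | R e q.val} = ∑' p : Timed α,
      Set.indicator {e | R e p.val} (fun _ => x.toPMF p) e := by
  rw [Prog.pr, PMF.toOuterMeasure_apply]
  refine tsum_congr fun p => ?_
  by_cases h : R e p.val
  · rw [Set.indicator_of_mem (show p ∈ {q : Timed α | R e q.val} from h),
      Set.indicator_of_mem (show e ∈ {e | R e p.val} from h)]
  · rw [Set.indicator_of_notMem (show p ∉ {q : Timed α | R e q.val} from h),
      Set.indicator_of_notMem (show e ∉ {e | R e p.val} from h)]

theorem measurable_pr {α Ω : Type} [Countable α] [MeasurableSpace Ω] (x : Prog α)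
    {R : Ω → α → Prop} (hR : ∀ a, MeasurableSet {e | R e a}) :
    Measurable fun e => x.pr {q | R e q.val} := by
  have := countable_timed (α := α)
  simp only [pr_eq_tsum_indicator]
  exact Measurable.tsum fun p => measurable_const.indicator (hR p.val)

/-- An event that has small probability for each possible outcome of the program has small
expected conditional probability. -/
theorem lintegral_pr_le {α Ω : Type} [Countable α] [MeasurableSpace Ω] {μ : Measure Ω}
    (x : Prog α) {R : Ω → α → Prop} (hR : ∀ a, MeasurableSet {e | R e a}) {δ : ENNReal}
    (hδ : x.Sure fun q => μ {e | R e q.val} ≤ δ) :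
    ∫⁻ e, x.pr {q | R e q.val} ∂μ ≤ δ := by
  have := countable_timed (α := α)
  simp only [pr_eq_tsum_indicator]
  rw [lintegral_tsum fun p : Timed α =>
    ((measurable_const (a := x.toPMF p)).indicator (hR p.val)).aemeasurable]
  calc _ ≤ ∑' p, x.toPMF p * δ := by
        refine ENNReal.tsum_le_tsum fun p => ?_
        rw [lintegral_indicator_const (hR p.val)]
        by_cases hp : p ∈ x.toPMF.support
        · gcongr
          exact hδ p hp
        · rw [(PMF.apply_eq_zero_iff (p := x.toPMF) p).2 hp, zero_mul, zero_mul]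
    _ = δ := by rw [ENNReal.tsum_mul_right, PMF.tsum_coe, one_mul]

/-- At the levels up to `k₀`, the stochastic errors at the indices `A` are at most `τ` times their
order of magnitude `√(log n / N)`. -/
def CleanNoise (T : Tuning) (n k₀ : ℕ) (τ : ℝ) (e : ℕ → ℝ) (A : List ℕ) : Prop :=
  ∀ k ∈ Finset.Icc 1 k₀, ∀ a ∈ A.toFinset, |noisePart T.K n (4 ^ (k - 1)) a e|
    ≤ τ * √(Real.log n / (4 ^ (k - 1) : ℕ))

theorem setOf_not_cleanNoise (T : Tuning) (n k₀ : ℕ) (τ : ℝ) (A : List ℕ) :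
    {e | ¬ CleanNoise T n k₀ τ e A} = ⋃ k ∈ Finset.Icc 1 k₀, ⋃ a ∈ A.toFinset,
      {e | τ * √(Real.log n / (4 ^ (k - 1) : ℕ)) < |noisePart T.K n (4 ^ (k - 1)) a e|} := by
  ext e
  have h : e ∈ {e | ¬ CleanNoise T n k₀ τ e A} ↔ ¬ CleanNoise T n k₀ τ e A := Iff.rfl
  rw [h, CleanNoise]
  push Not
  simp only [Set.mem_iUnion, exists_prop]
  rfl

theorem measurableSet_not_cleanNoise (T : Tuning) (n k₀ : ℕ) (τ : ℝ) (A : List ℕ) :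
    MeasurableSet {e | ¬ CleanNoise T n k₀ τ e A} := by
  rw [setOf_not_cleanNoise]
  refine Finset.measurableSet_biUnion _ fun k _ => Finset.measurableSet_biUnion _ fun a _ => ?_
  exact measurableSet_lt measurable_const (measurable_noisePart _ _ _ _).abs

theorem measure_not_cleanNoise_le {T : Tuning} {Kmin Δ : ℝ}
    (hK : KernelAssumptions T.K T.Kmax Kmin Δ T.LK) (hσ : 0 < T.σ) {τ : ℝ} (hτ : 0 ≤ τ)
    {n k₀ : ℕ} (hk : 2 * 4 ^ (k₀ - 1) ≤ n) {A : List ℕ} (hA : ∀ a ∈ A, a ∈ Finset.Icc 1 n) :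
    noiseLaw T.σ {e | ¬ CleanNoise T n k₀ τ e A} ≤ ENNReal.ofReal (k₀ * (A.length
      * (2 * (n : ℝ) ^ (-(τ ^ 2 / (2 * (T.σ ^ 2 * (T.Kmax / massConst Kmin Δ)))))))) := by
  set r : ℝ := 2 * (n : ℝ) ^ (-(τ ^ 2 / (2 * (T.σ ^ 2 * (T.Kmax / massConst Kmin Δ))))) with hr
  have hr0 : 0 ≤ r := by positivity
  clear_value r
  rw [setOf_not_cleanNoise]
  calc _ ≤ ∑ k ∈ Finset.Icc 1 k₀, ∑ a ∈ A.toFinset, ENNReal.ofReal r := by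
        refine (measure_biUnion_finset_le _ _).trans (Finset.sum_le_sum fun k hk' => ?_)
        refine (measure_biUnion_finset_le _ _).trans (Finset.sum_le_sum fun a ha => ?_)
        rw [hr]
        refine measure_noisePart_gt_le_rpow hK hσ hτ (hA a (List.mem_toFinset.1 ha))
          (by positivity) (le_trans ?_ hk)
        have := (Finset.mem_Icc.1 hk').2
        exact Nat.mul_le_mul_left 2 (Nat.pow_le_pow_right (by norm_num) (by omega))
    _ = ENNReal.ofReal (k₀ * (A.toFinset.card * r)) := by
        rw [Finset.sum_const, Finset.sum_const, Nat.card_Icc, Nat.add_sub_cancel, nsmul_eq_mul,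
          nsmul_eq_mul, ENNReal.ofReal_mul (by positivity), ENNReal.ofReal_mul (by positivity),
          ENNReal.ofReal_natCast, ENNReal.ofReal_natCast]
    _ ≤ _ := by
        refine ENNReal.ofReal_le_ofReal ?_
        have : (A.toFinset.card : ℝ) ≤ A.length := by exact_mod_cast A.toFinset_card_le
        gcongr

/-- The errors for which the index sets with exceptionally large stochastic errors make up for
half of the detections from the indices in `G`. -/
def confusingErrors (T : Tuning) (n k₀ : ℕ) (τ : ℝ) (G : Finset ℕ) : Set (ℕ → ℝ) :=
  {e | (G.card : ENNReal) / 16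
    ≤ ∑ i ∈ G, (generator n i).pr {q | ¬ CleanNoise T n k₀ τ e q.val.2}}

theorem measure_confusingErrors_le {T : Tuning} {n k₀ : ℕ} {τ : ℝ} {G : Finset ℕ}
    (hG : G.Nonempty) {δ : ENNReal}
    (hδ : ∀ i ∈ G, (generator n i).Sure fun q =>
      noiseLaw T.σ {e | ¬ CleanNoise T n k₀ τ e q.val.2} ≤ δ) :
    noiseLaw T.σ (confusingErrors T n k₀ τ G) ≤ 16 * δ := by
  have hm : ∀ i, Measurable fun e => (generator n i).pr {q | ¬ CleanNoise T n k₀ τ e q.val.2} :=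
    fun i => measurable_pr (generator n i) (R := fun e s => ¬ CleanNoise T n k₀ τ e s.2)
      fun s => measurableSet_not_cleanNoise T n k₀ τ s.2
  have hint : ∫⁻ e, ∑ i ∈ G, (generator n i).pr {q | ¬ CleanNoise T n k₀ τ e q.val.2}
      ∂(noiseLaw T.σ) ≤ G.card * δ := by
    rw [lintegral_finsetSum _ fun i _ => hm i, ← nsmul_eq_mul]
    refine Finset.sum_le_card_nsmul _ _ _ fun i hi => ?_
    exact lintegral_pr_le (generator n i) (R := fun e s => ¬ CleanNoise T n k₀ τ e s.2)
      (fun s => measurableSet_not_cleanNoise T n k₀ τ s.2) (hδ i hi)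
  have hmarkov := (mul_meas_ge_le_lintegral (μ := noiseLaw T.σ)
    (Finset.measurable_sum G fun i _ => hm i) ((G.card : ENNReal) / 16)).trans
    hint
  have hc : (G.card : ENNReal) ≠ 0 := by
    exact_mod_cast hG.card_pos.ne'
  have hc' : (G.card : ENNReal) ≠ ⊤ := ENNReal.natCast_ne_top _
  have h16 : (G.card : ENNReal) * noiseLaw T.σ (confusingErrors T n k₀ τ G)
      ≤ G.card * (16 * δ) := by
    calc _ = 16 * ((G.card : ENNReal) / 16 * noiseLaw T.σ (confusingErrors T n k₀ τ G)) := by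
          rw [← mul_assoc, ENNReal.mul_div_cancel (by norm_num) (by norm_num)]
      _ ≤ 16 * (G.card * δ) := by
          refine mul_le_mul_right (le_of_eq_of_le ?_ hmarkov) (16 : ENNReal)
          simp only [confusingErrors]
      _ = _ := by ring
  exact (ENNReal.mul_le_mul_iff_right hc hc').1 h16

/-- If clean errors lead from a pair with a drop to a rejection, then a round rejects with a
probability of the order of the fraction of indices with many partners. -/
theorem pr_round_not_reject_le {T : Tuning} {α : ℝ} {n k₀ : ℕ} {τ θ ε : ℝ} {f : ℝ → ℝ} (hn : 2 ≤ n)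
    (hε : ε ≤ (dropIndices f n θ).card / n) {e : ℕ → ℝ}
    (he : e ∉ confusingErrors T n k₀ τ (dropIndices f n θ))
    (hdet : ∀ s : List (ℕ × ℕ) × List ℕ, ValidIndices n s → CleanNoise T n k₀ τ e s.2 →
      (∃ p ∈ s.1, Drop f n θ p) → (roundProg T α n (obs f n e) s).val = true) :
    (randomIndices n).pr {q | (roundProg T α n (obs f n e) q.val).val ≠ true}
      ≤ 1 - ENNReal.ofReal (ε / 16) := by
  set G := dropIndices f n θ with hG
  set rej : ℕ → ENNReal := fun i =>
    (generator n i).pr {q | (roundProg T α n (obs f n e) q.val).val = true}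
  set bad : ℕ → ENNReal := fun i => (generator n i).pr {q | ¬ CleanNoise T n k₀ τ e q.val.2}
  have hn0 : (n : ENNReal) ≠ 0 := by exact_mod_cast (by omega : n ≠ 0)
  have hone : ∀ i ∈ G, (8 : ENNReal)⁻¹ ≤ rej i + bad i := by
    intro i hi
    obtain ⟨hi1, hi2⟩ := mem_dropIndices.1 hi
    refine (le_pr_generator_good hn (Finset.mem_Icc.1 hi1).2 (Drop f n θ) hi2).trans ?_
    refine le_trans (Prog.pr_le_of_sure
      (S' := {q | (roundProg T α n (obs f n e) q.val).val = true}
        ∪ {q | ¬ CleanNoise T n k₀ τ e q.val.2}) ?_) (Prog.pr_union_le _ _ _)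
    refine (sure_generator_bounds hi1).mono fun q hq hex => ?_
    by_cases hc : CleanNoise T n k₀ τ e q.val.2
    · exact Or.inl (hdet q.val hq.1 hc hex)
    · exact Or.inr hc
  have hsum : (G.card : ENNReal) / 16 ≤ ∑ i ∈ G, rej i := by
    have h1 : (G.card : ENNReal) * 8⁻¹ ≤ ∑ i ∈ G, rej i + ∑ i ∈ G, bad i := by
      rw [← nsmul_eq_mul, ← Finset.sum_add_distrib]
      exact Finset.card_nsmul_le_sum _ _ _ hone
    have h2 : ∑ i ∈ G, bad i < (G.card : ENNReal) / 16 := not_le.1 he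
    have h3 : (G.card : ENNReal) * 8⁻¹ = (G.card : ENNReal) / 16 + (G.card : ENNReal) / 16 := by
      rw [div_eq_mul_inv, ← mul_add, ← two_mul, show (16 : ENNReal) = 2 * 8 by norm_num,
        ENNReal.mul_inv (by norm_num) (by norm_num), ← mul_assoc 2,
        ENNReal.mul_inv_cancel (by norm_num) (by norm_num), one_mul]
    rw [h3] at h1
    have h4 : (G.card : ENNReal) / 16 ≠ ⊤ :=
      ENNReal.div_ne_top (ENNReal.natCast_ne_top _) (by norm_num)
    exact (ENNReal.add_le_add_iff_right h4).1 (h1.trans (by gcongr))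
  have hrej : ENNReal.ofReal (ε / 16) ≤ (randomIndices n).pr
      {q | (roundProg T α n (obs f n e) q.val).val = true} := by
    rw [pr_randomIndices (by omega) fun s => (roundProg T α n (obs f n e) s).val = true]
    calc ENNReal.ofReal (ε / 16) ≤ ENNReal.ofReal (G.card / 16 / n) := by
          refine ENNReal.ofReal_le_ofReal ?_
          calc ε / 16 ≤ (G.card / n : ℝ) / 16 := by gcongr
            _ = _ := by ring
      _ = (G.card : ENNReal) / 16 / n := by
          rw [ENNReal.ofReal_div_of_pos (by exact_mod_cast (by omega : 0 < n)),
            ENNReal.ofReal_div_of_pos (by norm_num), ENNReal.ofReal_natCast,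
            ENNReal.ofReal_natCast, ENNReal.ofReal_ofNat]
      _ ≤ (∑ i ∈ G, rej i) / n := by gcongr
      _ ≤ _ := by
          refine ENNReal.div_le_div_right (Finset.sum_le_sum_of_subset ?_) _
          exact fun i hi => (mem_dropIndices.1 hi).1
  have hcompl := Prog.pr_compl (randomIndices n)
    {q | (roundProg T α n (obs f n e) q.val).val = true}
  refine ENNReal.le_sub_of_add_le_right ENNReal.ofReal_ne_top ?_
  rw [← hcompl, add_comm]
  exact add_le_add_left hrej _

/-! ### Self-similarity stops the bandwidth selection early -/

theorem exists_biasMax_eq (T : Tuning) (n : ℕ) (f : ℝ → ℝ) {A : Finset ℕ}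
    (hA : A.Nonempty) (h : ℝ) :
    ∃ a ∈ A, biasMax T n f A h
      = |f (a / n) - ∫ e, lpe T.K n h (obs f n e) (a / n) ∂(noiseLaw T.σ)| := by
  have hmem := ((Finset.coe_nonempty.2 hA).image (fun i : ℕ =>
    |f (i / n) - ∫ e, lpe T.K n h (obs f n e) (i / n) ∂(noiseLaw T.σ)|)).csSup_mem
      (A.finite_toSet.image _)
  obtain ⟨a, ha, hval⟩ := hmem
  exact ⟨a, ha, hval.symm⟩

/-- If the bias is of the order of its upper bound, then at a level whose bandwidth is a large
multiple of `optBw β n` it is visible in the comparison with the optimal level. -/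
theorem violation_of_selfSimilar {T : Tuning} {Kmin Δ L : ℝ}
    (hK : KernelAssumptions T.K T.Kmax Kmin Δ T.LK)
    (hκ : 0 < T.κ) (hC : 0 < T.Crho) {β : ℝ} (hβ : 0 < β) (hβ2 : β ≤ 2) (hL : 0 < L)
    {f : ℝ → ℝ} (hf : f ∈ Holder β L) {n : ℕ} (hn : 3 ≤ n) {k₀ m₀ : ℕ} (hk0 : 1 ≤ k₀)
    (hkm : k₀ ≤ m₀)
    (hk1 : (4 : ℝ) ^ (k₀ - 1) ≤ bwRatio T Kmin Δ L * (n * optBw β n))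
    (hk2 : bwRatio T Kmin Δ L * (n * optBw β n) < 4 * 4 ^ (k₀ - 1))
    {R τ c₀ c₁ : ℝ} (hτ : 0 ≤ τ) (hc₀ : 0 < c₀) (hR1 : 1 ≤ R)
    (hR : (5 * (T.κ * T.Crho) + τ) * (2 / √(bwRatio T Kmin Δ L)) + τ < c₀ * R ^ β)
    (hm : R * (n * optBw β n) ≤ 4 ^ (m₀ - 1)) (hhalf : bw n m₀ ≤ 1 / 2)
    {A : List ℕ} (hA : ∀ a ∈ A, a ∈ Finset.Icc 1 n) (hne : A.toFinset.Nonempty)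
    (hself : SelfSimilarOn T β c₀ c₁ n f A.toFinset) {e : ℕ → ℝ}
    (he : CleanNoise T n m₀ τ e (List.range' 1 n)) : Violation T n (obs f n e) A k₀ m₀ := by
  set q := bwRatio T Kmin Δ L with hq
  have hq0 : 0 < q := bwRatio_pos hκ hC hL
  have hn0 : (0 : ℝ) < n := by exact_mod_cast (by omega : 0 < n)
  have hs := optBw_pos hn β
  have hG0 := G2_nonneg T n k₀
  rw [violation_iff (by positivity)]
  have hbw : R * optBw β n ≤ bw n m₀ := by
    rw [bw, le_div_iff₀ hn0]; linarith
  obtain ⟨a, ha, hbias⟩ := exists_biasMax_eq T n f hne (bw n m₀)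
  rw [List.mem_toFinset] at ha
  have ha' := hA a ha
  have har : a ∈ (List.range' 1 n).toFinset := by
    rw [List.mem_toFinset, List.mem_range'_1]
    rw [Finset.mem_Icc] at ha'
    omega
  refine ⟨a, ha, ?_⟩
  have hlow := (hself (bw n m₀) (le_trans (le_mul_of_one_le_left hs.le hR1) hbw) hhalf).1
  rw [hbias, integral_lpe hK m₀ f T.σ ha'] at hlow
  -- the stochastic error and the error at the optimal level
  have hval := lpeProg_obs hK m₀ f e ha'
  have hn1 := he m₀ (Finset.mem_Icc.2 ⟨hk0.trans hkm, le_rfl⟩) a har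
  have hn2 := he k₀ (Finset.mem_Icc.2 ⟨hk0, hkm⟩) a har
  have herr := abs_lpeProg_sub_le hK hκ hC hβ hβ2 hL hf hn hk1 (e := e) ha'
  have hsq1 : √(Real.log n / (4 ^ (m₀ - 1) : ℕ)) ≤ optBw β n ^ β := by
    rw [← sqrt_log_div_optBw hn hβ]
    have hlog := one_lt_log hn
    have hle : n * optBw β n ≤ 4 ^ (m₀ - 1) :=
      le_trans (le_mul_of_one_le_left (by positivity) hR1) hm
    refine Real.sqrt_le_sqrt ?_
    push_cast
    gcongr
  have hsq2 : √(Real.log n / (4 ^ (k₀ - 1) : ℕ)) ≤ 2 / √q * optBw β n ^ β := by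
    push_cast
    exact sqrt_optLevel_le hq0 hβ hn hk2.le
  have hG := G2_optLevel_le hq0 hβ hn hk2
  set Λ := optBw β n ^ β with hΛ
  have hΛ0 : 0 < Λ := by positivity
  have hpow : c₀ * R ^ β * Λ ≤ c₀ * bw n m₀ ^ β := by
    rw [mul_assoc, hΛ, ← Real.mul_rpow (by linarith) hs.le]
    gcongr
  have b1 : |noisePart T.K n (4 ^ (m₀ - 1)) a e| ≤ τ * Λ := hn1.trans (by gcongr)
  have b2 : |noisePart T.K n (4 ^ (k₀ - 1)) a e| ≤ τ * (2 / √q * Λ) := hn2.trans (by gcongr)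
  have b3 : T.κ * T.G2 n k₀ ≤ T.κ * (T.Crho * (2 / √q * Λ)) := by gcongr
  have b4 := mul_lt_mul_of_pos_right hR hΛ0
  have e1 : ((5 * (T.κ * T.Crho) + τ) * (2 / √q) + τ) * Λ
      = 5 * (T.κ * (T.Crho * (2 / √q * Λ))) + τ * (2 / √q * Λ) + τ * Λ := by ring
  rw [e1] at b4
  set S := ∑ k ∈ Finset.Icc 1 n, lpeWeight T.K n (4 ^ (m₀ - 1)) a k * f (k / n)
  have tri : |f (a / n) - S| ≤ |(lpeProg T.K n k₀ (obs f n e) a).val - f (a / n)|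
      + |(lpeProg T.K n k₀ (obs f n e) a).val - (lpeProg T.K n m₀ (obs f n e) a).val|
      + |noisePart T.K n (4 ^ (m₀ - 1)) a e| := by
    rw [hval]
    generalize (lpeProg T.K n k₀ (obs f n e) a).val = x
    generalize noisePart T.K n (4 ^ (m₀ - 1)) a e = y
    calc |f (a / n) - S| = |-(x - f (a / n)) + (x - (S + y)) + y| := by congr 1; ring
      _ ≤ |-(x - f (a / n)) + (x - (S + y))| + |y| := abs_add_le _ _
      _ ≤ |-(x - f (a / n))| + |x - (S + y)| + |y| := by gcongr; exact abs_add_le _ _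
      _ = _ := by rw [abs_neg]
  linarith

theorem calm_lt_of_violation {T : Tuning} {n : ℕ} {Y : ℕ → ℝ} {A : List ℕ} {k m : ℕ} (hk : 1 ≤ k)
    (hkm : k < m) (hv : Violation T n Y A k m) : (calm T n Y A).val.1 < m := by
  obtain ⟨m', -, hm, -, hno, -⟩ := calm_spec T n Y A
  rw [hm]
  by_contra hle
  exact hno m (not_lt.1 hle) k hk hkm hv

theorem calm_le_numBw (T : Tuning) (n : ℕ) (Y : ℕ → ℝ) (A : List ℕ) :
    (calm T n Y A).val.1 ≤ numBw n := by
  obtain ⟨m', h, hm, -⟩ := calm_spec T n Y A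
  exact hm ▸ h

/-- The index set has at least `(log n)²` elements with probability at least `1 - 1 / n`. -/
theorem pr_randomIndices_card_lt_le {n : ℕ} (hn : 4 ≤ n)
    (hbig : 16 * (Real.log n ^ 2 + 1) * √n ≤ n) :
    (randomIndices n).pr {q | (q.val.2.toFinset.card : ℝ) < Real.log n ^ 2} ≤ (n : ENNReal)⁻¹ := by
  set D := ⌈Real.log n ^ 2⌉₊ with hDdef
  have hn0 : (0 : ℝ) < n := by exact_mod_cast (by omega : 0 < n)
  have hlog := one_lt_log (by omega : 3 ≤ n)
  have hDle : (D : ℝ) ≤ Real.log n ^ 2 + 1 := (Nat.ceil_lt_add_one (by positivity)).le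
  have hD1 : 1 ≤ D := Nat.one_le_ceil_iff.2 (by positivity)
  have hsq2 : 2 ≤ √(n : ℝ) := by
    refine Real.le_sqrt_of_sq_le ?_
    have : (4 : ℝ) ≤ n := by exact_mod_cast hn
    linarith
  have hDn : 8 * D + 3 ≤ n := by
    have h1 : (1 : ℝ) ≤ D := by exact_mod_cast hD1
    have : ((8 * D + 3 : ℕ) : ℝ) ≤ n := by
      push_cast
      nlinarith
    exact_mod_cast this
  rw [pr_randomIndices (by omega) fun s => (s.2.toFinset.card : ℝ) < Real.log n ^ 2]
  have hone : ∀ i ∈ Finset.Icc 1 n, (generator n i).pr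
      {q | (q.val.2.toFinset.card : ℝ) < Real.log n ^ 2} ≤ (n : ENNReal)⁻¹ := by
    intro i hi
    obtain ⟨r, hr, hpr⟩ := pr_generator_card_lt_le hi hDn
    refine (Prog.pr_mono fun q hq => Nat.lt_ceil.2 hq).trans (hpr.trans ?_)
    set x := Nat.clog 2 r + 1 - Nat.clog 2 (4 * D) with hx
    set q := ⌈20 * Real.log n⌉₊ * x with hqdef
    -- at least half of the levels allow for `4 D` different draws
    have hx1 : √(n : ℝ) ≤ 2 ^ x := by
      have h1 : r ≤ 2 ^ Nat.clog 2 r := Nat.le_pow_clog (by norm_num) r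
      have h2 : 2 ^ Nat.clog 2 (4 * D) < 2 * (4 * D) := two_pow_clog_lt (by omega)
      have h3 : 2 ^ (Nat.clog 2 r + 1) ≤ 2 ^ x * 2 ^ Nat.clog 2 (4 * D) := by
        rw [← pow_add]
        exact Nat.pow_le_pow_right (by norm_num) (by omega)
      have h4 : n ≤ 2 ^ x * (16 * D) := by
        have h5 : 2 ^ (Nat.clog 2 r + 1) = 2 * 2 ^ Nat.clog 2 r := by ring
        have h6 : 2 ^ x * 2 ^ Nat.clog 2 (4 * D) ≤ 2 ^ x * (8 * D) :=
          Nat.mul_le_mul_left _ (by omega)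
        have h7 : 2 ^ x * (16 * D) = 2 * (2 ^ x * (8 * D)) := by ring
        have h8 : 1 ≤ 2 ^ x * (8 * D) := Nat.one_le_iff_ne_zero.2 (by positivity)
        omega
      have h5 : (n : ℝ) ≤ 2 ^ x * (16 * D) := by exact_mod_cast h4
      have h6 : 16 * (Real.log n ^ 2 + 1) * √n ≤ 16 * (Real.log n ^ 2 + 1) * 2 ^ x := by
        calc _ ≤ (n : ℝ) := hbig
          _ ≤ 2 ^ x * (16 * D) := h5
          _ ≤ 2 ^ x * (16 * (Real.log n ^ 2 + 1)) := by gcongr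
          _ = _ := by ring
      exact le_of_mul_le_mul_left h6 (by positivity)
    have hl2 := Real.log_two_lt_d9
    have hl2' := Real.log_two_gt_d9
    have hx2 : Real.log n / 2 ≤ x * Real.log 2 := by
      have h := Real.log_le_log (by positivity) hx1
      rwa [Real.log_sqrt hn0.le, Real.log_pow] at h
    have hqx : 4 * Real.log n ^ 2 + 2 ≤ q := by
      have h1 : 20 * Real.log n ≤ (⌈20 * Real.log n⌉₊ : ℝ) := Nat.le_ceil _
      have hx3 : Real.log n / 2 ≤ x := by
        have : 0 ≤ (x : ℝ) := by positivity
        nlinarith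
      have h2 : 20 * Real.log n * (Real.log n / 2) ≤ (⌈20 * Real.log n⌉₊ : ℝ) * x := by gcongr
      rw [hqdef]
      push_cast
      nlinarith
    have hnat : 4 ^ D * n ≤ 2 ^ q := by
      have h : ((4 ^ D * n : ℕ) : ℝ) ≤ (2 ^ q : ℕ) := by
        push_cast
        rw [← Real.log_le_log_iff (by positivity) (by positivity), Real.log_mul (by positivity)
          (by positivity), Real.log_pow, Real.log_pow, show (4 : ℝ) = 2 ^ 2 by norm_num,
          Real.log_pow]
        push_cast
        have h1 : (D : ℝ) * (2 * Real.log 2) ≤ (Real.log n ^ 2 + 1) * (2 * Real.log 2) := by gcongr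
        have h2 : (4 * Real.log n ^ 2 + 2) * Real.log 2 ≤ q * Real.log 2 := by gcongr
        nlinarith
      exact_mod_cast h
    rw [← ENNReal.inv_pow]
    have hn00 : (n : ENNReal) ≠ 0 := by exact_mod_cast (by omega : n ≠ 0)
    rw [ENNReal.le_inv_iff_mul_le]
    calc (4 : ENNReal) ^ D * (2 ^ q)⁻¹ * n = ((4 ^ D * n : ℕ) : ENNReal) * (2 ^ q)⁻¹ := by
          push_cast; ring
      _ ≤ ((2 ^ q : ℕ) : ENNReal) * (2 ^ q)⁻¹ := by gcongr
      _ = 1 := by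
          push_cast
          exact ENNReal.mul_inv_cancel (by positivity) (by simp)
  calc _ ≤ (∑ i ∈ Finset.Icc 1 n, (n : ENNReal)⁻¹) / n := by
        refine ENNReal.div_le_div_right (Finset.sum_le_sum fun i hi => ?_) _
        exact hone i hi
    _ = (n : ENNReal)⁻¹ := by
        have hn00 : (n : ENNReal) ≠ 0 := by exact_mod_cast (by omega : n ≠ 0)
        rw [Finset.sum_const, Nat.card_Icc, Nat.add_sub_cancel, nsmul_eq_mul,
          ENNReal.mul_inv_cancel hn00 (ENNReal.natCast_ne_top n), one_div]

/-! ### Orders of magnitude -/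

theorem eventually_log_pow_le (k : ℕ) {r c : ℝ} (hr : 0 < r) (hc : 0 < c) :
    ∀ᶠ n : ℕ in atTop, Real.log n ^ k ≤ c * (n : ℝ) ^ r := by
  have h := ((isLittleO_log_rpow_rpow_atTop (k : ℝ) hr).comp_tendsto
    tendsto_natCast_atTop_atTop).bound hc
  filter_upwards [h] with n hn
  simp only [Function.comp, Real.rpow_natCast, Real.norm_eq_abs] at hn
  exact (le_abs_self _).trans (hn.trans_eq (by rw [abs_of_nonneg (by positivity)]))

theorem eventually_le_log (c : ℝ) : ∀ᶠ n : ℕ in atTop, c ≤ Real.log n :=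
  (Real.tendsto_log_atTop.comp tendsto_natCast_atTop_atTop).eventually_ge_atTop c

theorem rpow_le_mul_optBw {n : ℕ} (hn : 3 ≤ n) {β : ℝ} (hβ : 0 < β) :
    (n : ℝ) ^ (1 - 1 / (2 * β + 1)) ≤ n * optBw β n := by
  have hn0 : (0 : ℝ) < n := by exact_mod_cast (by omega : 0 < n)
  have hlog := one_lt_log hn
  rw [Real.rpow_sub hn0, Real.rpow_one, optBw, Real.div_rpow (by linarith) hn0.le,
    mul_div_assoc']
  gcongr
  exact le_mul_of_one_le_right hn0.le (Real.one_le_rpow hlog.le (by positivity))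

theorem eventually_log_pow_le_mul_optBw {β : ℝ} (hβ : 0 < β) (k : ℕ) {c : ℝ} (hc : 0 < c) :
    ∀ᶠ n : ℕ in atTop, Real.log n ^ k ≤ c * (n * optBw β n) := by
  have hpos : 0 < 1 - 1 / (2 * β + 1) := by
    rw [sub_pos, div_lt_one (by positivity)]; linarith
  filter_upwards [eventually_log_pow_le k hpos hc, eventually_ge_atTop 3] with n h hn
  exact h.trans (mul_le_mul_of_nonneg_left (rpow_le_mul_optBw hn hβ) hc.le)

theorem eventually_optBw_le {β : ℝ} (hβ : 0 < β) {c : ℝ} (hc : 0 < c) :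
    ∀ᶠ n : ℕ in atTop, optBw β n ≤ c := by
  filter_upwards [eventually_log_pow_le 1 zero_lt_one (Real.rpow_pos_of_pos hc (2 * β + 1)),
    eventually_ge_atTop 3] with n h hn
  have hn0 : (0 : ℝ) < n := by exact_mod_cast (by omega : 0 < n)
  rw [pow_one, Real.rpow_one, ← div_le_iff₀ hn0] at h
  refine (Real.rpow_le_rpow (log_div_pos hn).le h (by positivity)).trans_eq ?_
  rw [← Real.rpow_mul hc.le, mul_one_div_cancel (by positivity), Real.rpow_one]

theorem log_half_neg {α : ℝ} (h0 : 0 < α) (h1 : α < 1) : 1 / 2 < -Real.log (α / 2) := by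
  have h : Real.log (α / 2) ≤ -Real.log 2 := by
    rw [← Real.log_inv]
    refine Real.log_le_log (by linarith) ?_
    rw [div_le_iff₀ (by norm_num)]
    norm_num
    linarith
  linarith [Real.log_two_gt_d9]

theorem eventually_log_critVal_le {α : ℝ} (h0 : 0 < α) (h1 : α < 1) :
    ∀ᶠ n : ℕ in atTop, -2 * Real.log (α / Tuning.Nmax α n) ≤ 6 * Real.log n := by
  have hl := log_half_neg h0 h1
  have hl2 := Real.log_two_gt_d9
  set c : ℝ := 40 / Real.log 2 * (-Real.log (α / 2)) with hc
  have hc0 : 0 < c := by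
    have : 0 < -Real.log (α / 2) := by linarith
    have : 0 < Real.log 2 := by linarith
    positivity
  filter_upwards [eventually_log_pow_le 1 (zero_lt_two (α := ℝ)) (div_pos h0 hc0),
    eventually_ge_atTop 3] with n h hn
  have hn0 : (0 : ℝ) < n := by exact_mod_cast (by omega : 0 < n)
  have hlog := one_lt_log hn
  have hN : Tuning.Nmax α n = c * n * Real.log n := by
    rw [Tuning.Nmax, numRounds, hc]
    field_simp
  have hNpos : 0 < Tuning.Nmax α n := by rw [hN]; positivity
  have hle : Tuning.Nmax α n / α ≤ (n : ℝ) ^ 3 := by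
    rw [hN, div_le_iff₀ h0]
    rw [pow_one, Real.rpow_two, div_mul_eq_mul_div, le_div_iff₀ hc0] at h
    calc c * n * Real.log n = (Real.log n * c) * n := by ring
      _ ≤ (α * n ^ 2) * n := by gcongr
      _ = _ := by ring
  have h3 := Real.log_le_log (by positivity) hle
  rw [Real.log_pow, Real.log_div hNpos.ne' h0.ne'] at h3
  rw [Real.log_div h0.ne' hNpos.ne']
  push_cast at h3
  linarith

theorem eventually_one_le_numRounds {α : ℝ} (h0 : 0 < α) (h1 : α < 1) :
    ∀ᶠ n : ℕ in atTop, 1 ≤ numRounds α n := by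
  filter_upwards [eventually_log_pow_le 1 zero_lt_one (by norm_num : (0 : ℝ) < 1 / 2),
    eventually_ge_atTop 3] with n h hn
  have hlog := one_lt_log hn
  have hl := log_half_neg h0 h1
  rw [pow_one, Real.rpow_one] at h
  have h2 : 2 ≤ (n : ℝ) / Real.log n := by
    rw [le_div_iff₀ (by linarith)]; linarith
  unfold numRounds
  nlinarith

/-- The number of rounds is of smaller order than `n`. -/
theorem eventually_rounds_mul_le {α : ℝ} (h0 : 0 < α) (h1 : α < 1) :
    ∀ᶠ n : ℕ in atTop, (⌊numRounds α n⌋₊ : ENNReal) * (2 * (n : ENNReal)⁻¹)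
      ≤ ENNReal.ofReal (α / 4) := by
  filter_upwards [eventually_one_le_numRounds h0 h1,
    eventually_le_log (8 * (-Real.log (α / 2)) / α), eventually_ge_atTop 3] with n hr h hn
  have hn0 : (0 : ℝ) < n := by exact_mod_cast (by omega : 0 < n)
  have hlog := one_lt_log hn
  have he : (⌊numRounds α n⌋₊ : ENNReal) * (2 * (n : ENNReal)⁻¹)
      = ENNReal.ofReal (⌊numRounds α n⌋₊ * (2 * (n : ℝ)⁻¹)) := by
    rw [ENNReal.ofReal_mul (by positivity), ENNReal.ofReal_mul (by norm_num),
      ENNReal.ofReal_inv_of_pos hn0, ENNReal.ofReal_natCast, ENNReal.ofReal_natCast,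
      ENNReal.ofReal_ofNat]
  rw [he]
  refine ENNReal.ofReal_le_ofReal ?_
  calc ⌊numRounds α n⌋₊ * (2 * (n : ℝ)⁻¹) ≤ numRounds α n * (2 * (n : ℝ)⁻¹) := by
        gcongr
        exact Nat.floor_le (by linarith)
    _ = 2 * (-Real.log (α / 2)) / Real.log n := by
        unfold numRounds
        field_simp
    _ ≤ α / 4 := by
        rw [div_le_iff₀ h0] at h
        rw [div_le_iff₀ (by linarith)]
        linarith

theorem levelBound_le {n : ℕ} (hn : 3 ≤ n) : (levelBound n : ℝ) ≤ 84 * Real.log n ^ 2 := by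
  have hn0 : (0 : ℝ) < n := by exact_mod_cast (by omega : 0 < n)
  have hlog := one_lt_log hn
  have h1 : (⌈20 * Real.log n⌉₊ : ℝ) ≤ 21 * Real.log n := by
    have := (Nat.ceil_lt_add_one (a := 20 * Real.log n) (by positivity)).le
    linarith
  have h2 : (Nat.clog 2 n : ℝ) + 1 ≤ 4 * Real.log n := by
    have h3 : ((2 ^ Nat.clog 2 n : ℕ) : ℝ) ≤ ((2 * n : ℕ) : ℝ) := by
      exact_mod_cast (two_pow_clog_lt (by omega : 1 ≤ n)).le
    push_cast at h3
    have h4 := Real.log_le_log (by positivity) h3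
    rw [Real.log_pow, Real.log_mul (by norm_num) hn0.ne'] at h4
    have h5 := Real.log_two_gt_d9
    have h6 := Real.log_two_lt_d9
    have h7 : (0 : ℝ) ≤ Nat.clog 2 n := by positivity
    nlinarith
  rw [levelBound]
  push_cast
  calc (⌈20 * Real.log n⌉₊ : ℝ) * (Nat.clog 2 n + 1)
      ≤ 21 * Real.log n * (4 * Real.log n) := by gcongr
    _ = _ := by ring

theorem roundCost_le {n x : ℕ} (hn : 3 ≤ n) {X : ℝ} (hx : (x : ℝ) ≤ X)
    (hX : Real.log n ^ 2 ≤ X) : (roundCost n x : ℝ) ≤ 170000 * (Real.log n ^ 2 * X) := by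
  have hlog := one_lt_log hn
  have hb := levelBound_le hn
  set l := Real.log n ^ 2 with hl
  have hl1 : 1 ≤ l := one_le_pow₀ hlog.le
  have h0 : (0 : ℝ) ≤ levelBound n := by positivity
  rw [roundCost]
  push_cast
  calc 20 * (levelBound n : ℝ) ^ 2 + 94 * levelBound n + 8 + 162 * (levelBound n + 1) * x
      ≤ 20 * (84 * l) ^ 2 + 94 * (84 * l) + 8 + 162 * (84 * l + l) * X := by gcongr
    _ ≤ 20 * 84 ^ 2 * (l * X) + 94 * 84 * (l * X) + 8 * (l * X) + 162 * 85 * (l * X) := by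
        have h1 : l * l ≤ l * X := by gcongr
        have h2 : l ≤ l * X := le_mul_of_one_le_right (by linarith) (hl1.trans hX)
        nlinarith
    _ ≤ 170000 * (l * X) := by
        have h2 : 0 ≤ l * X := by nlinarith
        nlinarith

theorem level_le_log {n k : ℕ} (hk : 2 * 4 ^ (k - 1) ≤ n) :
    (k : ℝ) ≤ 1 + Real.log n := by
  rcases Nat.eq_zero_or_pos k with rfl | hk0
  · have := Real.log_natCast_nonneg n
    push_cast; linarith
  have h1 : ((4 ^ (k - 1) : ℕ) : ℝ) ≤ n := by exact_mod_cast (by omega : 4 ^ (k - 1) ≤ n)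
  push_cast at h1
  have h2 := Real.log_le_log (by positivity) h1
  rw [Real.log_pow, Nat.cast_sub hk0] at h2
  have h3 : 1 ≤ Real.log 4 := by
    rw [show (4 : ℝ) = 2 ^ 2 by norm_num, Real.log_pow]
    push_cast
    linarith [Real.log_two_gt_d9]
  have h4 : (1 : ℝ) ≤ k := by exact_mod_cast hk0
  push_cast at h2
  nlinarith

theorem log_sq_mul_maxWindow {n : ℕ} (hn : 3 ≤ n) :
    Real.log n ^ 2 * maxWindow n = (n : ℝ) ^ (4 / 5 : ℝ) * Real.log n ^ (11 / 5 : ℝ) := by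
  have hlog := one_lt_log hn
  rw [maxWindow, ← Real.rpow_natCast, mul_left_comm, ← Real.rpow_add (by linarith)]
  norm_num

theorem log_sq_mul_optBw {n : ℕ} (hn : 3 ≤ n) {β : ℝ} (hβ : 0 < β) :
    Real.log n ^ 2 * (n * optBw β n) = (n : ℝ) ^ (2 * β / (2 * β + 1))
      * Real.log n ^ ((4 * β + 3) / (2 * β + 1)) := by
  have hlog := one_lt_log hn
  have hn0 : (0 : ℝ) < n := by exact_mod_cast (by omega : 0 < n)
  have h1 : 2 * β / (2 * β + 1) = 1 - 1 / (2 * β + 1) := by field_simp; ring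
  have h2 : (4 * β + 3) / (2 * β + 1) = (2 : ℕ) + 1 / (2 * β + 1) := by
    push_cast; field_simp; ring
  rw [h1, h2, Real.rpow_sub hn0, Real.rpow_one, Real.rpow_add (by linarith), Real.rpow_natCast,
    optBw, Real.div_rpow (by linarith) hn0.le]
  ring

theorem numRounds_mul {n : ℕ} (hn : 3 ≤ n) (α : ℝ) :
    numRounds α n * (n : ℝ) ^ (4 / 5 : ℝ) * Real.log n ^ (11 / 5 : ℝ)
      = -Real.log (α / 2) * ((n : ℝ) ^ (9 / 5 : ℝ) * Real.log n ^ (6 / 5 : ℝ)) := by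
  have hlog := one_lt_log hn
  have hn0 : (0 : ℝ) < n := by exact_mod_cast (by omega : 0 < n)
  rw [show (9 / 5 : ℝ) = 4 / 5 + 1 by norm_num, show (6 / 5 : ℝ) = 11 / 5 - 1 by norm_num,
    Real.rpow_add_one hn0.ne', Real.rpow_sub_one (by linarith), numRounds]
  ring

theorem eventually_sqrt_le : ∀ᶠ n : ℕ in atTop, 16 * (Real.log n ^ 2 + 1) * √n ≤ n := by
  filter_upwards [eventually_log_pow_le 2 (by norm_num : (0 : ℝ) < 1 / 2)
    (by norm_num : (0 : ℝ) < 1 / 32), eventually_ge_atTop 3] with n h hn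
  have hlog := one_lt_log hn
  rw [← Real.sqrt_eq_rpow] at h
  have h1 : 1 ≤ Real.log n ^ 2 := one_le_pow₀ hlog.le
  have h2 : 16 * (Real.log n ^ 2 + 1) ≤ √n := by linarith
  calc _ ≤ √(n : ℝ) * √n := by gcongr
    _ = n := Real.mul_self_sqrt (by positivity)

/-- Exceptionally large stochastic errors at the optimal level and below are rare on a set of
logarithmic size. -/
theorem eventually_noise_small {v α : ℝ} (hv : 0 < v) (h0 : 0 < α) :
    ∀ᶠ n : ℕ in atTop, ∀ k len : ℕ, (k : ℝ) ≤ 1 + Real.log n → len ≤ 2 * levelBound n + 1 →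
      16 * ENNReal.ofReal (k * (len * (2 * (n : ℝ) ^ (-v)))) ≤ ENNReal.ofReal (α / 2) := by
  filter_upwards [eventually_log_pow_le 3 hv (by positivity : 0 < α / 22000),
    eventually_ge_atTop 3] with n h hn k len hk hlen
  have hlog := one_lt_log hn
  have hn0 : (0 : ℝ) < n := by exact_mod_cast (by omega : 0 < n)
  have hb := levelBound_le hn
  have hlen' : (len : ℝ) ≤ 169 * Real.log n ^ 2 := by
    have : (len : ℝ) ≤ ((2 * levelBound n + 1 : ℕ) : ℝ) := by exact_mod_cast hlen
    push_cast at this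
    have h1 : 1 ≤ Real.log n ^ 2 := one_le_pow₀ hlog.le
    linarith
  rw [← ENNReal.ofReal_ofNat, ← ENNReal.ofReal_mul (by norm_num)]
  refine ENNReal.ofReal_le_ofReal ?_
  rw [Real.rpow_neg hn0.le]
  have hp : 0 < (n : ℝ) ^ v := by positivity
  calc 16 * ((k : ℝ) * (len * (2 * ((n : ℝ) ^ v)⁻¹)))
      ≤ 16 * ((2 * Real.log n) * ((169 * Real.log n ^ 2) * (2 * ((n : ℝ) ^ v)⁻¹))) := by
        gcongr; linarith
    _ = 10816 * Real.log n ^ 3 * ((n : ℝ) ^ v)⁻¹ := by ring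
    _ ≤ 10816 * (α / 22000 * (n : ℝ) ^ v) * ((n : ℝ) ^ v)⁻¹ := by gcongr
    _ = 10816 / 22000 * α := by field_simp
    _ ≤ α / 2 := by linarith

/-- Errors that are larger than their order by a large factor are rare everywhere. -/
theorem eventually_noise_small_all {α : ℝ} (h0 : 0 < α) :
    ∀ᶠ n : ℕ in atTop, ∀ k : ℕ, (k : ℝ) ≤ 1 + Real.log n →
      ENNReal.ofReal (k * (n * (2 * (n : ℝ) ^ (-2 : ℝ)))) ≤ ENNReal.ofReal (α / 4) := by
  filter_upwards [eventually_log_pow_le 1 zero_lt_one (by positivity : 0 < α / 16),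
    eventually_ge_atTop 3] with n h hn k hk
  have hlog := one_lt_log hn
  have hn0 : (0 : ℝ) < n := by exact_mod_cast (by omega : 0 < n)
  refine ENNReal.ofReal_le_ofReal ?_
  rw [pow_one, Real.rpow_one] at h
  rw [Real.rpow_neg hn0.le, Real.rpow_two]
  calc (k : ℝ) * (n * (2 * ((n : ℝ) ^ 2)⁻¹)) ≤ 2 * Real.log n * (n * (2 * ((n : ℝ) ^ 2)⁻¹)) := by
        gcongr; linarith
    _ ≤ 2 * (α / 16 * n) * (n * (2 * ((n : ℝ) ^ 2)⁻¹)) := by gcongr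
    _ = α / 4 := by field_simp; norm_num

/-! ### Complexity of the test -/

section
variable {T : Tuning} {Kmin Δ : ℝ} {β L : ℝ}

/-- A drop by this multiple of the rate is detected by a local test with clean errors. -/
noncomputable def dropConst (T : Tuning) (Kmin Δ L : ℝ) : ℝ :=
  (12 * T.κ * T.Crho + T.σ * √(6 * T.W)) * (2 / √(bwRatio T Kmin Δ L))

/-- The constant in the level `γ` of the exceedance fraction. For `β ≤ 1` the level has to exceed the
detectable drop by the oscillation of `f` between design points, for `β > 1` the change of the
derivative over the distance `optBw β n` must not use up the slope. -/
noncomputable def gammaConst (T : Tuning) (Kmin Δ L : ℝ) : ℝ := 8 * dropConst T Kmin Δ L + 4 * L + 1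

theorem dropConst_pos (hσ : 0 < T.σ) (hκ : 0 < T.κ) (hC : 0 < T.Crho) (hL : 0 < L) :
    0 < dropConst T Kmin Δ L := by
  have := bwRatio_pos (Kmin := Kmin) (Δ := Δ) hκ hC hL
  unfold dropConst
  positivity

theorem roundProg_eq_true (hK : KernelAssumptions T.K T.Kmax Kmin Δ T.LK) (hσ : 0 < T.σ)
    (hκ : 0 < T.κ) (hC : 0 < T.Crho) (hβ : 0 < β) (hβ2 : β ≤ 2) (hL : 0 < L) {f : ℝ → ℝ}
    (hf : f ∈ Holder β L) {n : ℕ} (hn : 3 ≤ n) {α : ℝ}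
    (hα : -2 * Real.log (α / Tuning.Nmax α n) ≤ 6 * Real.log n) {k₀ : ℕ}
    (hk₀ : 1 ≤ k₀) (hk₁ : k₀ ≤ numBw n)
    (hk2 : (4 : ℝ) ^ (k₀ - 1) ≤ bwRatio T Kmin Δ L * (n * optBw β n))
    (hk3 : bwRatio T Kmin Δ L * (n * optBw β n) < 4 * 4 ^ (k₀ - 1))
    {e : ℕ → ℝ} {s : List (ℕ × ℕ) × List ℕ} (hs : ValidIndices n s)
    (he : CleanNoise T n k₀ (T.κ * T.Crho) e s.2)
    (hex : ∃ p ∈ s.1, Drop f n (dropConst T Kmin Δ L * optBw β n ^ β) p) :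
    (roundProg T α n (obs f n e) s).val = true := by
  have hq := bwRatio_pos (Kmin := Kmin) (Δ := Δ) hκ hC hL
  refine testProg_calm hκ.le (by omega) hs hk₀ hk₁ (fun k hk hk' a ha => ?_)
    (fun i j h hh => critVal_le hσ hq hβ hn hα hk3 i j hh) ?_ hex
  · have hle : (4 : ℝ) ^ (k - 1) ≤ bwRatio T Kmin Δ L * (n * optBw β n) :=
      (pow_le_pow_right₀ (by norm_num) (by omega)).trans hk2
    refine (abs_lpeProg_sub_le hK hκ hC hβ hβ2 hL hf hn hle (hs.2 a ha)).trans ?_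
    have h1 := he k (Finset.mem_Icc.2 ⟨hk, hk'⟩) a (List.mem_toFinset.2 ha)
    rw [← mul_bw (n := n) (by omega) k, mul_assoc] at h1
    rw [Tuning.G2] at *
    linarith
  · have h1 := mul_le_mul_of_nonneg_left (G2_optLevel_le hq hβ hn hk3)
      (by positivity : 0 ≤ 12 * T.κ)
    refine (add_le_add_left h1 _).trans (le_of_eq ?_)
    unfold dropConst
    ring

/-- Outside a small set of errors, each round rejects with a probability of the order of the
exceedance fraction. -/
theorem eventually_detects (hK : KernelAssumptions T.K T.Kmax Kmin Δ T.LK) (hσ : 0 < T.σ)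
    (hκ : 0 < T.κ) (hC : 0 < T.Crho) (hβ : 0 < β) (hβ2 : β ≤ 2) (hL : 0 < L)
    {α : ℝ} (h0 : 0 < α) (h1 : α < 1) : ∀ᶠ n : ℕ in atTop, ∀ C ≥ 4 * gammaConst T Kmin Δ L,
      ∀ f ∈ Alternative β L (C * sepRate β n), ∃ ε,
        ε = exceedance (⌈β⌉₊ - 1) (gammaConst T Kmin Δ L * sepRate β n) f ∧ 0 < ε ∧ ε ≤ 1 ∧
        ∃ Bad, noiseLaw T.σ Bad ≤ ENNReal.ofReal (α / 4) ∧ ∀ e ∉ Bad,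
          (randomIndices n).pr {q | (roundProg T α n (obs f n e) q.val).val ≠ true}
            ≤ 1 - ENNReal.ofReal (ε / 16) := by
  have hq := bwRatio_pos (Kmin := Kmin) (Δ := Δ) hκ hC hL
  have hd := dropConst_pos (Kmin := Kmin) (Δ := Δ) hσ hκ hC hL
  have hV : 0 < T.σ ^ 2 * (T.Kmax / massConst Kmin Δ) := by
    have h1 := massConst_pos hK
    have h2 := hK.Kmax_pos
    positivity
  filter_upwards [eventually_ge_atTop 4, eventually_log_critVal_le h0 h1,
    eventually_log_pow_le_mul_optBw hβ 0 hq, eventually_log_pow_le_mul_optBw hβ 0 one_pos,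
    eventually_optBw_le hβ (by norm_num : (0 : ℝ) < 1 / 4),
    eventually_noise_small (v := (T.κ * T.Crho) ^ 2
      / (2 * (T.σ ^ 2 * (T.Kmax / massConst Kmin Δ)))) (by positivity) (half_pos h0)]
    with n hn hcrit hbig hone hsmall hnoise C hCC f hf
  rw [pow_zero] at hbig hone
  rw [one_mul] at hone
  have hn3 : 3 ≤ n := by omega
  have hn0 : (0 : ℝ) < n := by exact_mod_cast (by omega : 0 < n)
  have hs := optBw_pos hn3 β
  set θ := dropConst T Kmin Δ L * optBw β n ^ β with hθ
  have hrate : 0 < sepRate β n := by rw [sepRate_eq hn3]; positivity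
  have hγ0 : 0 < gammaConst T Kmin Δ L := by unfold gammaConst; positivity
  obtain ⟨hpos, hle⟩ := exceedance_bounds (θ := θ) (H := optBw β n)
    (γ := gammaConst T Kmin Δ L * sepRate β n) hβ hβ2 hL hf hn (by positivity) (by positivity)
    (by rw [← mul_assoc]; gcongr) (by rw [div_le_iff₀ hn0]; linarith) hsmall
    (fun hβ1 => by
      rw [sepRate_eq hn3, ceil_eq_one hβ hβ1, hθ, Nat.cast_one, sub_add_cancel, ← add_mul]
      unfold gammaConst
      exact mul_le_mul_of_nonneg_right (by linarith) (by positivity))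
    (fun hβ1 => by
      have e1 : (β - ((2 : ℕ) : ℝ) + 1) = β - 1 := by push_cast; ring
      rw [sepRate_eq hn3, ceil_eq_two hβ1 hβ2, hθ, e1]
      constructor
      · unfold gammaConst
        gcongr
        linarith
      · rw [mul_assoc (gammaConst T Kmin Δ L), ← Real.rpow_add_one hs.ne', sub_add_cancel,
          ← mul_assoc]
        unfold gammaConst
        gcongr
        linarith)
  obtain ⟨k₀, hk₀, hk₁, hk2, hk3⟩ := exists_optLevel (T := T) (Kmin := Kmin) (Δ := Δ) (L := L)
    hβ hβ2 hn3 hbig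
  have h2N := two_mul_pow_le hκ hC hβ hL hn3 hk2
  refine ⟨_, rfl, hpos, hle.trans ?_, confusingErrors T n k₀ (T.κ * T.Crho) (dropIndices f n θ),
    ?_, fun e he => ?_⟩
  · rw [div_le_one hn0]
    have h := Finset.card_le_card (fun i hi => (mem_dropIndices.1 hi).1 :
      dropIndices f n θ ⊆ Finset.Icc 1 n)
    rw [Nat.card_Icc, Nat.add_sub_cancel] at h
    exact_mod_cast h
  · have hne : (dropIndices f n θ).Nonempty := by
      rw [← Finset.card_pos]
      by_contra h
      rw [Nat.eq_zero_of_not_pos h, Nat.cast_zero, zero_div] at hle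
      exact absurd hle (not_le.2 hpos)
    refine (measure_confusingErrors_le hne
      (δ := ENNReal.ofReal (k₀ * (((2 * levelBound n + 1 : ℕ) : ℝ)
      * (2 * (n : ℝ) ^ (-((T.κ * T.Crho) ^ 2
        / (2 * (T.σ ^ 2 * (T.Kmax / massConst Kmin Δ))))))))) fun i hi => ?_).trans ?_
    · refine (sure_generator_bounds (mem_dropIndices.1 hi).1).mono fun r hr => ?_
      refine (measure_not_cleanNoise_le hK hσ (by positivity) h2N hr.1.2).trans ?_
      refine ENNReal.ofReal_le_ofReal ?_
      have : (r.val.2.length : ℝ) ≤ (2 * levelBound n + 1 : ℕ) := by exact_mod_cast hr.2.2.1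
      gcongr
    · refine (hnoise k₀ _ (level_le_log h2N) le_rfl).trans (le_of_eq ?_)
      congr 1; ring
  · exact pr_round_not_reject_le (by omega) hle he fun s hs' hc hex =>
      roundProg_eq_true hK hσ hκ hC hβ hβ2 hL hf.1 hn3 hcrit hk₀ hk₁ hk2 hk3 hs' hc hex

theorem sure_round_cost (T : Tuning) (α : ℝ) {n : ℕ} (hn : 1 ≤ n) (Y : ℕ → ℝ) :
    (randomIndices n).Sure fun q => 1 + (q.steps + (roundProg T α n Y q.val).steps)
      ≤ roundCost n (4 * 4 ^ numBw n) := by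
  refine (sure_randomIndices_bounds hn).mono fun q hq => ?_
  refine roundProg_steps_le T α Y hq.2.1 hq.2.2.1 hq.2.2.2 ?_
  rw [pow_succ']
  exact Nat.mul_le_mul_left _ (Nat.pow_le_pow_right (by norm_num) (calm_le_numBw T n Y _))

theorem eventually_roundCost_le : ∀ᶠ n : ℕ in atTop, (roundCost n (4 * 4 ^ numBw n) : ℝ)
    ≤ 680000 * ((n : ℝ) ^ (4 / 5 : ℝ) * Real.log n ^ (11 / 5 : ℝ)) := by
  filter_upwards [eventually_log_pow_le 2 (by norm_num : (0 : ℝ) < 4 / 5) one_pos,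
    eventually_ge_atTop 3] with n h hn
  have hlog := one_lt_log hn
  have h1 := (le_numBw_iff hn).1 le_rfl
  rw [← log_sq_mul_maxWindow hn]
  refine (roundCost_le hn (X := 4 * maxWindow n) ?_ ?_).trans (le_of_eq (by ring))
  · push_cast
    linarith
  · have h2 : (n : ℝ) ^ (4 / 5 : ℝ) ≤ maxWindow n :=
      le_mul_of_one_le_right (by positivity) (Real.one_le_rpow hlog.le (by norm_num))
    have h3 := maxWindow_pos hn
    linarith

theorem total_le {α ε B X : ℝ} {b : ℕ} (h0 : 0 < α) (h1 : α < 1) (hε : 0 < ε) (hε1 : ε ≤ 1)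
    (hX : 1 ≤ X) (hb : (b : ℝ) ≤ B * X) :
    10 + (16 * Real.log (4 / α) + 1) / ε * b
      ≤ (10 + (16 * Real.log (4 / α) + 1) * B) * (ε⁻¹ * X) := by
  have hlog : 0 ≤ Real.log (4 / α) := Real.log_nonneg (by rw [le_div_iff₀ h0]; linarith)
  have h2 : 1 ≤ ε⁻¹ * X := one_le_mul_of_one_le_of_one_le ((one_le_inv₀ hε).2 hε1) hX
  calc 10 + (16 * Real.log (4 / α) + 1) / ε * b
      ≤ 10 * (ε⁻¹ * X) + (16 * Real.log (4 / α) + 1) / ε * (B * X) := by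
        gcongr
        linarith
    _ = _ := by ring

/-- Every round costs at most what the largest bandwidth costs. -/
theorem eventually_steps (hK : KernelAssumptions T.K T.Kmax Kmin Δ T.LK) (hσ : 0 < T.σ)
    (hκ : 0 < T.κ) (hC : 0 < T.Crho) (hβ : 0 < β) (hβ2 : β ≤ 2) (hL : 0 < L)
    {α : ℝ} (h0 : 0 < α) (h1 : α < 1) : ∀ᶠ n : ℕ in atTop, ∀ C ≥ 4 * gammaConst T Kmin Δ L,
      ∀ f ∈ Alternative β L (C * sepRate β n),
        ENNReal.ofReal (1 - α) ≤ probSteps T α n f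
          ((10 + (16 * Real.log (4 / α) + 1) * 680000)
            * ((exceedance (⌈β⌉₊ - 1) (gammaConst T Kmin Δ L * sepRate β n) f)⁻¹
              * (n : ℝ) ^ (4 / 5 : ℝ) * Real.log n ^ (11 / 5 : ℝ))) := by
  filter_upwards [eventually_detects hK hσ hκ hC hβ hβ2 hL h0 h1, eventually_roundCost_le,
    eventually_ge_atTop 3] with n hdet hcost hn C hCC f hf
  obtain ⟨ε, hεeq, hε, hε1, Bad, hBad, hrej⟩ := hdet C hCC f hf
  have hlog := one_lt_log hn
  have hn1 : (1 : ℝ) ≤ n := by exact_mod_cast (by omega : 1 ≤ n)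
  rw [← hεeq, mul_assoc ε⁻¹]
  refine le_probSteps (B := roundCost n (4 * 4 ^ numBw n)) h0 h1 hε hε1
    (hBad.trans (ENNReal.ofReal_le_ofReal (by linarith))) (η := 0) (fun e _ => le_of_eq ?_)
    (by simp) hrej (total_le h0 h1 hε hε1 ?_ hcost)
  · refine Prog.pr_eq_zero ((sure_round_cost T α (by omega) (obs f n e)).mono fun q hq hlt => ?_)
    exact absurd hlt (not_lt.2 hq)
  · exact one_le_mul_of_one_le_of_one_le (Real.one_le_rpow hn1 (by norm_num))
      (Real.one_le_rpow hlog.le (by norm_num))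

/-- For self-similar functions, bandwidth selection stops near the optimal bandwidth, so that a
round is cheap up to an event of probability `O(1 / n)`. -/
theorem pr_round_cost_le (hK : KernelAssumptions T.K T.Kmax Kmin Δ T.LK)
    (hκ : 0 < T.κ) (hC : 0 < T.Crho) (hβ : 0 < β) (hβ2 : β ≤ 2) (hL : 0 < L) {f : ℝ → ℝ}
    (hf : f ∈ Holder β L) {n : ℕ} (hn : 4 ≤ n) (hsq : 16 * (Real.log n ^ 2 + 1) * √n ≤ n)
    {k₀ m₀ : ℕ} (hk₀ : 1 ≤ k₀)
    (hk2 : (4 : ℝ) ^ (k₀ - 1) ≤ bwRatio T Kmin Δ L * (n * optBw β n))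
    (hk3 : bwRatio T Kmin Δ L * (n * optBw β n) < 4 * 4 ^ (k₀ - 1))
    {R τ c₀ c₁ : ℝ} (hτ : 0 ≤ τ) (hc₀ : 0 < c₀) (hR1 : 1 ≤ R)
    (hR : (5 * (T.κ * T.Crho) + τ) * (2 / √(bwRatio T Kmin Δ L)) + τ < c₀ * R ^ β)
    (hm : R * (n * optBw β n) ≤ 4 ^ (m₀ - 1)) (hhalf : bw n m₀ ≤ 1 / 2)
    (hself : GloballySelfSimilar T β c₀ c₁ n f) {e : ℕ → ℝ}
    (he : CleanNoise T n m₀ τ e (List.range' 1 n)) {α : ℝ} :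
    (randomIndices n).pr {q | roundCost n (4 ^ m₀)
      < 1 + (q.steps + (roundProg T α n (obs f n e) q.val).steps)} ≤ 2 * (n : ENNReal)⁻¹ := by
  have hn3 : 3 ≤ n := by omega
  have hn0 : (0 : ℝ) < n := by exact_mod_cast (by omega : 0 < n)
  have hs := optBw_pos hn3 β
  have hlog := one_lt_log hn3
  have hkm : k₀ < m₀ := by
    have hq14 : bwRatio T Kmin Δ L ≤ 1 / 4 := min_le_left _ _
    have hx : 0 < n * optBw β n := by positivity
    have h : (4 : ℝ) ^ (k₀ - 1) < 4 ^ (m₀ - 1) := by nlinarith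
    have := (pow_lt_pow_iff_right₀ (by norm_num : (1 : ℝ) < 4)).1 h
    omega
  calc _ ≤ (randomIndices n).pr ({q | (q.val.2.toFinset.card : ℝ) < Real.log n ^ 2}
        ∪ {q | Real.log n ^ 2 ≤ (q.val.2.toFinset.card : ℝ) ∧
          ¬ SelfSimilarOn T β c₀ c₁ n f q.val.2.toFinset}) := by
        refine Prog.pr_le_of_sure ((sure_randomIndices_bounds (by omega)).mono fun q hq hlt => ?_)
        by_cases hcard : (q.val.2.toFinset.card : ℝ) < Real.log n ^ 2
        · exact Or.inl hcard
        refine Or.inr ⟨not_lt.1 hcard, fun hss => ?_⟩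
        have hne : q.val.2.toFinset.Nonempty := by
          rw [← Finset.card_pos]
          by_contra h
          rw [Nat.eq_zero_of_not_pos h, Nat.cast_zero] at hcard
          exact hcard (by positivity)
        have hv := violation_of_selfSimilar hK hκ hC hβ hβ2 hL hf hn3 hk₀ hkm.le hk2 hk3 hτ hc₀
          hR1 hR hm hhalf hq.1.2 hne hss he
        have hlt' := calm_lt_of_violation hk₀ hkm hv
        refine absurd hlt (not_lt.2
          (roundProg_steps_le T α (obs f n e) hq.2.1 hq.2.2.1 hq.2.2.2 ?_))
        exact Nat.pow_le_pow_right (by norm_num) hlt'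
    _ ≤ _ := Prog.pr_union_le _ _ _
    _ ≤ (n : ENNReal)⁻¹ + (n : ENNReal)⁻¹ :=
        add_le_add (pr_randomIndices_card_lt_le hn hsq) hself
    _ = _ := (two_mul _).symm

/-- Under self-similarity, the cost of a round is governed by the optimal bandwidth. -/
theorem eventually_steps_selfSimilar (hK : KernelAssumptions T.K T.Kmax Kmin Δ T.LK) (hσ : 0 < T.σ)
    (hκ : 0 < T.κ) (hC : 0 < T.Crho) (hβ : 0 < β) (hβ2 : β ≤ 2) (hL : 0 < L)
    {α : ℝ} (h0 : 0 < α) (h1 : α < 1) {c₀ c₁ : ℝ} (hc₀ : 0 < c₀) :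
    ∃ c > (0 : ℝ), ∀ᶠ n : ℕ in atTop, ∀ C ≥ 4 * gammaConst T Kmin Δ L,
      ∀ f ∈ Alternative β L (C * sepRate β n), GloballySelfSimilar T β c₀ c₁ n f →
        ENNReal.ofReal (1 - α) ≤ probSteps T α n f
          (c * ((exceedance (⌈β⌉₊ - 1) (gammaConst T Kmin Δ L * sepRate β n) f)⁻¹
            * (n : ℝ) ^ (2 * β / (2 * β + 1))
            * Real.log n ^ ((4 * β + 3) / (2 * β + 1)))) := by
  have hq := bwRatio_pos (Kmin := Kmin) (Δ := Δ) hκ hC hL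
  have hV : 0 < T.σ ^ 2 * (T.Kmax / massConst Kmin Δ) := by
    have h1 := massConst_pos hK
    have h2 := hK.Kmax_pos
    positivity
  set V := T.σ ^ 2 * (T.Kmax / massConst Kmin Δ) with hVdef
  -- with this factor, all stochastic errors are clean with probability `1 - O(log n / n)`
  set τ := √(4 * V) with hτ
  have hτ2 : τ ^ 2 / (2 * V) = 2 := by
    rw [hτ, Real.sq_sqrt (by positivity)]; field_simp; norm_num
  obtain ⟨R, hR, hR1⟩ := (((tendsto_rpow_atTop hβ).eventually_gt_atTop
    (((5 * (T.κ * T.Crho) + τ) * (2 / √(bwRatio T Kmin Δ L)) + τ) / c₀)).and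
      (eventually_ge_atTop 1)).exists
  rw [div_lt_iff₀' hc₀] at hR
  have hR0 : 0 < R := by linarith
  have hlogα : 0 ≤ Real.log (4 / α) := Real.log_nonneg (by rw [le_div_iff₀ h0]; linarith)
  refine ⟨10 + (16 * Real.log (4 / α) + 1) * (170000 * (16 * R)), by positivity, ?_⟩
  filter_upwards [eventually_detects hK hσ hκ hC hβ hβ2 hL h0 h1, eventually_ge_atTop 4,
    eventually_log_pow_le_mul_optBw hβ 0 hq, eventually_log_pow_le_mul_optBw hβ 2 one_pos,
    eventually_optBw_le hβ (by positivity : 0 < 1 / (8 * R)), eventually_sqrt_le,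
    eventually_noise_small_all h0, eventually_rounds_mul_le h0 h1]
    with n hdet hn hbig hlogle hsmall hsq hnoise hrounds C hCC f hf hself
  obtain ⟨ε, hεeq, hε, hε1, Bad, hBad, hrej⟩ := hdet C hCC f hf
  have hn3 : 3 ≤ n := by omega
  have hn0 : (0 : ℝ) < n := by exact_mod_cast (by omega : 0 < n)
  have hs := optBw_pos hn3 β
  have hlog := one_lt_log hn3
  rw [pow_zero] at hbig
  rw [one_mul] at hlogle
  have hl1 : 1 ≤ Real.log n ^ 2 := one_le_pow₀ hlog.le
  obtain ⟨k₀, hk₀, -, hk2, hk3⟩ := exists_optLevel (T := T) (Kmin := Kmin) (Δ := Δ) (L := L)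
    hβ hβ2 hn3 hbig
  obtain ⟨k, hk, hk4, hk5⟩ := exists_level (x := R * (n * optBw β n))
    (one_le_mul_of_one_le_of_one_le hR1 (hl1.trans hlogle))
  have hpow : (4 : ℝ) ^ k = 4 * 4 ^ (k - 1) := by
    rw [← pow_succ']; congr 1; omega
  have hsR : optBw β n * (8 * R) ≤ 1 := by
    rwa [le_div_iff₀ (by positivity)] at hsmall
  have h2N' : 2 * (4 : ℝ) ^ k ≤ n := by rw [hpow]; nlinarith
  have h2N : 2 * 4 ^ (k + 1 - 1) ≤ n := by
    rw [Nat.add_sub_cancel]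
    exact_mod_cast h2N'
  have hhalf : bw n (k + 1) ≤ 1 / 2 := by
    rw [bw, Nat.add_sub_cancel, div_le_iff₀ hn0]; linarith
  set Bad' := {e | ¬ CleanNoise T n (k + 1) τ e (List.range' 1 n)} with hBad'
  have hBadm : noiseLaw T.σ Bad' ≤ ENNReal.ofReal (α / 4) := by
    refine (measure_not_cleanNoise_le hK hσ (Real.sqrt_nonneg _) h2N fun a ha => ?_).trans ?_
    · rw [List.mem_range'_1] at ha
      rw [Finset.mem_Icc]
      omega
    · rw [← hVdef, hτ2, List.length_range']
      exact hnoise (k + 1) (level_le_log h2N)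
  rw [← hεeq, mul_assoc ε⁻¹, ← log_sq_mul_optBw hn3 hβ]
  refine le_probSteps (B := roundCost n (4 ^ (k + 1))) h0 h1 hε hε1 (Bad := Bad ∪ Bad') ?_
    (fun e he => ?_) hrounds (fun e he => hrej e fun h => he (Or.inl h))
    (total_le h0 h1 hε hε1 ?_ ?_)
  · refine (measure_union_le _ _).trans ((add_le_add hBad hBadm).trans (le_of_eq ?_))
    rw [← ENNReal.ofReal_add (by linarith) (by linarith)]
    congr 1; ring
  · have hclean : CleanNoise T n (k + 1) τ e (List.range' 1 n) := by
      by_contra h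
      exact he (Or.inr h)
    refine pr_round_cost_le hK hκ hC hβ hβ2 hL hf.1 hn hsq hk₀ hk2 hk3 (Real.sqrt_nonneg _) hc₀
      hR1 hR ?_ hhalf hself hclean
    rw [Nat.add_sub_cancel, hpow]
    exact hk5.le
  · exact one_le_mul_of_one_le_of_one_le hl1 (hl1.trans hlogle)
  · refine (roundCost_le hn3 (X := 16 * R * (n * optBw β n)) ?_ ?_).trans (le_of_eq (by ring))
    · push_cast
      rw [pow_succ, hpow]
      linarith
    · have : 0 < n * optBw β n := by positivity
      nlinarith

/-- The worst case: all rounds are carried out, with the largest bandwidth. -/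
theorem eventually_steps_worst_case (T : Tuning) {α : ℝ} (h0 : 0 < α) (h1 : α < 1) :
    ∀ᶠ n : ℕ in atTop, ∀ Y : ℕ → ℝ, ∀ r ∈ PMF.support (afomt T α n Y),
      (r.steps : ℝ) ≤ 680010 * (numRounds α n
        * (n : ℝ) ^ (4 / 5 : ℝ) * Real.log n ^ (11 / 5 : ℝ)) := by
  filter_upwards [eventually_roundCost_le, eventually_one_le_numRounds h0 h1,
    eventually_ge_atTop 3] with n hcost hr hn Y r hsupp
  have hlog := one_lt_log hn
  have hn1 : (1 : ℝ) ≤ n := by exact_mod_cast (by omega : 1 ≤ n)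
  have hsure : (afomt T α n Y).Sure fun r =>
      r.steps ≤ 10 + ⌊numRounds α n⌋₊ * roundCost n (4 * 4 ^ numBw n) := by
    rw [afomt_eq]
    refine Prog.sure_lift_bind ?_
    refine (sure_afomtLoop (sure_round_cost T α (by omega) Y) _).mono fun r hr => ?_
    exact Nat.add_le_add_left hr 10
  have hle : (r.steps : ℝ) ≤ ((10 + ⌊numRounds α n⌋₊ * roundCost n (4 * 4 ^ numBw n) : ℕ) : ℝ) := by
    exact_mod_cast hsure r hsupp
  push_cast at hle
  have hfl : (⌊numRounds α n⌋₊ : ℝ) ≤ numRounds α n := Nat.floor_le (by linarith)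
  set X := (n : ℝ) ^ (4 / 5 : ℝ) * Real.log n ^ (11 / 5 : ℝ) with hX
  have hX1 : 1 ≤ X := one_le_mul_of_one_le_of_one_le (Real.one_le_rpow hn1 (by norm_num))
    (Real.one_le_rpow hlog.le (by norm_num))
  rw [mul_assoc (numRounds α n), ← hX]
  have h2 : 1 ≤ numRounds α n * X := one_le_mul_of_one_le_of_one_le hr hX1
  have h3 : (⌊numRounds α n⌋₊ : ℝ) * roundCost n (4 * 4 ^ numBw n)
      ≤ numRounds α n * (680000 * X) := by gcongr
  linarith

end

end AFOMT

theorem mainTheorem8 (T : AFOMT.Tuning) (Kmin Δ : ℝ)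
    (hK : AFOMT.KernelAssumptions T.K T.Kmax Kmin Δ T.LK)
    (hσ : 0 < T.σ) (hlam : 0 < T.lam0)
    (hκ : 1 + 2 * T.Kmax / √(AFOMT.mu2 T.K) < T.κ)
    (β L : ℝ) (hβ : 0 < β) (hβ2 : β ≤ 2) (hL : 0 < L) :
    ∃ C₀ > (0 : ℝ), ∃ Cβ > (0 : ℝ), ∀ C ≥ C₀, ∀ α ∈ Set.Ioo (0 : ℝ) 1,
      -- (i)
      (∃ c > (0 : ℝ), ∃ n₀ : ℕ, ∀ n ≥ n₀,
        ∀ f ∈ AFOMT.Alternative β L (C * AFOMT.sepRate β n),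
          ENNReal.ofReal (1 - α) ≤ AFOMT.probSteps T α n f
            (c * ((AFOMT.exceedance (⌈β⌉₊ - 1) (Cβ * AFOMT.sepRate β n) f)⁻¹
              * (n : ℝ) ^ (4 / 5 : ℝ) * Real.log n ^ (11 / 5 : ℝ)))) ∧
      -- (ii)
      (∀ c₀ > (0 : ℝ), ∀ c₁ > (0 : ℝ), ∃ c > (0 : ℝ), ∃ n₀ : ℕ, ∀ n ≥ n₀,
        ∀ f ∈ AFOMT.Alternative β L (C * AFOMT.sepRate β n),
          AFOMT.GloballySelfSimilar T β c₀ c₁ n f →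
          ENNReal.ofReal (1 - α) ≤ AFOMT.probSteps T α n f
            (c * ((AFOMT.exceedance (⌈β⌉₊ - 1) (Cβ * AFOMT.sepRate β n) f)⁻¹
              * (n : ℝ) ^ (2 * β / (2 * β + 1))
              * Real.log n ^ ((4 * β + 3) / (2 * β + 1))))) ∧
      -- (iii)
      (∃ c > (0 : ℝ), ∃ n₀ : ℕ, ∀ n ≥ n₀, ∀ Y : ℕ → ℝ,
        ∀ r ∈ PMF.support (AFOMT.afomt T α n Y),
          (r.steps : ℝ) ≤ c * (AFOMT.numRounds α n
            * (n : ℝ) ^ (4 / 5 : ℝ) * Real.log n ^ (11 / 5 : ℝ)) ∧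
          (r.steps : ℝ) ≤ c * ((n : ℝ) ^ (9 / 5 : ℝ) * Real.log n ^ (6 / 5 : ℝ))) := by
  have hκ0 := AFOMT.kappa_pos hK.Kmax_pos hκ
  have hC := AFOMT.Crho_pos (AFOMT.mu2_pos hK) hσ hlam
  have hγ : 0 < AFOMT.gammaConst T Kmin Δ L := by
    have := AFOMT.dropConst_pos (Kmin := Kmin) (Δ := Δ) hσ hκ0 hC hL
    unfold AFOMT.gammaConst
    positivity
  refine ⟨4 * AFOMT.gammaConst T Kmin Δ L, by positivity, AFOMT.gammaConst T Kmin Δ L, hγ,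
    fun C hCC α hα => ⟨?_, fun c₀ hc₀ c₁ _ => ?_, ?_⟩⟩
  · obtain ⟨n₀, hn₀⟩ := Filter.eventually_atTop.1
      (AFOMT.eventually_steps hK hσ hκ0 hC hβ hβ2 hL hα.1 hα.2)
    have hlog : 0 ≤ Real.log (4 / α) :=
      Real.log_nonneg (by rw [le_div_iff₀ hα.1]; linarith [hα.2])
    exact ⟨_, by positivity, n₀, fun n hn f hf => hn₀ n hn C hCC f hf⟩
  · obtain ⟨c, hc, hev⟩ := AFOMT.eventually_steps_selfSimilar (c₁ := c₁) hK hσ hκ0 hC hβ hβ2 hL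
      hα.1 hα.2 hc₀
    obtain ⟨n₀, hn₀⟩ := Filter.eventually_atTop.1 hev
    exact ⟨c, hc, n₀, fun n hn f hf hself => hn₀ n hn C hCC f hf hself⟩
  · obtain ⟨n₀, hn₀⟩ := Filter.eventually_atTop.1
      ((AFOMT.eventually_steps_worst_case T hα.1 hα.2).and (Filter.eventually_ge_atTop 3))
    have hl := AFOMT.log_half_neg hα.1 hα.2
    -- the factor accounts for `numRounds α n = -log (α / 2) * n / log n`
    refine ⟨680010 * (1 - Real.log (α / 2)), by nlinarith, n₀, fun n hn Y r hr => ?_⟩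
    obtain ⟨h1, h3⟩ := hn₀ n hn
    have h := h1 Y r hr
    have hlog := AFOMT.one_lt_log h3
    rw [AFOMT.numRounds_mul h3] at h ⊢
    have hX : 0 ≤ (n : ℝ) ^ (9 / 5 : ℝ) * Real.log n ^ (6 / 5 : ℝ) := by positivity
    generalize (n : ℝ) ^ (9 / 5 : ℝ) * Real.log n ^ (6 / 5 : ℝ) = X at h hX ⊢
    have hlX : 0 ≤ -Real.log (α / 2) * X := mul_nonneg (by linarith) hX
    constructor
    · nlinarith
    · nlinarith
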